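/- Let $(M,g,J)$ be a Kähler manifold: a smooth Riemannian manifold with Levi-Civita connection $\nabla$ and a smooth orthogonal almost complex structure $J$ with $\nabla J=0$. Let $\mathcal F$ be a (regular) complex Riemannian foliation of $M$ with tangent distribution $\mathcal V$ and $\mathcal H=\mathcal V^{\perp}$; that is, $\mathcal V$ is a smooth integrable distribution with $J\mathcal V=\mathcal V$, and $(L_Vg)(X,Y)=0$ for all local sections $V$ of $\mathcal V$ and $X,Y$ of $\mathcal H$. Denote by $E_{\mathcal V},E_{\mathcal H}$ the orthogonal components of a vector field $E$ and by $$A_EF=(\nabla_{E_{\mathcal H}}F_{\mathcal H})_{\mathcal V}+(\nabla_{E_{\mathcal H}}F_{\mathcal V})_{\mathcal H},\qquad T_EF=(\nabla_{E_{\mathcal V}}F_{\mathcal V})_{\mathcal H}+(\nabla_{E_{\mathcal V}}F_{\mathcal H})_{\mathcal V}$$ the O'Neill tensors of $\mathcal F$. A foliation is called totally geodesic if its tensor $T$ vanishes identically, and polar if its tensor $A$ vanishes identically. At each point let $A_{\mathcal H}\mathcal H\subset\mathcal V$ be the span of the vectors $A_XY$ with $X,Y\in\mathcal H$, and let $\mathcal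 V_0=\mathcal V\cap(A_{\mathcal H}\mathcal H)^{\perp}$ be its orthogonal complement in $\mathcal V$. Then either $\mathcal F$ is totally geodesic, or there is a non-empty connected open set $U\subset M$ on which $\mathcal V_0$ is nowhere zero and is a smooth integrable distribution whose integral manifolds form a polar complex Riemannian foliation of $U$ (so the O'Neill tensor $A$ of the foliation of $U$ tangent to $\mathcal V_0$, with horizontal distribution $\mathcal V_0^{\perp}$, vanishes). -/

import Mathlib

open Bundle Set VectorField
open scoped Manifold ContDiff Topology

namespace KahlerFoliation

noncomputable section

section LeviCivita

set_option linter.unusedSectionVars false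

variable {E : Type*} [NormedAddCommGroup E] [NormedSpace ℝ E] [FiniteDimensional ℝ E]
  {M : Type*} [TopologicalSpace M] [ChartedSpace E M] [IsManifold 𝓘(ℝ, E) ∞ M]
  [RiemannianBundle (fun x : M => TangentSpace 𝓘(ℝ, E) x)]

instance instFiniteDimensionalTangentSpace (x : M) :
    FiniteDimensional ℝ (TangentSpace 𝓘(ℝ, E) x) :=
  inferInstanceAs (FiniteDimensional ℝ E)

/-- The right hand side of the Koszul formula for `2 ⟨∇_X Y, Z⟩`. -/
def koszul (X Y Z : Π x : M, TangentSpace 𝓘(ℝ, E) x) (x : M) : ℝ :=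
  d% (fun y => inner ℝ (Y y) (Z y)) x (X x)
    + d% (fun y => inner ℝ (X y) (Z y)) x (Y x)
    - d% (fun y => inner ℝ (X y) (Y y)) x (Z x)
    + inner ℝ (mlieBracket 𝓘(ℝ, E) X Y x) (Z x)
    - inner ℝ (mlieBracket 𝓘(ℝ, E) X Z x) (Y x)
    - inner ℝ (mlieBracket 𝓘(ℝ, E) Y Z x) (X x)

variable [IsContMDiffRiemannianBundle 𝓘(ℝ, E) ∞ E (fun x : M => TangentSpace 𝓘(ℝ, E) x)]

theorem mdiff_inner {X Y : Π x : M, TangentSpace 𝓘(ℝ, E) x} {x : M}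
    (hX : MDiffAt (T% X) x) (hY : MDiffAt (T% Y) x) :
    MDiffAt (fun y => inner ℝ (X y) (Y y)) x :=
  MDifferentiableAt.inner_bundle (E := fun x : M => TangentSpace 𝓘(ℝ, E) x) hX hY

theorem koszul_tensorial_left (Y Z : Π x : M, TangentSpace 𝓘(ℝ, E) x) (x : M)
    (hY : MDiffAt (T% Y) x) (hZ : MDiffAt (T% Z) x) :
    TensorialAt 𝓘(ℝ, E) E (fun X => koszul X Y Z x) x where
  smul {f X} hf hX := by
    have : CompleteSpace E := FiniteDimensional.complete ℝ E
    simp [koszul, mlieBracket_smul_left hf hX, real_inner_smul_left, real_inner_smul_right,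
      mvfderiv_fun_mul hf (mdiff_inner hX hY),
      mvfderiv_fun_mul hf (mdiff_inner hX hZ), inner_add_left]
    rw [real_inner_comm (Y x) (X x), real_inner_comm (Z x) (X x)]
    ring
  add {X X'} hX hX' := by
    have : CompleteSpace E := FiniteDimensional.complete ℝ E
    simp [koszul, mlieBracket_add_left hX hX', inner_add_left, inner_add_right,
      mvfderiv_fun_add (mdiff_inner hX hY) (mdiff_inner hX' hY),
      mvfderiv_fun_add (mdiff_inner hX hZ) (mdiff_inner hX' hZ)]
    ring

theorem koszul_tensorial_right (X Y : Π x : M, TangentSpace 𝓘(ℝ, E) x) (x : M)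
    (hX : MDiffAt (T% X) x) (hY : MDiffAt (T% Y) x) :
    TensorialAt 𝓘(ℝ, E) E (fun Z => koszul X Y Z x) x where
  smul {f Z} hf hZ := by
    have : CompleteSpace E := FiniteDimensional.complete ℝ E
    simp [koszul, mlieBracket_smul_right hf hZ, real_inner_smul_left, real_inner_smul_right,
      mvfderiv_fun_mul hf (mdiff_inner hY hZ),
      mvfderiv_fun_mul hf (mdiff_inner hX hZ), inner_add_left]
    rw [real_inner_comm (Y x) (Z x), real_inner_comm (X x) (Z x)]
    ring
  add {Z Z'} hZ hZ' := by
    have : CompleteSpace E := FiniteDimensional.complete ℝ E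
    simp [koszul, mlieBracket_add_right hZ hZ', inner_add_left, inner_add_right,
      mvfderiv_fun_add (mdiff_inner hX hZ) (mdiff_inner hX hZ'),
      mvfderiv_fun_add (mdiff_inner hY hZ) (mdiff_inner hY hZ')]
    ring

theorem koszul_add_middle {X Y Y' Z : Π x : M, TangentSpace 𝓘(ℝ, E) x} {x : M}
    (hX : MDiffAt (T% X) x) (hY : MDiffAt (T% Y) x) (hY' : MDiffAt (T% Y') x)
    (hZ : MDiffAt (T% Z) x) :
    koszul X (Y + Y') Z x = koszul X Y Z x + koszul X Y' Z x := by
  have : CompleteSpace E := FiniteDimensional.complete ℝ E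
  simp [koszul, mlieBracket_add_right hY hY', mlieBracket_add_left hY hY',
    inner_add_left, inner_add_right,
    mvfderiv_fun_add (mdiff_inner hX hY) (mdiff_inner hX hY'),
    mvfderiv_fun_add (mdiff_inner hY hZ) (mdiff_inner hY' hZ)]
  ring

theorem koszul_smul_middle {X Y Z : Π x : M, TangentSpace 𝓘(ℝ, E) x} {f : M → ℝ} {x : M}
    (hX : MDiffAt (T% X) x) (hY : MDiffAt (T% Y) x) (hZ : MDiffAt (T% Z) x)
    (hf : MDiffAt f x) :
    koszul X (f • Y) Z x = f x * koszul X Y Z x + 2 * d% f x (X x) * inner ℝ (Y x) (Z x) := by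
  have : CompleteSpace E := FiniteDimensional.complete ℝ E
  simp [koszul, mlieBracket_smul_right hf hY, mlieBracket_smul_left hf hY,
    real_inner_smul_left, real_inner_smul_right, mvfderiv_fun_mul hf (mdiff_inner hX hY),
    mvfderiv_fun_mul hf (mdiff_inner hY hZ), inner_add_left]
  rw [real_inner_comm (Y x) (X x)]
  ring

/-- The Koszul expression as a bilinear form in the first and third arguments, for a fixed vector
field `Y` differentiable at `x`. -/
def koszulForm (Y : Π x : M, TangentSpace 𝓘(ℝ, E) x) (x : M) (hY : MDiffAt (T% Y) x) :
    TangentSpace 𝓘(ℝ, E) x →L[ℝ] TangentSpace 𝓘(ℝ, E) x →L[ℝ] ℝ :=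
  TensorialAt.mkHom₂ (I := 𝓘(ℝ, E)) (F := E) (F' := E) (fun X Z => koszul X Y Z x) x
    (fun Z hZ => koszul_tensorial_left Y Z x hY hZ)
    (fun X hX => koszul_tensorial_right X Y x hX hY)

theorem koszulForm_apply {X Y Z : Π x : M, TangentSpace 𝓘(ℝ, E) x} {x : M}
    (hX : MDiffAt (T% X) x) (hY : MDiffAt (T% Y) x) (hZ : MDiffAt (T% Z) x) :
    koszulForm Y x hY (X x) (Z x) = koszul X Y Z x :=
  TensorialAt.mkHom₂_apply (I := 𝓘(ℝ, E)) (F := E) (F' := E)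
    (Φ := fun X Z => koszul X Y Z x) (x := x)
    (fun Z hZ => koszul_tensorial_left Y Z x hY hZ)
    (fun X hX => koszul_tensorial_right X Y x hX hY) hX hZ

open Classical in
/-- The covariant derivative `u ↦ ∇_u Y` at `x`, determined by `2 ⟨∇_u Y, w⟩ = koszul u Y w`.
It is set to zero at the points where `Y` is not differentiable. -/
def leviCivitaFun (Y : Π x : M, TangentSpace 𝓘(ℝ, E) x) (x : M) :
    TangentSpace 𝓘(ℝ, E) x →L[ℝ] TangentSpace 𝓘(ℝ, E) x :=
  if hY : MDiffAt (T% Y) x then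
    LinearMap.toContinuousLinearMap
      { toFun := fun u => (1 / 2 : ℝ) •
          (InnerProductSpace.toDual ℝ (TangentSpace 𝓘(ℝ, E) x)).symm (koszulForm Y x hY u)
        map_add' := fun u v => by simp
        map_smul' := fun c u => by simp [smul_comm c] }
  else 0

theorem inner_leviCivitaFun {X Y Z : Π x : M, TangentSpace 𝓘(ℝ, E) x} {x : M}
    (hX : MDiffAt (T% X) x) (hY : MDiffAt (T% Y) x) (hZ : MDiffAt (T% Z) x) :
    inner ℝ (leviCivitaFun Y x (X x)) (Z x) = koszul X Y Z x / 2 := by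
  rw [← koszulForm_apply hX hY hZ]
  simp only [leviCivitaFun, dif_pos hY]
  simp [real_inner_smul_left]
  ring

theorem mdiff_extend {x : M} (u : TangentSpace 𝓘(ℝ, E) x) :
    MDiffAt (T% (FiberBundle.extend E u)) x :=
  FiberBundle.mdifferentiableAt_extend ..

theorem inner_leviCivitaFun_extend {Y : Π x : M, TangentSpace 𝓘(ℝ, E) x} {x : M}
    (hY : MDiffAt (T% Y) x) (u w : TangentSpace 𝓘(ℝ, E) x) :
    inner ℝ (leviCivitaFun Y x u) w
      = koszul (FiberBundle.extend E u) Y (FiberBundle.extend E w) x / 2 := by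
  have h := inner_leviCivitaFun (mdiff_extend u) hY (mdiff_extend w)
  simpa using h

variable (E M) in
/-- The Levi-Civita connection of the Riemannian metric: `leviCivita E M Y x u` is `∇_u Y` at `x`.
It is torsion-free and metric by `leviCivita_torsionFree` and `leviCivita_metric`, and these two
properties determine it. -/
def leviCivita : CovariantDerivative 𝓘(ℝ, E) E (fun x : M => TangentSpace 𝓘(ℝ, E) x) where
  toFun := leviCivitaFun
  isCovariantDerivativeOnUniv :=
    { add := by
        intro Y Y' x hY hY' _
        ext u
        refine ext_inner_right ℝ fun w => ?_
        rw [inner_leviCivitaFun_extend (mdifferentiableAt_add_section hY hY')]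
        rw [koszul_add_middle (mdiff_extend u) hY hY' (mdiff_extend w)]
        rw [add_apply, inner_add_left, inner_leviCivitaFun_extend hY,
          inner_leviCivitaFun_extend hY']
        ring
      leibniz := by
        intro Y f x hY hf _
        ext u
        refine ext_inner_right ℝ fun w => ?_
        rw [inner_leviCivitaFun_extend (hf.smul_section hY)]
        rw [koszul_smul_middle (mdiff_extend u) hY (mdiff_extend w) hf]
        rw [add_apply, inner_add_left, smul_apply,
          real_inner_smul_left, inner_leviCivitaFun_extend hY]
        simp [real_inner_smul_left]
        ring }

/-- `∇_X Y - ∇_Y X = [X, Y]`. -/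
theorem leviCivita_torsionFree {X Y : Π x : M, TangentSpace 𝓘(ℝ, E) x} {x : M}
    (hX : MDiffAt (T% X) x) (hY : MDiffAt (T% Y) x) :
    leviCivita E M Y x (X x) - leviCivita E M X x (Y x) = mlieBracket 𝓘(ℝ, E) X Y x := by
  refine ext_inner_right ℝ fun w => ?_
  have h1 := inner_leviCivitaFun hX hY (mdiff_extend w)
  have h2 := inner_leviCivitaFun hY hX (mdiff_extend w)
  simp only [FiberBundle.extend_apply_self] at h1 h2
  change inner ℝ (leviCivitaFun Y x (X x) - leviCivitaFun X x (Y x)) w = _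
  rw [inner_sub_left, h1, h2, koszul, koszul, mlieBracket_swap_apply (V := Y) (W := X)]
  simp only [FiberBundle.extend_apply_self, inner_neg_left, real_inner_comm]
  ring

/-- `X ⟨Y, Z⟩ = ⟨∇_X Y, Z⟩ + ⟨Y, ∇_X Z⟩`. -/
theorem leviCivita_metric {X Y Z : Π x : M, TangentSpace 𝓘(ℝ, E) x} {x : M}
    (hX : MDiffAt (T% X) x) (hY : MDiffAt (T% Y) x) (hZ : MDiffAt (T% Z) x) :
    d% (fun y => inner ℝ (Y y) (Z y)) x (X x)
      = inner ℝ (leviCivita E M Y x (X x)) (Z x) + inner ℝ (Y x) (leviCivita E M Z x (X x)) := by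
  change _ = inner ℝ (leviCivitaFun Y x (X x)) (Z x) + inner ℝ (Y x) (leviCivitaFun Z x (X x))
  rw [real_inner_comm (leviCivitaFun Z x (X x)) (Y x), inner_leviCivitaFun hX hY hZ,
    inner_leviCivitaFun hX hZ hY]
  rw [koszul, koszul, mlieBracket_swap_apply (V := Z) (W := Y)]
  simp only [inner_neg_left, real_inner_comm]
  ring

end LeviCivita

section Foliations

variable {E : Type*} [NormedAddCommGroup E] [NormedSpace ℝ E]
  {M : Type*} [TopologicalSpace M] [ChartedSpace E M] [IsManifold 𝓘(ℝ, E) ∞ M]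

/-- `X` is a smooth section over `W` of the distribution `D`. -/
def IsSectionOn (D : Π x : M, Submodule ℝ (TangentSpace 𝓘(ℝ, E) x)) (W : Set M)
    (X : Π x : M, TangentSpace 𝓘(ℝ, E) x) : Prop :=
  CMDiff[W] ∞ (T% X) ∧ ∀ x ∈ W, X x ∈ D x

/-- `D` is a smooth distribution (a smooth subbundle of the tangent bundle) over the open set `U`:
near every point of `U` it has a smooth frame. -/
def IsSmoothDistributionOn (U : Set M) (D : Π x : M, Submodule ℝ (TangentSpace 𝓘(ℝ, E) x)) :
    Prop :=
  ∀ p ∈ U, ∃ W ⊆ U, IsOpen W ∧ p ∈ W ∧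
    ∃ (k : ℕ) (X : Fin k → Π x : M, TangentSpace 𝓘(ℝ, E) x),
      (∀ i, CMDiff[W] ∞ (T% (X i))) ∧
      ∀ x ∈ W, LinearIndependent ℝ (fun i => X i x) ∧
        Submodule.span ℝ (range fun i => X i x) = D x

/-- `f`, restricted to the open set `N` of `ℝᵏ`, is an injective immersion into `U` whose image is
an integral manifold of `D`: its tangent space at every point `f z` is `D (f z)`. -/
structure IsIntegralManifoldIn (U : Set M) (D : Π x : M, Submodule ℝ (TangentSpace 𝓘(ℝ, E) x))
    {k : ℕ} (N : Set (EuclideanSpace ℝ (Fin k))) (f : EuclideanSpace ℝ (Fin k) → M) : Prop where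
  isOpen : IsOpen N
  mapsTo : MapsTo f N U
  injOn : InjOn f N
  contMDiffOn : CMDiff[N] ∞ f
  injective_mfderiv : ∀ z ∈ N, Function.Injective
    (mfderiv 𝓘(ℝ, EuclideanSpace ℝ (Fin k)) 𝓘(ℝ, E) f z)
  range_mfderiv : ∀ z ∈ N,
    (mfderiv 𝓘(ℝ, EuclideanSpace ℝ (Fin k)) 𝓘(ℝ, E) f z).range = D (f z)

/-- `D` is integrable over `U`: every point of `U` lies on an integral manifold of `D`. -/
def IsIntegrableOn (U : Set M) (D : Π x : M, Submodule ℝ (TangentSpace 𝓘(ℝ, E) x)) : Prop :=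
  ∀ p ∈ U, ∃ (k : ℕ) (N : Set (EuclideanSpace ℝ (Fin k))) (f : EuclideanSpace ℝ (Fin k) → M),
    IsIntegralManifoldIn U D N f ∧ p ∈ f '' N

/-- `D` is the tangent distribution of a (regular) foliation of the open set `U`, the leaves being
the maximal connected integral manifolds of `D` in `U`. A foliation is given by this
distribution. -/
structure IsFoliationOn (U : Set M) (D : Π x : M, Submodule ℝ (TangentSpace 𝓘(ℝ, E) x)) :
    Prop where
  smooth : IsSmoothDistributionOn U D
  integrable : IsIntegrableOn U D

variable [RiemannianBundle (fun x : M => TangentSpace 𝓘(ℝ, E) x)]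

/-- The foliation tangent to `D` is Riemannian on `U`: `(L_V g)(X, Y) = 0`, that is
`V ⟨X, Y⟩ = ⟨[V, X], Y⟩ + ⟨X, [V, Y]⟩`, for `V` tangent to the leaves and `X`, `Y` orthogonal to
them. -/
def IsRiemannianOn (U : Set M) (D : Π x : M, Submodule ℝ (TangentSpace 𝓘(ℝ, E) x)) : Prop :=
  ∀ W ⊆ U, IsOpen W → ∀ V X Y : Π x : M, TangentSpace 𝓘(ℝ, E) x,
    IsSectionOn D W V → IsSectionOn (fun x => (D x)ᗮ) W X → IsSectionOn (fun x => (D x)ᗮ) W Y →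
    ∀ x ∈ W, d% (fun y => inner ℝ (X y) (Y y)) x (V x)
      = inner ℝ (mlieBracket 𝓘(ℝ, E) V X x) (Y x) + inner ℝ (X x) (mlieBracket 𝓘(ℝ, E) V Y x)

/-- `D` is tangent to a foliation of `U` that is Riemannian and complex, the latter meaning that
the leaves are complex submanifolds: their tangent spaces are preserved by `J`. -/
structure IsComplexRiemannianFoliationOn
    (J : Π x : M, TangentSpace 𝓘(ℝ, E) x →L[ℝ] TangentSpace 𝓘(ℝ, E) x)
    (U : Set M) (D : Π x : M, Submodule ℝ (TangentSpace 𝓘(ℝ, E) x)) : Prop where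
  foliation : IsFoliationOn U D
  complex : ∀ x ∈ U, ∀ v ∈ D x, J x v ∈ D x
  riemannian : IsRiemannianOn U D

variable [FiniteDimensional ℝ E]

/-- The component tangent to `D` of a vector field. -/
def vert (D : Π x : M, Submodule ℝ (TangentSpace 𝓘(ℝ, E) x))
    (X : Π x : M, TangentSpace 𝓘(ℝ, E) x) (x : M) : TangentSpace 𝓘(ℝ, E) x :=
  (D x).starProjection (X x)

/-- The component orthogonal to `D` of a vector field. -/
def hor (D : Π x : M, Submodule ℝ (TangentSpace 𝓘(ℝ, E) x))
    (X : Π x : M, TangentSpace 𝓘(ℝ, E) x) (x : M) : TangentSpace 𝓘(ℝ, E) x :=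
  (D x)ᗮ.starProjection (X x)

variable [IsContMDiffRiemannianBundle 𝓘(ℝ, E) ∞ E (fun x : M => TangentSpace 𝓘(ℝ, E) x)]

/-- `J` is a Kähler structure for the given Riemannian metric: an orthogonal almost complex
structure that is parallel for the Levi-Civita connection. -/
structure IsKahler (J : Π x : M, TangentSpace 𝓘(ℝ, E) x →L[ℝ] TangentSpace 𝓘(ℝ, E) x) :
    Prop where
  smooth : ContMDiff 𝓘(ℝ, E) (𝓘(ℝ, E).prod 𝓘(ℝ, E →L[ℝ] E)) ∞
    (fun x => TotalSpace.mk' (E →L[ℝ] E)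
      (E := fun x : M => TangentSpace 𝓘(ℝ, E) x →L[ℝ] TangentSpace 𝓘(ℝ, E) x) x (J x))
  sq : ∀ (x : M) (v : TangentSpace 𝓘(ℝ, E) x), J x (J x v) = -v
  isometry : ∀ (x : M) (v w : TangentSpace 𝓘(ℝ, E) x), inner ℝ (J x v) (J x w) = inner ℝ v w
  parallel : ∀ (Y : Π x : M, TangentSpace 𝓘(ℝ, E) x) (x : M), MDiffAt (T% Y) x →
    ∀ u, leviCivita E M (fun y => J y (Y y)) x u = J x (leviCivita E M Y x u)

/-- The O'Neill tensor `A_X Y = (∇_{X_H} Y_H)_V + (∇_{X_H} Y_V)_H` of the distribution `D`,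
where `V` and `H` denote the components tangent and orthogonal to `D`. -/
def oneillA (D : Π x : M, Submodule ℝ (TangentSpace 𝓘(ℝ, E) x))
    (X Y : Π x : M, TangentSpace 𝓘(ℝ, E) x) (x : M) : TangentSpace 𝓘(ℝ, E) x :=
  (D x).starProjection (leviCivita E M (hor D Y) x (hor D X x))
    + (D x)ᗮ.starProjection (leviCivita E M (vert D Y) x (hor D X x))

/-- The O'Neill tensor `T_X Y = (∇_{X_V} Y_V)_H + (∇_{X_V} Y_H)_V` of the distribution `D`. -/
def oneillT (D : Π x : M, Submodule ℝ (TangentSpace 𝓘(ℝ, E) x))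
    (X Y : Π x : M, TangentSpace 𝓘(ℝ, E) x) (x : M) : TangentSpace 𝓘(ℝ, E) x :=
  (D x)ᗮ.starProjection (leviCivita E M (vert D Y) x (vert D X x))
    + (D x).starProjection (leviCivita E M (hor D Y) x (vert D X x))

/-- Polar: the O'Neill tensor `A` vanishes on `U`. -/
def IsPolarOn (U : Set M) (D : Π x : M, Submodule ℝ (TangentSpace 𝓘(ℝ, E) x)) : Prop :=
  ∀ W ⊆ U, IsOpen W → ∀ X Y : Π x : M, TangentSpace 𝓘(ℝ, E) x,
    CMDiff[W] ∞ (T% X) → CMDiff[W] ∞ (T% Y) → ∀ x ∈ W, oneillA D X Y x = 0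

/-- Totally geodesic: the O'Neill tensor `T` vanishes on `U`. -/
def IsTotallyGeodesicOn (U : Set M) (D : Π x : M, Submodule ℝ (TangentSpace 𝓘(ℝ, E) x)) :
    Prop :=
  ∀ W ⊆ U, IsOpen W → ∀ X Y : Π x : M, TangentSpace 𝓘(ℝ, E) x,
    CMDiff[W] ∞ (T% X) → CMDiff[W] ∞ (T% Y) → ∀ x ∈ W, oneillT D X Y x = 0

/-- The space `A_H H` at `x`: the span of the values at `x` of `A_X Y`, for `X` and `Y` smooth
vector fields orthogonal to `D` near `x`. -/
def aHH (D : Π x : M, Submodule ℝ (TangentSpace 𝓘(ℝ, E) x)) (x : M) :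
    Submodule ℝ (TangentSpace 𝓘(ℝ, E) x) :=
  Submodule.span ℝ {v | ∃ (W : Set M) (X Y : Π x : M, TangentSpace 𝓘(ℝ, E) x),
    IsOpen W ∧ x ∈ W ∧ IsSectionOn (fun y => (D y)ᗮ) W X ∧ IsSectionOn (fun y => (D y)ᗮ) W Y ∧
    v = oneillA D X Y x}

/-- The orthogonal complement `V₀` of `A_H H` inside `D`. -/
def vZero (D : Π x : M, Submodule ℝ (TangentSpace 𝓘(ℝ, E) x)) (x : M) :
    Submodule ℝ (TangentSpace 𝓘(ℝ, E) x) :=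
  D x ⊓ (aHH D x)ᗮ

end Foliations

end

end KahlerFoliation

/-! Write `A_X Y` and `T_U Z` for the vertical parts of `∇_X Y` and `∇_U Z`, with `X`, `Y`, `Z`
horizontal and `U` vertical. Since `J` is parallel and preserves the splitting, `A` is complex
bilinear on horizontal fields, so `A_{JX} JY = -A_X Y`, whereas `T_{JU} JZ = T_U Z`. The Kähler
curvature satisfies `R(JX, JY) = R(X, Y)`. Thus in any curvature identity the substitution of `JX,
JY` for `X, Y` separates the terms that contain `A_X Y` from the others.

This device is used four times. Applied to the vertical part of `R(X, Y)Z`, and then to the Bianchi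
identity, it gives `T_{A_X Y} Z = 0` (`t_a`) and the horizontal parallelism of `A` (`N_eq_zero`).
Applied to `⟨R(X, Y)B, W⟩` with `B` in `A_H H` and `W` in `V₀`, it gives `⟨∇_B (A_X Y), W⟩ = 0`
(`inner_D_a_a`). Applied to `⟨R(X, Y)V, W⟩` with `V`, `W` both in `V₀`, it gives `[V, W] ⊥ A_H H`
(`inner_bracket_a`).

Consequently `V₀` is involutive, and `⟨∇_ξ η, N⟩ = 0` for `ξ`, `η` taken from horizontal fields and
fields `A_X Y`, which span `V₀^⊥`, and `N` in `V₀`. This says both that `V₀` is Riemannian and that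
its tensor `A` vanishes. Frobenius' theorem, proved here through a total differential equation,
supplies the leaves.

By the symmetry of `T`, its vertical values are orthogonal to `A_H H`, hence lie in `V₀`
(`isFlat_t`). If `T` is not identically zero, then `V₀ ≠ 0` on a non-empty open set; inside it, near
a point where the rank of `A_H H` is maximal, `V₀` is a smooth distribution. -/

/-! ### O'Neill tensors and curvature, treated algebraically -/

/-- The algebra underlying a complex Riemannian foliation of a Kähler manifold: `𝔛` stands for the
vector fields, `C` for the functions, `D` for the Levi-Civita connection and `v` for the projection
to the tangent distribution of the foliation. -/
structure FoliatedKahlerModule (𝔛 C : Type*) [AddCommGroup 𝔛] [Module ℝ 𝔛]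
    [AddCommGroup C] [Module ℝ C] where
  g : 𝔛 →+ 𝔛 →+ C
  D : 𝔛 →+ 𝔛 →+ 𝔛
  J : 𝔛 →+ 𝔛
  v : 𝔛 →+ 𝔛
  symm : ∀ X Y, g X Y = g Y X
  definite : ∀ X, g X X = 0 → X = 0
  -- No derivative of a function along a field is available here. Metric compatibility is encoded by
  -- saying that the Leibniz expression depends only on the function `g A B`.
  metric : ∀ X {A B A' B'}, g A B = g A' B' →
    g (D X A) B + g A (D X B) = g (D X A') B' + g A' (D X B')
  jacobi : ∀ X Y Z, (D X (D Y Z) - D Y (D X Z) - D (D X Y - D Y X) Z)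
    + (D Y (D Z X) - D Z (D Y X) - D (D Y Z - D Z Y) X)
    + (D Z (D X Y) - D X (D Z Y) - D (D Z X - D X Z) Y) = 0
  curvature_skew : ∀ X Y Z W, g (D X (D Y Z) - D Y (D X Z) - D (D X Y - D Y X) Z) W
    = - g Z (D X (D Y W) - D Y (D X W) - D (D X Y - D Y X) W)
  J_sq : ∀ X, J (J X) = -X
  J_isometry : ∀ X Y, g (J X) (J Y) = g X Y
  J_parallel : ∀ X Y, D X (J Y) = J (D X Y)
  v_idem : ∀ X, v (v X) = v X
  v_symm : ∀ X Y, g (v X) Y = g X (v Y)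
  v_J : ∀ X, v (J X) = J (v X)
  involutive : ∀ {U W}, v U = U → v W = W → v (D U W - D W U) = D U W - D W U
  -- This is `(L_U g)(X, Y) = 0` rewritten with a torsion-free metric connection: the derivatives
  -- along `U` cancel.
  riemannian : ∀ {U X Y}, v U = U → v X = 0 → v Y = 0 → g (D X U) Y + g X (D Y U) = 0

namespace FoliatedKahlerModule

variable {𝔛 C : Type*} [AddCommGroup 𝔛] [Module ℝ 𝔛] [AddCommGroup C] [Module ℝ C]
  (S : FoliatedKahlerModule 𝔛 C)

/-- The curvature of the connection. -/
def R (X Y Z : 𝔛) : 𝔛 := S.D X (S.D Y Z) - S.D Y (S.D X Z) - S.D (S.D X Y - S.D Y X) Z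

/-- The horizontal projection. -/
def h : 𝔛 →+ 𝔛 := AddMonoidHom.id 𝔛 - S.v

theorem h_apply (X : 𝔛) : S.h X = X - S.v X := rfl

theorem split (X : 𝔛) : X = S.v X + S.h X := by rw [h_apply]; abel

theorem v_h (X : 𝔛) : S.v (S.h X) = 0 := by rw [h_apply, map_sub, S.v_idem, sub_self]

theorem ext_inner {X Y : 𝔛} (hg : ∀ W, S.g X W = S.g Y W) : X = Y := by
  rw [← sub_eq_zero]
  apply S.definite
  have (Z : 𝔛) (hZ : S.g X Z = S.g Y Z) : S.g (X - Y) Z = 0 := by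
    rw [map_sub, AddMonoidHom.sub_apply, hZ, sub_self]
  exact this _ (hg _)

theorem g_v_h {U X : 𝔛} (hU : S.v U = U) (hX : S.v X = 0) : S.g U X = 0 := by
  rw [← hU, S.v_symm, hX, map_zero]

theorem g_h_v {U X : 𝔛} (hU : S.v U = U) (hX : S.v X = 0) : S.g X U = 0 := by
  rw [S.symm, S.g_v_h hU hX]

theorem g_v_right {U : 𝔛} (hU : S.v U = U) (X : 𝔛) : S.g (S.v X) U = S.g X U := by
  rw [S.v_symm, hU]

theorem g_h_right {X : 𝔛} (hX : S.v X = 0) (Y : 𝔛) : S.g (S.h Y) X = S.g Y X := by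
  rw [h_apply, map_sub, AddMonoidHom.sub_apply, S.v_symm, hX, map_zero, sub_zero]

theorem ext_vertical {U U' : 𝔛} (hU : S.v U = U) (hU' : S.v U' = U')
    (hg : ∀ W, S.v W = W → S.g U W = S.g U' W) : U = U' := by
  refine S.ext_inner fun W => ?_
  rw [← hU, ← hU', S.v_symm, S.v_symm, hg _ (S.v_idem _)]

theorem metric_zero (X : 𝔛) {A B : 𝔛} (hAB : S.g A B = 0) :
    S.g (S.D X A) B = - S.g A (S.D X B) := by
  have := S.metric X (A := A) (B := B) (A' := 0) (B' := 0) (by simpa using hAB)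
  simp only [map_zero, add_zero] at this
  exact eq_neg_of_add_eq_zero_left this

theorem v_J_horizontal {X : 𝔛} (hX : S.v X = 0) : S.v (S.J X) = 0 := by
  rw [S.v_J, hX, map_zero]

theorem v_J_vertical {U : 𝔛} (hU : S.v U = U) : S.v (S.J U) = S.J U := by
  rw [S.v_J, hU]

/-- The O'Neill tensor `A` is antisymmetric in horizontal arguments. -/
theorem a_antisymm {X Y : 𝔛} (hX : S.v X = 0) (hY : S.v Y = 0) :
    S.v (S.D X Y) = - S.v (S.D Y X) := by
  refine S.ext_vertical (S.v_idem _) (by rw [map_neg, S.v_idem]) fun U hU => ?_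
  rw [S.g_v_right hU, map_neg, AddMonoidHom.neg_apply, S.g_v_right hU,
    S.metric_zero _ (S.g_h_v hU hY), S.metric_zero _ (S.g_h_v hU hX), S.symm]
  have := S.riemannian hU hX hY
  rw [neg_neg]
  exact neg_eq_of_add_eq_zero_right this

theorem a_J_right (X Y : 𝔛) : S.v (S.D X (S.J Y)) = S.J (S.v (S.D X Y)) := by
  rw [S.J_parallel, S.v_J]

/-- `J` passes through the second slot because it is parallel; antisymmetry of `A` carries this over
to the first. -/
theorem a_J_left {X Y : 𝔛} (hX : S.v X = 0) (hY : S.v Y = 0) :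
    S.v (S.D (S.J X) Y) = S.J (S.v (S.D X Y)) := by
  rw [S.a_antisymm (S.v_J_horizontal hX) hY, a_J_right, ← map_neg, ← S.a_antisymm hX hY]

theorem a_J_J {X Y : 𝔛} (hX : S.v X = 0) (hY : S.v Y = 0) :
    S.v (S.D (S.J X) (S.J Y)) = - S.v (S.D X Y) := by
  rw [S.a_J_left hX (S.v_J_horizontal hY), a_J_right, S.J_sq]

theorem h_J (X : 𝔛) : S.h (S.J X) = S.J (S.h X) := by
  rw [h_apply, h_apply, S.v_J, map_sub]

theorem s_symm {U W : 𝔛} (hU : S.v U = U) (hW : S.v W = W) :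
    S.h (S.D U W) = S.h (S.D W U) := by
  have := S.involutive hU hW
  rw [← sub_eq_zero, ← map_sub, h_apply, this, sub_self]

theorem t_adjoint {U Z W : 𝔛} (hZ : S.v Z = 0) (hW : S.v W = W) :
    S.g (S.v (S.D U Z)) W = - S.g Z (S.h (S.D U W)) := by
  rw [S.g_v_right hW, S.metric_zero _ (S.g_h_v hW hZ), S.symm Z, S.symm Z, S.g_h_right hZ]

/-- `U ↦ T_U Z` is minus the adjoint of the second fundamental form of the leaves, which is
symmetric because the distribution is involutive. -/
theorem t_symm {U Z W : 𝔛} (hU : S.v U = U) (hZ : S.v Z = 0) (hW : S.v W = W) :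
    S.g (S.v (S.D U Z)) W = S.g (S.v (S.D W Z)) U := by
  rw [S.t_adjoint hZ hW, S.t_adjoint hZ hU, S.s_symm hU hW]

/-- By symmetry and parallelism of `J`, the second fundamental form is complex linear in each slot;
pairing it with `JZ`, the isometry `J` cancels. -/
theorem t_J_J {U Z : 𝔛} (hU : S.v U = U) (hZ : S.v Z = 0) :
    S.v (S.D (S.J U) (S.J Z)) = S.v (S.D U Z) := by
  refine S.ext_vertical (S.v_idem _) (S.v_idem _) fun W hW => ?_
  rw [S.t_adjoint (S.v_J_horizontal hZ) hW, S.t_adjoint hZ hW, S.s_symm (S.v_J_vertical hU) hW,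
    S.J_parallel, S.h_J, S.J_isometry, S.s_symm hU hW]

theorem R_skew (X Y Z W : 𝔛) : S.g (S.R X Y Z) W = - S.g Z (S.R X Y W) :=
  S.curvature_skew X Y Z W

theorem R_antisymm (X Y Z : 𝔛) : S.R X Y Z = - S.R Y X Z := by
  simp only [R, map_sub, AddMonoidHom.sub_apply]; abel

theorem R_bianchi (X Y Z : 𝔛) : S.R X Y Z + S.R Y Z X + S.R Z X Y = 0 := S.jacobi X Y Z

theorem R_J (X Y Z : 𝔛) : S.R X Y (S.J Z) = S.J (S.R X Y Z) := by
  simp only [R, S.J_parallel, map_sub, AddMonoidHom.sub_apply]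

/-- The classical combination of four Bianchi identities, normalised with the two skew-symmetries.
-/
theorem R_pair_symm (X Y Z W : 𝔛) : S.g (S.R X Y Z) W = S.g (S.R Z W X) Y := by
  have b (A B E F : 𝔛) : S.g (S.R A B E) F + S.g (S.R B E A) F + S.g (S.R E A B) F = 0 := by
    rw [← AddMonoidHom.add_apply, ← AddMonoidHom.add_apply, ← map_add, ← map_add, S.R_bianchi,
      map_zero, AddMonoidHom.zero_apply]
  have a (A B E F : 𝔛) : S.g (S.R A B E) F = - S.g (S.R B A E) F := by
    rw [S.R_antisymm, map_neg, AddMonoidHom.neg_apply]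
  have s (A B E F : 𝔛) : S.g (S.R A B E) F = - S.g (S.R A B F) E := by
    rw [S.R_skew, S.symm]
  have e₁ := b X Y Z W
  have e₂ := b X Y W Z
  have e₃ := b X Z W Y
  have e₄ := b Y Z W X
  rw [a Z X] at e₁
  rw [s X Y W Z, a W X] at e₂
  rw [s X Z W Y, a W X, s X W Z Y, neg_neg] at e₃
  rw [s Y Z W X, s Z W Y X, a W Y, s Y W Z X, neg_neg] at e₄
  linear_combination (norm := module) (1 / 2 : ℝ) • (e₁ - e₂ - e₃ + e₄)

/-- The curvature is invariant under the complex structure. -/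
theorem R_J_J (X Y Z : 𝔛) : S.R (S.J X) (S.J Y) Z = S.R X Y Z := by
  refine S.ext_inner fun W => ?_
  -- Pair symmetry turns `JX, JY` into the last two arguments, where `J` commutes with the curvature
  -- and preserves `g`.
  rw [S.R_pair_symm, S.R_J, S.J_isometry, S.R_pair_symm]

/-! ### Consequences of the J-invariance of the curvature -/

/-- The vertical part of the covariant derivative of `A` in horizontal directions. -/
def N (Z X Y : 𝔛) : 𝔛 :=
  S.v (S.D Z (S.v (S.D X Y))) - S.v (S.D (S.h (S.D Z X)) Y) - S.v (S.D X (S.h (S.D Z Y)))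

theorem N_antisymm {X Y : 𝔛} (Z : 𝔛) (hX : S.v X = 0) (hY : S.v Y = 0) :
    S.N Z X Y = - S.N Z Y X := by
  rw [N, N, S.a_antisymm hX hY, S.a_antisymm (S.v_h (S.D Z X)) hY,
    S.a_antisymm hX (S.v_h (S.D Z Y))]
  simp only [map_neg]
  abel

theorem N_J_J {X Y : 𝔛} (Z : 𝔛) (hX : S.v X = 0) (hY : S.v Y = 0) :
    S.N Z (S.J X) (S.J Y) = - S.N Z X Y := by
  rw [N, N, S.J_parallel Z, S.J_parallel Z, S.h_J, S.h_J, S.a_J_J hX hY, S.a_J_J (S.v_h _) hY,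
    S.a_J_J hX (S.v_h _)]
  simp only [map_neg]
  abel

theorem v_D_split (X Y Z : 𝔛) :
    S.v (S.D X (S.D Y Z)) = S.v (S.D X (S.v (S.D Y Z))) + S.v (S.D X (S.h (S.D Y Z))) := by
  rw [← map_add, ← map_add, ← S.split]

theorem v_D_split_left (X Y Z : 𝔛) :
    S.v (S.D (S.D X Y) Z) = S.v (S.D (S.v (S.D X Y)) Z) + S.v (S.D (S.h (S.D X Y)) Z) := by
  rw [← map_add, ← AddMonoidHom.add_apply, ← map_add, ← S.split]

/-- The factor 2 appears because antisymmetry of `A` makes `2 A_X Y` the vertical part of `[X, Y]`.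
-/
theorem v_R_aux {X Y Z : 𝔛} (hX : S.v X = 0) (hY : S.v Y = 0) :
    S.v (S.R X Y Z) = S.N X Y Z - S.N Y X Z - (2 : ℝ) • S.v (S.D (S.v (S.D X Y)) Z) := by
  have e := S.v_D_split_left Y X Z
  rw [S.a_antisymm hY hX, map_neg, AddMonoidHom.neg_apply, map_neg] at e
  simp only [R, N, map_sub, AddMonoidHom.sub_apply, S.v_D_split X, S.v_D_split Y,
    S.v_D_split_left X Y, e]
  module

/-- The vertical part of the curvature of horizontal fields. -/
theorem v_R {X Y Z : 𝔛} (hX : S.v X = 0) (hY : S.v Y = 0) (hZ : S.v Z = 0) :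
    S.v (S.R X Y Z) = - S.N Z X Y + S.v (S.D (S.v (S.D Y Z)) X) + S.v (S.D (S.v (S.D Z X)) Y)
      - S.v (S.D (S.v (S.D X Y)) Z) := by
  have e := congrArg S.v (S.R_bianchi X Y Z)
  simp only [map_add, map_zero, S.v_R_aux hX hY, S.v_R_aux hY hZ, S.v_R_aux hZ hX] at e
  rw [S.v_R_aux hX hY]
  -- The Bianchi identity now says that the cyclic sum of `N Z X Y` equals the cyclic sum of `T_{A_X
  -- Y} Z`. This trades the two derivatives of `A` in `v_R_aux` for a single one.
  rw [S.N_antisymm X hZ hY, S.N_antisymm Y hX hZ, S.N_antisymm Z hY hX] at e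
  rw [S.N_antisymm Y hX hZ]
  linear_combination (norm := module) (1 / 2 : ℝ) • e

/-- In `v_R`, passing to `JX, JY` changes the sign of `N Z X Y` and of `T_{A_X Y} Z` and fixes
everything else, so the odd terms cancel among themselves. -/
theorem N_eq {X Y Z : 𝔛} (hX : S.v X = 0) (hY : S.v Y = 0) (hZ : S.v Z = 0) :
    S.N Z X Y = - S.v (S.D (S.v (S.D X Y)) Z) := by
  have e := S.v_R (S.v_J_horizontal hX) (S.v_J_horizontal hY) hZ
  rw [S.R_J_J, S.v_R hX hY hZ, S.N_J_J Z hX hY, S.a_J_left hY hZ, S.t_J_J (S.v_idem _) hX,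
    S.a_J_right Z X, S.t_J_J (S.v_idem _) hY, S.a_J_J hX hY, map_neg, AddMonoidHom.neg_apply,
    map_neg] at e
  linear_combination (norm := module) - (1 / 2 : ℝ) • e

/-- `T` vanishes on `A_H H`. -/
theorem t_a {X Y Z : 𝔛} (hX : S.v X = 0) (hY : S.v Y = 0) (hZ : S.v Z = 0) :
    S.v (S.D (S.v (S.D X Y)) Z) = 0 := by
  -- After `N_eq`, only `T_{A_Y Z} X + T_{A_Z X} Y` is left of `R(X, Y)Z` vertically, and its cyclic
  -- sum is twice the sum below.
  have c {X Y : 𝔛} (hX : S.v X = 0) (hY : S.v Y = 0) :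
      S.v (S.D (S.v (S.D X Y)) Z) + S.v (S.D (S.v (S.D Y Z)) X)
        + S.v (S.D (S.v (S.D Z X)) Y) = 0 := by
    have e := congrArg S.v (S.R_bianchi X Y Z)
    simp only [map_add, map_zero, S.v_R hX hY hZ, S.v_R hY hZ hX, S.v_R hZ hX hY,
      S.N_eq hX hY hZ, S.N_eq hY hZ hX, S.N_eq hZ hX hY] at e
    linear_combination (norm := module) (1 / 2 : ℝ) • e
  -- Of the three summands, only `T_{A_X Y} Z` is reversed by the passage to `JX, JY`.
  have e := c (S.v_J_horizontal hX) (S.v_J_horizontal hY)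
  rw [S.a_J_left hY hZ, S.t_J_J (S.v_idem _) hX,
    S.a_J_right Z X, S.t_J_J (S.v_idem _) hY, S.a_J_J hX hY, map_neg, AddMonoidHom.neg_apply,
    map_neg] at e
  linear_combination (norm := module) (1 / 2 : ℝ) • (c hX hY - e)

/-- `A` is parallel in horizontal directions. -/
theorem N_eq_zero {X Y Z : 𝔛} (hX : S.v X = 0) (hY : S.v Y = 0) (hZ : S.v Z = 0) :
    S.N Z X Y = 0 := by
  rw [S.N_eq hX hY hZ, S.t_a hX hY hZ, neg_zero]

/-- A vertical field is flat if it is orthogonal to `A_H H`. -/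
structure IsFlat (W : 𝔛) : Prop where
  vertical : S.v W = W
  orthogonal : ∀ {X Y}, S.v X = 0 → S.v Y = 0 → S.g (S.v (S.D X Y)) W = 0

/-- `T` takes values orthogonal to `A_H H`. -/
theorem isFlat_t {U Z : 𝔛} (hU : S.v U = U) (hZ : S.v Z = 0) : S.IsFlat (S.v (S.D U Z)) where
  vertical := S.v_idem _
  orthogonal hX hY := by
    -- Symmetry of `T` gives `⟨T_U Z, A_X Y⟩ = ⟨T_{A_X Y} Z, U⟩`.
    rw [S.symm, S.t_symm hU hZ (S.v_idem _), S.t_a hX hY hZ, map_zero, AddMonoidHom.zero_apply]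

/-- Since `A` is horizontally parallel, the vertical part of `∇_X (A_Y Z)` is a sum of values of
`A`. This lemma, the next one and `inner_D_a_a` say that derivatives among `H` and `A_H H` have no
component along a flat field. -/
theorem inner_D_horizontal_a {X Y Z W : 𝔛} (hX : S.v X = 0) (hY : S.v Y = 0) (hZ : S.v Z = 0)
    (hW : S.IsFlat W) : S.g (S.D X (S.v (S.D Y Z))) W = 0 := by
  have e := congrArg (fun A => S.g A W) (S.N_eq_zero hY hZ hX)
  simp only [N, map_sub, AddMonoidHom.sub_apply, hW.orthogonal (S.v_h _) hZ,
    hW.orthogonal hY (S.v_h _), map_zero, AddMonoidHom.zero_apply, sub_zero,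
    S.g_v_right hW.vertical] at e
  exact e

theorem inner_D_a_horizontal {X Y Z W : 𝔛} (hX : S.v X = 0) (hY : S.v Y = 0) (hZ : S.v Z = 0)
    (hW : S.v W = W) : S.g (S.D (S.v (S.D X Y)) Z) W = 0 := by
  rw [← S.g_v_right hW, S.t_a hX hY hZ, map_zero, AddMonoidHom.zero_apply]

/-- The vertical part of the covariant derivative of `A` in vertical directions. -/
def P (V X Y : 𝔛) : 𝔛 :=
  S.v (S.D V (S.v (S.D X Y))) - S.v (S.D (S.h (S.D V X)) Y) - S.v (S.D X (S.h (S.D V Y)))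

theorem inner_P {W : 𝔛} (V : 𝔛) {X Y : 𝔛} (hX : S.v X = 0) (hY : S.v Y = 0) (hW : S.IsFlat W) :
    S.g (S.P V X Y) W = S.g (S.D V (S.v (S.D X Y))) W := by
  simp only [P, map_sub, AddMonoidHom.sub_apply, hW.orthogonal (S.v_h _) hY,
    hW.orthogonal hX (S.v_h _), sub_zero, S.g_v_right hW.vertical]

/-- The vertical part of the covariant derivative of `T` in horizontal directions. -/
def Q (X V Y : 𝔛) : 𝔛 :=
  S.v (S.D X (S.v (S.D V Y))) - S.v (S.D (S.v (S.D X V)) Y) - S.v (S.D V (S.h (S.D X Y)))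

theorem v_R_mixed (V X Y : 𝔛) :
    S.v (S.R V X Y) = S.P V X Y - S.Q X V Y - S.v (S.D (S.v (S.D V X)) Y)
      + S.v (S.D (S.h (S.D X V)) Y) := by
  simp only [R, P, Q, map_sub, AddMonoidHom.sub_apply, S.v_D_split X, S.v_D_split V,
    S.v_D_split_left X V, S.v_D_split_left V X]
  abel

/-- Pairing with a flat `W` removes from `v_R_mixed` every term that is a value of `A`. -/
theorem inner_R_mixed {W : 𝔛} (V : 𝔛) {X Y : 𝔛} (hX : S.v X = 0) (hY : S.v Y = 0)
    (hW : S.IsFlat W) : S.g (S.R V X Y) W = S.g (S.D V (S.v (S.D X Y))) W - S.g (S.Q X V Y) W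
      - S.g (S.v (S.D (S.v (S.D V X)) Y)) W := by
  rw [← S.g_v_right hW.vertical, S.v_R_mixed, map_add, AddMonoidHom.add_apply,
    hW.orthogonal (S.v_h _) hY, add_zero, map_sub, map_sub, AddMonoidHom.sub_apply,
    AddMonoidHom.sub_apply, S.inner_P V hX hY hW]

/-- By Bianchi, `R(X, Y)V` is the difference of the mixed terms `R(V, Y)X` and `R(V, X)Y`;
antisymmetry of `A` doubles the first summand. -/
theorem inner_R_horizontal {W : 𝔛} (V : 𝔛) {X Y : 𝔛} (hX : S.v X = 0) (hY : S.v Y = 0)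
    (hW : S.IsFlat W) :
    S.g (S.R X Y V) W = - (2 : ℝ) • S.g (S.D V (S.v (S.D X Y))) W - S.g (S.Q Y V X) W
      + S.g (S.Q X V Y) W - S.g (S.v (S.D (S.v (S.D V Y)) X)) W
      + S.g (S.v (S.D (S.v (S.D V X)) Y)) W := by
  have e := congrArg (fun A => S.g A W) (S.R_bianchi X Y V)
  rw [S.R_antisymm Y V X] at e
  simp only [map_add, AddMonoidHom.add_apply, map_neg, AddMonoidHom.neg_apply, map_zero,
    AddMonoidHom.zero_apply, S.inner_R_mixed V hX hY hW, S.inner_R_mixed V hY hX hW] at e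
  rw [S.a_antisymm hY hX] at e
  simp only [map_neg, AddMonoidHom.neg_apply] at e
  linear_combination (norm := module) e

/-- The derivative of `A` along `A_H H` takes values in `A_H H`. -/
theorem inner_D_a_a {X Y Z Z' W : 𝔛} (hX : S.v X = 0) (hY : S.v Y = 0) (hZ : S.v Z = 0)
    (hZ' : S.v Z' = 0) (hW : S.IsFlat W) :
    S.g (S.D (S.v (S.D Z Z')) (S.v (S.D X Y))) W = 0 := by
  set B := S.v (S.D Z Z') with hB
  -- As `N = 0`, the vertical part of `∇_X B` is again a sum of values of `A`. Each term of `Q X B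
  -- Y` then contains `T` evaluated on `A_H H`.
  have hQ {X Y : 𝔛} (hX : S.v X = 0) (hY : S.v Y = 0) : S.Q X B Y = 0 := by
    have e := S.N_eq_zero hZ hZ' hX
    rw [N, ← hB] at e
    have e' : S.v (S.D X B) = S.v (S.D (S.h (S.D X Z)) Z') + S.v (S.D Z (S.h (S.D X Z'))) := by
      linear_combination (norm := module) e
    rw [Q, e', map_add, AddMonoidHom.add_apply, map_add, S.t_a (S.v_h _) hZ' hY,
      S.t_a hZ (S.v_h _) hY, hB, S.t_a hZ hZ' hY, S.t_a hZ hZ' (S.v_h _)]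
    simp
  have key {X Y : 𝔛} (hX : S.v X = 0) (hY : S.v Y = 0) :
      S.g (S.R X Y B) W = - (2 : ℝ) • S.g (S.D B (S.v (S.D X Y))) W := by
    rw [S.inner_R_horizontal B hX hY hW, hQ hX hY, hQ hY hX, hB, S.t_a hZ hZ' hX,
      S.t_a hZ hZ' hY]
    simp
  -- The left side of `key` is invariant under `(X, Y) ↦ (JX, JY)` and the right side is odd, so
  -- both vanish.
  have e := key (S.v_J_horizontal hX) (S.v_J_horizontal hY)
  rw [S.R_J_J, key hX hY, S.a_J_J hX hY] at e
  simp only [map_neg, AddMonoidHom.neg_apply] at e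
  linear_combination (norm := module) - (1 / 4 : ℝ) • e

/-- `Q` is a covariant derivative of `T` and inherits its symmetry. To see this, `key`
differentiates the adjunction between `T` and the second fundamental form; exchanging `V` and `W`
then permutes the terms. -/
theorem inner_Q_symm {X Y V W : 𝔛} (hY : S.v Y = 0) (hV : S.v V = V) (hW : S.v W = W) :
    S.g (S.Q X V Y) W = S.g (S.Q X W Y) V := by
  have key {V W : 𝔛} (hV : S.v V = V) (hW : S.v W = W) :
      S.g (S.Q X V Y) W = - S.g Y (S.D X (S.h (S.D V W)))
        + S.g Y (S.h (S.D V (S.v (S.D X W)))) + S.g Y (S.h (S.D (S.v (S.D X V)) W)) := by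
    have e := S.metric X (A := S.v (S.D V Y)) (B := W) (A' := -Y) (B' := S.h (S.D V W))
      (by rw [S.t_adjoint hY hW, map_neg, AddMonoidHom.neg_apply])
    simp only [map_neg, AddMonoidHom.neg_apply] at e
    have e₂ : S.g (S.v (S.D V Y)) (S.D X W) = - S.g Y (S.h (S.D V (S.v (S.D X W)))) := by
      rw [← S.v_idem (S.D V Y), S.v_symm, S.t_adjoint hY (S.v_idem _)]
    have e₃ : S.g (S.D X Y) (S.h (S.D V W)) = S.g (S.h (S.D X Y)) (S.h (S.D V W)) := by
      rw [S.g_h_right (S.v_h _)]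
    simp only [Q, map_sub, AddMonoidHom.sub_apply, S.t_adjoint hY hW, S.t_adjoint (S.v_h _) hW,
      S.g_v_right hW]
    rw [e₂, e₃] at e
    linear_combination (norm := module) e
  rw [key hV hW, key hW hV, S.s_symm hV hW, S.s_symm hV (S.v_idem _), S.s_symm hW (S.v_idem _)]
  abel

/-- The flat fields are closed under the Lie bracket. -/
theorem inner_bracket_a {X Y V W : 𝔛} (hX : S.v X = 0) (hY : S.v Y = 0) (hV : S.IsFlat V)
    (hW : S.IsFlat W) : S.g (S.D V W - S.D W V) (S.v (S.D X Y)) = 0 := by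
  -- Antisymmetrising `⟨R(X, Y)V, W⟩` in `V` and `W` removes the derivatives of `T`, which are
  -- symmetric in them.
  have key {X Y : 𝔛} (hX : S.v X = 0) (hY : S.v Y = 0) :
      (2 : ℝ) • S.g (S.R X Y V) W = - (2 : ℝ) • (S.g (S.D V (S.v (S.D X Y))) W
        - S.g (S.D W (S.v (S.D X Y))) V)
        - S.g (S.v (S.D (S.v (S.D V Y)) X)) W + S.g (S.v (S.D (S.v (S.D V X)) Y)) W
        + S.g (S.v (S.D (S.v (S.D W Y)) X)) V - S.g (S.v (S.D (S.v (S.D W X)) Y)) V := by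
    have e₁ := S.inner_R_horizontal V hX hY hW
    have e₂ := S.inner_R_horizontal W hX hY hV
    rw [S.R_skew, S.symm, S.inner_Q_symm hX hW.vertical hV.vertical,
      S.inner_Q_symm hY hW.vertical hV.vertical] at e₂
    linear_combination (norm := module) e₁ - e₂
  have ht {U X Y : 𝔛} (hU : S.v U = U) (hX : S.v X = 0) (hY : S.v Y = 0) :
      S.v (S.D (S.v (S.D U (S.J X))) (S.J Y)) = S.v (S.D (S.v (S.D U X)) Y) := by
    rw [S.a_J_right U X, S.t_J_J (S.v_idem _) hY]
  -- The curvature and the iterated `T` terms are unchanged for `JX, JY`, while the derivatives of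
  -- `A_X Y` are reversed. Hence `⟨∇_V (A_X Y), W⟩ = ⟨∇_W (A_X Y), V⟩`, which the metric property
  -- turns into the claim.
  have e := key (S.v_J_horizontal hX) (S.v_J_horizontal hY)
  rw [S.R_J_J, key hX hY, S.a_J_J hX hY] at e
  simp only [map_neg, AddMonoidHom.neg_apply, ht hV.vertical hX hY, ht hV.vertical hY hX,
    ht hW.vertical hX hY, ht hW.vertical hY hX] at e
  have e₁ := S.metric_zero V (hW.orthogonal hX hY)
  have e₂ := S.metric_zero W (hV.orthogonal hX hY)
  rw [S.symm, map_sub]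
  linear_combination (norm := module) (1 / 4 : ℝ) • e + e₁ - e₂

end FoliatedKahlerModule

/-! ### Total differential equations with an integrability condition -/

section TotalDifferentialEquation

variable {E F : Type*} [NormedAddCommGroup E] [NormedSpace ℝ E]
  [NormedAddCommGroup F] [NormedSpace ℝ F]

open scoped NNReal in
/-- Picard-Lindelöf theorem on `[0, 1]`, including the fact that the solution stays in the ball. -/
theorem exists_solution_mem_closedBall [CompleteSpace E] {g : E → E} {e₀ : E} {a L K : ℝ≥0}
    (hg : LipschitzOnWith K g (Metric.closedBall e₀ a))
    (hL : ∀ x ∈ Metric.closedBall e₀ a, ‖g x‖ ≤ L) (hLa : L ≤ a) :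
    ∃ α : ℝ → E, α 0 = e₀ ∧ ∀ t ∈ Icc (0 : ℝ) 1,
      HasDerivWithinAt α (g (α t)) (Icc 0 1) t ∧ α t ∈ Metric.closedBall e₀ a := by
  have hP : IsPicardLindelof (fun _ => g) (⟨0, by simp⟩ : Icc (0 : ℝ) 1) e₀ a 0 L K :=
    { lipschitzOnWith := fun _ _ => hg
      continuousOn := fun _ _ => continuousOn_const
      norm_le := fun _ _ => hL
      mul_max_le := by simpa using hLa }
  have hx : e₀ ∈ Metric.closedBall e₀ ((0 : ℝ≥0) : ℝ) := Metric.mem_closedBall_self le_rfl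
  -- Working with the fixed point of the Picard operator retains the information that the curve
  -- stays in the ball.
  obtain ⟨α, hα⟩ := ODE.FunSpace.exists_isFixedPt_next hP hx
  have hα' : ∀ t, α.compProj t ∈ Metric.closedBall e₀ a := fun t =>
    α.compProj_mem_closedBall hP.mul_max_le
  refine ⟨α.compProj, ?_, fun t ht => ⟨?_, hα' t⟩⟩
  · have := ODE.FunSpace.compProj_val (α := α) (t := ⟨0, by simp⟩)
    rw [this, ← hα, ODE.FunSpace.next_apply₀]
  · apply ODE.hasDerivWithinAt_picard_Icc (⟨0, by simp⟩ : Icc (0 : ℝ) 1).2 hP.continuousOn_uncurry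
      α.continuous_compProj.continuousOn (fun t _ => hα' t) e₀ ht |>.congr_of_mem _ ht
    intro t' ht'
    nth_rw 1 [← hα]
    rw [ODE.FunSpace.compProj_of_mem ht', ODE.FunSpace.next_apply]

set_option synthInstance.maxHeartbeats 100000 in
/-- Local constants for a `C²` map: bounds and Lipschitz constants on a ball. -/
theorem exists_ball_bounds {B : E → F →L[ℝ] E} {e₀ : E} {Ω : Set E} (hΩ : IsOpen Ω)
    (he₀ : e₀ ∈ Ω) (hB : ContDiffOn ℝ ∞ B Ω) :
    ∃ a > (0 : ℝ), ∃ C > (0 : ℝ), Metric.ball e₀ (2 * a) ⊆ Ω ∧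
      (∀ x ∈ Metric.ball e₀ (2 * a), ‖B x‖ ≤ C) ∧
      (∀ x ∈ Metric.ball e₀ (2 * a), ‖fderiv ℝ B x‖ ≤ C) ∧
      (∀ x ∈ Metric.ball e₀ (2 * a), ∀ y ∈ Metric.ball e₀ (2 * a), ‖B y - B x‖ ≤ C * ‖y - x‖) ∧
      (∀ x ∈ Metric.ball e₀ (2 * a), ∀ y ∈ Metric.ball e₀ (2 * a),
        ‖B y - B x - fderiv ℝ B x (y - x)‖ ≤ C * ‖y - x‖ ^ 2) := by
  have hBe : ContDiffAt ℝ ∞ B e₀ := hB.contDiffAt (hΩ.mem_nhds he₀)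
  have hdB : ContDiffOn ℝ ∞ (fderiv ℝ B) Ω := ((contDiffOn_infty_iff_fderiv_of_isOpen hΩ).1 hB).2
  have hdBe : ContDiffAt ℝ ∞ (fderiv ℝ B) e₀ := hdB.contDiffAt (hΩ.mem_nhds he₀)
  obtain ⟨K, t, ht, hK⟩ := (hBe.of_le (mod_cast le_top) : ContDiffAt ℝ 1 B e₀).exists_lipschitzOnWith
  obtain ⟨K', t', ht', hK'⟩ :=
    (hdBe.of_le (mod_cast le_top) : ContDiffAt ℝ 1 (fderiv ℝ B) e₀).exists_lipschitzOnWith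
  have h₁ : ∀ᶠ x in 𝓝 e₀, ‖B x‖ < ‖B e₀‖ + 1 :=
    hBe.continuousAt.norm.eventually_lt continuousAt_const (lt_add_one _)
  have h₂ : ∀ᶠ x in 𝓝 e₀, ‖fderiv ℝ B x‖ < ‖fderiv ℝ B e₀‖ + 1 :=
    ((continuous_norm (E := E →L[ℝ] F →L[ℝ] E)).continuousAt.comp
      hdBe.continuousAt).eventually_lt_const (lt_add_one _)
  obtain ⟨b, hb, hball⟩ := Metric.eventually_nhds_iff_ball.1
    (((h₁.and h₂).and (Filter.inter_mem ht ht')).and (hΩ.mem_nhds he₀))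
  set C := max (max (‖B e₀‖ + 1) (‖fderiv ℝ B e₀‖ + 1)) (max K K' : ℝ) with hC
  have hC1 : ‖B e₀‖ + 1 ≤ C := (le_max_left _ _).trans (le_max_left _ _)
  have hC2 : ‖fderiv ℝ B e₀‖ + 1 ≤ C := (le_max_right _ _).trans (le_max_left _ _)
  have hC3 : (K : ℝ) ≤ C := (le_max_left _ _).trans (le_max_right _ _)
  have hC4 : (K' : ℝ) ≤ C := (le_max_right _ _).trans (le_max_right _ _)
  have hC0 : 0 < C := lt_of_lt_of_le (by positivity) hC1
  refine ⟨b / 2, by positivity, C, hC0, ?_⟩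
  rw [mul_div_cancel₀ b two_ne_zero]
  refine ⟨fun x hx => (hball x hx).2, fun x hx => (hball x hx).1.1.1.le.trans hC1,
    fun x hx => (hball x hx).1.1.2.le.trans hC2, fun x hx y hy => ?_, fun x hx y hy => ?_⟩
  · have := hK.dist_le_mul y (hball y hy).1.2.1 x (hball x hx).1.2.1
    rw [dist_eq_norm, dist_eq_norm] at this
    exact this.trans (by gcongr)
  -- Second-order Taylor bound: the mean value inequality with the fixed linear map `fderiv ℝ B x`,
  -- from which `fderiv ℝ B` deviates by at most `C * ‖y - x‖` along the segment.
  · have hseg : segment ℝ x y ⊆ Metric.ball e₀ b := (convex_ball e₀ b).segment_subset hx hy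
    have := (convex_segment x y).norm_image_sub_le_of_norm_fderiv_le' (𝕜 := ℝ) (f := B)
      (φ := fderiv ℝ B x) (C := C * ‖y - x‖) (x := x) (y := y)
      (fun z hz => (hB.contDiffAt (hΩ.mem_nhds (hball z (hseg hz)).2)).differentiableAt (by simp))
      (fun z hz => by
        have := hK'.dist_le_mul z (hball z (hseg hz)).1.2.2 x (hball x hx).1.2.2
        rw [dist_eq_norm, dist_eq_norm] at this
        refine this.trans (mul_le_mul hC4 ?_ (norm_nonneg _) hC0.le)
        rw [norm_sub_rev y]
        simpa [dist_eq_norm] using segment_subset_closedBall_left x y hz)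
      (left_mem_segment _ _ _) (right_mem_segment _ _ _)
    rwa [mul_assoc, ← sq] at this

/-- Solution of the total differential equation `Df = B ∘ f` under the integrability condition. -/
theorem exists_hasFDerivAt_eq_comp [CompleteSpace E] {B : E → F →L[ℝ] E} {e₀ : E} {Ω : Set E}
    (hΩ : IsOpen Ω) (he₀ : e₀ ∈ Ω) (hB : ContDiffOn ℝ ∞ B Ω)
    (hsymm : ∀ e ∈ Ω, ∀ u v, fderiv ℝ B e (B e u) v = fderiv ℝ B e (B e v) u) :
    ∃ r > (0 : ℝ), ∃ f : F → E, f 0 = e₀ ∧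
      ∀ x ∈ Metric.ball (0 : F) r, f x ∈ Ω ∧ HasFDerivAt f (B (f x)) x := by
  obtain ⟨a, ha, C, hC, hsub, hbd, hbd', hlip, htaylor⟩ := exists_ball_bounds hΩ he₀ hB
  have hcl : Metric.closedBall e₀ a ⊆ Metric.ball e₀ (2 * a) :=
    Metric.closedBall_subset_ball (by linarith)
  -- With `C * r = a / 4`, the solutions for `‖x‖ ≤ r` stay within distance `a` of `e₀`. The
  -- perturbed curves below move by at most `C * (2 * r) = a / 2` more, so they remain in the ball
  -- of radius `2 * a`.
  set r := a / (4 * C) with hr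
  have hr0 : 0 < r := by positivity
  have hCr : C * r = a / 4 := by rw [hr]; field_simp
  have hlipx (x : F) (hx : ‖x‖ ≤ r) : LipschitzOnWith (Real.toNNReal (C * r)) (fun y => B y x)
      (Metric.ball e₀ (2 * a)) := by
    refine LipschitzOnWith.of_dist_le_mul fun y hy z hz => ?_
    rw [Real.coe_toNNReal _ (by positivity), dist_eq_norm, dist_eq_norm, ← sub_apply]
    calc ‖(B y - B z) x‖ ≤ ‖B y - B z‖ * ‖x‖ := ContinuousLinearMap.le_opNorm _ _
      _ ≤ (C * ‖y - z‖) * r := by gcongr; exact hlip z hz y hy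
      _ = C * r * ‖y - z‖ := by ring
  -- Restricted to the ray `t ↦ t x`, the equation becomes the ODE `α' = B(α) x`; the value `f x`
  -- will be `α 1`.
  have hsol (x : F) : ∃ α : ℝ → E, ‖x‖ ≤ r → (α 0 = e₀ ∧ ∀ t ∈ Icc (0 : ℝ) 1,
      HasDerivWithinAt α (B (α t) x) (Icc 0 1) t ∧ α t ∈ Metric.closedBall e₀ a) := by
    by_cases hx : ‖x‖ ≤ r
    · obtain ⟨α, hα⟩ := exists_solution_mem_closedBall (g := fun y => B y x) (e₀ := e₀)
        (a := a.toNNReal) (L := (C * r).toNNReal)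
        (by rw [Real.coe_toNNReal _ ha.le]; exact (hlipx x hx).mono hcl) (fun y hy => by
          rw [Real.coe_toNNReal _ ha.le] at hy
          rw [Real.coe_toNNReal _ (by positivity)]
          calc ‖B y x‖ ≤ ‖B y‖ * ‖x‖ := ContinuousLinearMap.le_opNorm _ _
            _ ≤ C * r := by gcongr; exact hbd y (hcl hy))
        (Real.toNNReal_le_toNNReal (by linarith))
      rw [Real.coe_toNNReal _ ha.le] at hα
      exact ⟨α, fun _ => hα⟩
    · exact ⟨0, fun h => absurd h hx⟩
  choose u hu using hsol
  have hIco : ∀ {t : ℝ}, t ∈ Ico (0 : ℝ) 1 → t ∈ Icc (0 : ℝ) 1 := fun ht => Ico_subset_Icc_self ht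
  have hderiv {x : F} (hx : ‖x‖ ≤ r) {t : ℝ} (ht : t ∈ Ico (0 : ℝ) 1) :
      HasDerivWithinAt (u x) (B (u x t) x) (Ici t) t :=
    (((hu x hx).2 t (hIco ht)).1).mono_of_mem_nhdsWithin (Icc_mem_nhdsGE_of_mem ht)
  have hcont {x : F} (hx : ‖x‖ ≤ r) : ContinuousOn (u x) (Icc 0 1) :=
    fun t ht => ((hu x hx).2 t ht).1.continuousWithinAt
  have hmem {x : F} (hx : ‖x‖ ≤ r) {t : ℝ} (ht : t ∈ Icc (0 : ℝ) 1) :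
      u x t ∈ Metric.closedBall e₀ a := ((hu x hx).2 t ht).2
  set M := C * C ^ 2 * r + C * C with hM
  have hM0 : 0 ≤ M := by positivity
  have hmain {x x' : F} (hx : ‖x‖ ≤ r) (hx' : ‖x'‖ ≤ r) :
      ‖u x' 1 - u x 1 - B (u x 1) (x' - x)‖
        ≤ (M / (a / 4) * (Real.exp (a / 4) - 1)) * ‖x' - x‖ ^ 2 := by
    set v := x' - x with hv
    have hxv : x' = x + v := by rw [hv]; abel
    have hv2 : ‖v‖ ≤ 2 * r := (norm_sub_le _ _).trans (by linarith)
    have hCv : C * ‖v‖ ≤ a / 2 := by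
      calc C * ‖v‖ ≤ C * (2 * r) := by gcongr
        _ = a / 2 := by linarith
    have hBd {t : ℝ} (ht : t ∈ Icc (0 : ℝ) 1) : HasFDerivAt B (fderiv ℝ B (u x t)) (u x t) :=
      ((hB.contDiffAt (hΩ.mem_nhds (hsub (hcl (hmem hx ht))))).differentiableAt
        (by simp)).hasFDerivAt
    -- The first-order prediction for the solution along the ray of `x' = x + v`, built from the one
    -- along the ray of `x`.
    set z : ℝ → E := fun t => u x t + t • B (u x t) v with hz
    have hzd {t : ℝ} (ht : t ∈ Icc (0 : ℝ) 1) (s : Set ℝ)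
        (hd : HasDerivWithinAt (u x) (B (u x t) x) s t) :
        HasDerivWithinAt z (B (u x t) x + (t • fderiv ℝ B (u x t) (B (u x t) x) v
          + (1 : ℝ) • B (u x t) v)) s t := by
      have h₁ : HasDerivWithinAt (fun t => B (u x t)) (fderiv ℝ B (u x t) (B (u x t) x)) s t :=
        (hBd ht).comp_hasDerivWithinAt t hd
      have h₂ : HasDerivWithinAt (fun t => B (u x t) v) (fderiv ℝ B (u x t) (B (u x t) x) v) s t :=
        (((ContinuousLinearMap.apply ℝ E v).hasFDerivAt).comp_hasDerivWithinAt t h₁)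
      exact hd.add ((hasDerivWithinAt_id t s).smul h₂)
    have hstep {t : ℝ} (ht : t ∈ Icc (0 : ℝ) 1) : ‖z t - u x t‖ ≤ C * ‖v‖ := by
      rw [hz, add_sub_cancel_left, norm_smul, Real.norm_of_nonneg ht.1]
      calc t * ‖B (u x t) v‖ ≤ 1 * (‖B (u x t)‖ * ‖v‖) := by
            gcongr
            · exact ht.2
            · exact ContinuousLinearMap.le_opNorm _ _
        _ ≤ C * ‖v‖ := by rw [one_mul]; gcongr; exact hbd _ (hcl (hmem hx ht))
    have hzmem {t : ℝ} (ht : t ∈ Icc (0 : ℝ) 1) : z t ∈ Metric.ball e₀ (2 * a) := by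
      rw [Metric.mem_ball]
      calc dist (z t) e₀ ≤ dist (z t) (u x t) + dist (u x t) e₀ := dist_triangle _ _ _
        _ ≤ a / 2 + a := by
            gcongr
            · rw [dist_eq_norm]; exact (hstep ht).trans hCv
            · exact hmem hx ht
        _ < 2 * a := by linarith
    have hzc : ContinuousOn z (Icc 0 1) := fun t ht =>
      (hzd ht _ ((hu x hx).2 t ht).1).continuousWithinAt
    have hG := dist_le_of_approx_trajectories_ODE_of_mem (v := fun _ y => B y x')
      (s := fun _ => Metric.ball e₀ (2 * a)) (K := Real.toNNReal (C * r)) (f := u x')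
      (f' := fun t => B (u x' t) x') (g := z) (g' := fun t => B (u x t) x +
        (t • fderiv ℝ B (u x t) (B (u x t) x) v + (1 : ℝ) • B (u x t) v)) (a := 0) (b := 1)
      (εf := 0) (εg := M * ‖v‖ ^ 2) (δ := 0) (fun _ _ => hlipx x' hx') (hcont hx')
      (fun t ht => hderiv hx' ht) (fun t ht => by rw [dist_self])
      (fun t ht => hcl (hmem hx' (hIco ht))) hzc (fun t ht => hzd (hIco ht) _ (hderiv hx ht))
      (fun t ht => by
        have ht' := hIco ht
        set w := u x t with hw
        have hwm : w ∈ Metric.ball e₀ (2 * a) := hcl (hmem hx ht')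
        -- The defect of `z` in the ODE for `x'`. Integrability replaces `DB(Bx)v` by `DB(Bv)x`,
        -- which cancels the terms linear in `v`; the remainder is quadratic, and Grönwall gives a
        -- quadratic bound at time 1.
        have e : B w x + (t • fderiv ℝ B w (B w x) v + (1 : ℝ) • B w v) - B (z t) x'
            = - ((B (z t) - B w - fderiv ℝ B w (z t - w)) x')
              - t • fderiv ℝ B w (B w v) v := by
          have : z t - w = t • B w v := by rw [hz, hw]; simp
          rw [this, hxv]
          simp only [sub_apply, map_add, map_smul, smul_apply, hsymm w (hsub hwm) v x, one_smul]
          module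
        rw [dist_eq_norm, e]
        refine (norm_sub_le _ _).trans ?_
        rw [norm_neg, norm_smul, Real.norm_of_nonneg ht.1]
        have e₁ : ‖(B (z t) - B w - fderiv ℝ B w (z t - w)) x'‖ ≤ C * (C * ‖v‖) ^ 2 * r := by
          calc _ ≤ ‖B (z t) - B w - fderiv ℝ B w (z t - w)‖ * ‖x'‖ :=
                ContinuousLinearMap.le_opNorm _ _
            _ ≤ (C * ‖z t - w‖ ^ 2) * r := by
                gcongr
                exact htaylor w hwm _ (hzmem ht')
            _ ≤ _ := by gcongr; exact hstep ht'
        have e₂ : t * ‖fderiv ℝ B w (B w v) v‖ ≤ 1 * (C * (C * ‖v‖) * ‖v‖) := by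
          have : ‖fderiv ℝ B w (B w v) v‖ ≤ C * (C * ‖v‖) * ‖v‖ := by
            refine (ContinuousLinearMap.le_opNorm _ _).trans ?_
            gcongr
            refine (ContinuousLinearMap.le_opNorm _ _).trans ?_
            gcongr
            · exact hbd' w hwm
            · refine (ContinuousLinearMap.le_opNorm _ _).trans ?_
              gcongr
              exact hbd w hwm
          exact mul_le_mul ht'.2 this (norm_nonneg _) zero_le_one
        calc _ ≤ C * (C * ‖v‖) ^ 2 * r + 1 * (C * (C * ‖v‖) * ‖v‖) := add_le_add e₁ e₂
          _ = M * ‖v‖ ^ 2 := by rw [hM]; ring)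
      (fun t ht => hzmem (hIco ht)) (by rw [hz]; simp [(hu x hx).1, (hu x' hx').1])
      1 (by simp)
    rw [gronwallBound_of_K_ne_0 (by rw [Real.coe_toNNReal _ (by positivity)]; positivity),
      Real.coe_toNNReal _ (by positivity), hCr, dist_eq_norm] at hG
    have e : u x' 1 - u x 1 - B (u x 1) v = u x' 1 - z 1 := by rw [hz]; simp only [one_smul]; abel
    rw [e]
    refine hG.trans (le_of_eq ?_)
    simp only [sub_zero, mul_one, zero_mul, zero_add]
    ring
  refine ⟨r, hr0, fun x => u x 1, ?_, fun x hx => ⟨?_, ?_⟩⟩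
  · have h0 : ‖(0 : F)‖ ≤ r := by simpa using hr0.le
    have := constant_of_has_deriv_right_zero (hcont h0)
      (fun t ht => by simpa using hderiv h0 ht) 1 (by simp)
    exact this.trans (hu 0 h0).1
  · exact hsub (hcl (hmem (by simpa using (mem_ball_zero_iff.1 hx).le) (by simp)))
  · refine HasFDerivAt.of_isLittleO ?_
    have hO : (fun x' => u x' 1 - u x 1 - B (u x 1) (x' - x)) =O[𝓝 x]
        fun x' => ‖x' - x‖ ^ 2 := by
      refine Asymptotics.IsBigO.of_bound (M / (a / 4) * (Real.exp (a / 4) - 1)) ?_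
      filter_upwards [Metric.isOpen_ball.mem_nhds hx] with x' hx'
      rw [norm_pow, norm_norm]
      exact hmain (mem_ball_zero_iff.1 hx).le (mem_ball_zero_iff.1 hx').le
    refine hO.trans_isLittleO ?_
    have := (Asymptotics.isLittleO_pow_id (𝕜 := ℝ) one_lt_two).comp_tendsto
      (k := fun x' : F => ‖x' - x‖) (l' := 𝓝 x)
      (by have : Filter.Tendsto (fun x' : F => ‖x' - x‖) (𝓝 x) (𝓝 ‖x - x‖) :=
            (continuous_id.sub continuous_const).norm.tendsto x
          simpa using this)
    exact this.of_norm_right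

/-- The solution of a smooth total differential equation is smooth. -/
theorem contDiffOn_of_hasFDerivAt_eq_comp {B : E → F →L[ℝ] E} {Ω : Set E} {N : Set F}
    (hN : IsOpen N) (hB : ContDiffOn ℝ ∞ B Ω) {f : F → E}
    (hf : ∀ x ∈ N, f x ∈ Ω ∧ HasFDerivAt f (B (f x)) x) : ContDiffOn ℝ ∞ f N := by
  rw [contDiffOn_infty]
  intro n
  induction n with
  | zero => exact contDiffOn_zero.2 fun x hx => (hf x hx).2.continuousAt.continuousWithinAt
  | succ n ih =>
    push_cast
    rw [contDiffOn_succ_iff_fderiv_of_isOpen hN]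
    refine ⟨fun x hx => (hf x hx).2.differentiableAt.differentiableWithinAt, by simp, ?_⟩
    -- Bootstrapping: if `f` is `C^n`, then so is `Df = B ∘ f`.
    refine ContDiffOn.congr ((hB.of_le (by exact_mod_cast le_top)).comp ih fun x hx => (hf x hx).1)
      fun x hx => (hf x hx).2.fderiv

/-- Integral manifolds of a commuting frame. -/
theorem exists_injOn_hasFDerivAt_eq_comp [FiniteDimensional ℝ E] [CompleteSpace F]
    {B : E → F →L[ℝ] E} {e₀ : E} {Ω : Set E}
    (hΩ : IsOpen Ω) (he₀ : e₀ ∈ Ω) (hB : ContDiffOn ℝ ∞ B Ω)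
    (hinj : Function.Injective (B e₀))
    (hsymm : ∀ e ∈ Ω, ∀ u v, fderiv ℝ B e (B e u) v = fderiv ℝ B e (B e v) u) :
    ∃ (N : Set F) (f : F → E), IsOpen N ∧ (0 : F) ∈ N ∧ f 0 = e₀ ∧ InjOn f N ∧
      ContDiffOn ℝ ∞ f N ∧ ∀ x ∈ N, f x ∈ Ω ∧ HasFDerivAt f (B (f x)) x := by
  have : CompleteSpace E := FiniteDimensional.complete ℝ E
  have : FiniteDimensional ℝ F := FiniteDimensional.of_injective (B e₀).toLinearMap hinj
  obtain ⟨r, hr, f, hf0, hf⟩ := exists_hasFDerivAt_eq_comp hΩ he₀ hB hsymm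
  have hsm := contDiffOn_of_hasFDerivAt_eq_comp Metric.isOpen_ball hB hf
  have h0 : (0 : F) ∈ Metric.ball (0 : F) r := Metric.mem_ball_self hr
  -- With `L` a left inverse of `B e₀`, the map `L ∘ f` has derivative the identity at `0`. It is
  -- therefore locally injective, and so is `f`.
  obtain ⟨L, hL⟩ := (B e₀).toLinearMap.exists_leftInverse_of_injective
    (LinearMap.ker_eq_bot.2 hinj)
  have hs : HasStrictFDerivAt f (B e₀) 0 := by
    have := ((hsm.contDiffAt (Metric.isOpen_ball.mem_nhds h0)).hasStrictFDerivAt (by simp))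
    rwa [(hf 0 h0).2.fderiv, hf0] at this
  have hs' : HasStrictFDerivAt (fun x => LinearMap.toContinuousLinearMap L (f x))
      ((ContinuousLinearEquiv.refl ℝ F : F ≃L[ℝ] F) : F →L[ℝ] F) 0 := by
    convert! (LinearMap.toContinuousLinearMap L).hasStrictFDerivAt.comp (0 : F) hs using 1
    ext x
    exact (LinearMap.congr_fun hL x).symm
  set P := hs'.toOpenPartialHomeomorph _
  refine ⟨Metric.ball 0 r ∩ P.source, f, Metric.isOpen_ball.inter P.open_source,
    ⟨h0, hs'.mem_toOpenPartialHomeomorph_source⟩, hf0, ?_, hsm.mono inter_subset_left,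
    fun x hx => hf x hx.1⟩
  intro x hx y hy hxy
  refine P.injOn hx.2 hy.2 ?_
  simp only [P, HasStrictFDerivAt.toOpenPartialHomeomorph_coe, hxy]

end TotalDifferentialEquation

open scoped Matrix

namespace KahlerFoliation

/-! ### Smoothness of fields and the bracket as a commutator of derivations -/

section SmoothFields

set_option linter.unusedSectionVars false

variable {E : Type*} [NormedAddCommGroup E] [NormedSpace ℝ E]
  {M : Type*} [TopologicalSpace M] [ChartedSpace E M] [IsManifold 𝓘(ℝ, E) ∞ M]

theorem isManifold_minSmoothness (n : ℕ) : IsManifold 𝓘(ℝ, E) (minSmoothness ℝ n) M :=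
  IsManifold.of_le (n := ∞)
    (by rw [minSmoothness_of_isRCLikeNormedField]; exact WithTop.coe_le_coe.2 le_top)

theorem contMDiffAt_minSmoothness {X : Π x : M, TangentSpace 𝓘(ℝ, E) x} {x : M} (n : ℕ)
    (hX : CMDiffAt ∞ (T% X) x) : CMDiffAt (minSmoothness ℝ n) (T% X) x :=
  hX.of_le (by rw [minSmoothness_of_isRCLikeNormedField]; exact WithTop.coe_le_coe.2 le_top)

theorem eventually_mdiffAt {X : Π x : M, TangentSpace 𝓘(ℝ, E) x} {x : M}
    (hX : CMDiffAt ∞ (T% X) x) : ∀ᶠ y in 𝓝 x, MDiffAt (T% X) y := by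
  filter_upwards [(contMDiffAt_iff_contMDiffAt_nhds (n := 1) (by simp)).1
    (hX.of_le (by simp))] with y hy
  exact hy.mdifferentiableAt one_ne_zero

theorem eventually_mdiffAt_fun {f : M → ℝ} {x : M}
    (hf : CMDiffAt ∞ f x) : ∀ᶠ y in 𝓝 x, MDiffAt f y := by
  have : IsManifold 𝓘(ℝ, E) 1 M := IsManifold.of_le (n := ∞) (by simp)
  filter_upwards [(contMDiffAt_iff_contMDiffAt_nhds (n := 1) (by simp)).1
    (hf.of_le (by simp))] with y hy
  exact hy.mdifferentiableAt one_ne_zero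

theorem mdiffAt_of_smooth {X : Π x : M, TangentSpace 𝓘(ℝ, E) x} {x : M}
    (hX : CMDiffAt ∞ (T% X) x) : MDiffAt (T% X) x :=
  hX.mdifferentiableAt (by simp)

/-- The derivative of a smooth function along a smooth vector field is smooth. -/
theorem contMDiffAt_mvfderiv_apply {F : Type*} [NormedAddCommGroup F] [NormedSpace ℝ F]
    {f : M → F} {X : Π x : M, TangentSpace 𝓘(ℝ, E) x} {x : M}
    (hf : CMDiffAt ∞ f x) (hX : CMDiffAt ∞ (T% X) x) :
    CMDiffAt ∞ (fun y => d% f y (X y)) x := by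
  have h := ContMDiffAt.clm_apply_of_inCoordinates (IM := 𝓘(ℝ, E))
    (hf.mfderiv_const (m := ∞) (by simp)) hX hf
  rw [contMDiffAt_totalSpace] at h
  have h2 := h.2
  simp only [trivializationAt_model_space_apply] at h2
  exact h2

/-- Cramer's rule: if the invertible matrix `G` and the vector `b` are smooth, so is `G⁻¹ b`. -/
theorem contMDiffAt_of_mulVec_eq {ι : Type*} [Fintype ι] [DecidableEq ι]
    {G : M → Matrix ι ι ℝ} {c b : M → ι → ℝ} {x : M}
    (hG : ∀ i j, CMDiffAt ∞ (fun y => G y i j) x) (hb : ∀ i, CMDiffAt ∞ (fun y => b y i) x)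
    (hdet : (G x).det ≠ 0) (h : ∀ᶠ y in 𝓝 x, G y *ᵥ c y = b y) (i : ι) :
    CMDiffAt ∞ (fun y => c y i) x := by
  have hdet' {A : M → Matrix ι ι ℝ} (hA : ∀ i j, CMDiffAt ∞ (fun y => A y i j) x) :
      CMDiffAt ∞ (fun y => (A y).det) x := by
    simp only [Matrix.det_apply]
    refine ContMDiffAt.sum fun σ _ => ?_
    simp only [Units.smul_def, zsmul_eq_mul]
    refine ContMDiffAt.mul contMDiffAt_const ?_
    exact contMDiffAt_finsetProd fun i _ => hA _ _
  have hev : ∀ᶠ y in 𝓝 x, (G y).det ≠ 0 :=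
    (hdet' hG).continuousAt.eventually_ne hdet
  have hc : CMDiffAt ∞ (fun y => (G y).det⁻¹ * ((G y).updateCol i (b y)).det) x := by
    refine ContMDiffAt.mul ?_ (hdet' fun k l => ?_)
    · exact ((contDiffAt_inv ℝ hdet).contMDiffAt).comp x (hdet' hG)
    · by_cases hl : l = i
      · subst hl; simpa using hb k
      · simpa [Matrix.updateCol_apply, hl] using hG k l
  refine hc.congr_of_eventuallyEq ?_
  filter_upwards [h, hev] with y hy hy'
  rw [← Matrix.cramer_apply, ← hy, Matrix.cramer_eq_adjugate_mulVec, Matrix.mulVec_mulVec,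
    Matrix.adjugate_mul]
  simp [Matrix.smul_mulVec, hy']

variable [FiniteDimensional ℝ E]

/-- Every tangent vector extends to a vector field that is smooth at its base point. -/
theorem exists_smooth_extend (x : M) (u : TangentSpace 𝓘(ℝ, E) x) :
    ∃ X : Π x : M, TangentSpace 𝓘(ℝ, E) x, CMDiffAt ∞ (T% X) x ∧ X x = u :=
  ⟨FiberBundle.extend E u, FiberBundle.contMDiffAt_extend 𝓘(ℝ, E) E u,
    FiberBundle.extend_apply_self ..⟩

/-- Near every point there is a smooth frame of the tangent bundle. -/
theorem exists_smooth_frame (x : M) :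
    ∃ W : Set M, IsOpen W ∧ x ∈ W ∧ ∃ X : Fin (Module.finrank ℝ E) → Π x : M, TangentSpace 𝓘(ℝ, E) x,
      (∀ i, CMDiff[W] ∞ (T% (X i))) ∧ ∀ y ∈ W, LinearIndependent ℝ (fun i => X i y) ∧
        Submodule.span ℝ (range fun i => X i y) = ⊤ := by
  let e := trivializationAt E (TangentSpace 𝓘(ℝ, E) : M → Type _) x
  have hf := e.isLocalFrameOn_localFrame_baseSet 𝓘(ℝ, E) ∞ (Module.finBasis ℝ E)
  exact ⟨e.baseSet, e.open_baseSet, FiberBundle.mem_baseSet_trivializationAt' x, _,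
    hf.contMDiffOn, fun y hy => ⟨hf.linearIndependent hy, top_le_iff.1 (hf.generating hy)⟩⟩

theorem contMDiffAt_mlieBracket {X Y : Π x : M, TangentSpace 𝓘(ℝ, E) x} {x : M}
    (hX : CMDiffAt ∞ (T% X) x) (hY : CMDiffAt ∞ (T% Y) x) :
    CMDiffAt ∞ (T% (mlieBracket 𝓘(ℝ, E) X Y)) x := by
  have : CompleteSpace E := FiniteDimensional.complete ℝ E
  have := isManifold_minSmoothness (E := E) (M := M) 3
  have : IsManifold 𝓘(ℝ, E) (((⊤ : ℕ∞) : WithTop ℕ∞) + 1) M := ‹IsManifold 𝓘(ℝ, E) ∞ M›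
  exact ContMDiffAt.mlieBracket_vectorField (m := ⊤) (n := ⊤) hX hY (by simp)

/-- `[X, Y] f = X (Y f) - Y (X f)`. -/
theorem mvfderiv_mlieBracket {X Y : Π x : M, TangentSpace 𝓘(ℝ, E) x} {f : M → ℝ} {x : M}
    (hX : CMDiffAt ∞ (T% X) x) (hY : CMDiffAt ∞ (T% Y) x) (hf : CMDiffAt ∞ f x) :
    d% f x (mlieBracket 𝓘(ℝ, E) X Y x)
      = d% (fun y => d% f y (Y y)) x (X x) - d% (fun y => d% f y (X y)) x (Y x) := by
  have : CompleteSpace E := FiniteDimensional.complete ℝ E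
  -- The Jacobi identity for `X`, `Y`, `f • Z`, expanded by the Leibniz rule and compared with `f`
  -- times the one for `X`, `Y`, `Z`, leaves the desired difference as a coefficient of `Z`.
  have key (Z : Π x : M, TangentSpace 𝓘(ℝ, E) x) (hZ : CMDiffAt ∞ (T% Z) x) :
      (d% f x (mlieBracket 𝓘(ℝ, E) X Y x) - (d% (fun y => d% f y (Y y)) x (X x)
        - d% (fun y => d% f y (X y)) x (Y x))) • Z x = 0 := by
    have hb {A B : Π x : M, TangentSpace 𝓘(ℝ, E) x} (hA : CMDiffAt ∞ (T% A) x)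
        (hB : CMDiffAt ∞ (T% B) x) := contMDiffAt_mlieBracket hA hB
    have hs {g : M → ℝ} {A : Π x : M, TangentSpace 𝓘(ℝ, E) x} (hg : CMDiffAt ∞ g x)
        (hA : CMDiffAt ∞ (T% A) x) : CMDiffAt ∞ (T% (g • A)) x := hg.smul_section hA
    have hXf := contMDiffAt_mvfderiv_apply hf hX
    have hYf := contMDiffAt_mvfderiv_apply hf hY
    have hmf : MDiffAt f x := hf.mdifferentiableAt (by simp)
    have hexp {A : Π x : M, TangentSpace 𝓘(ℝ, E) x} (hA : CMDiffAt ∞ (T% A) x) :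
        mlieBracket 𝓘(ℝ, E) A (f • Z)
          =ᶠ[𝓝 x] (fun y => d% f y (A y)) • Z + f • mlieBracket 𝓘(ℝ, E) A Z := by
      filter_upwards [eventually_mdiffAt_fun hf, eventually_mdiffAt hZ] with y hf hZ
      exact mlieBracket_smul_right hf hZ
    have hsec {A B : Π x : M, TangentSpace 𝓘(ℝ, E) x} (hA : CMDiffAt ∞ (T% A) x)
        (hB : CMDiffAt ∞ (T% B) x) :
        mlieBracket 𝓘(ℝ, E) A (mlieBracket 𝓘(ℝ, E) B (f • Z)) x
          = d% (fun y => d% f y (B y)) x (A x) • Z x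
            + d% f x (B x) • mlieBracket 𝓘(ℝ, E) A Z x
            + (d% f x (A x) • mlieBracket 𝓘(ℝ, E) B Z x
              + f x • mlieBracket 𝓘(ℝ, E) A (mlieBracket 𝓘(ℝ, E) B Z) x) := by
      have hBf := contMDiffAt_mvfderiv_apply hf hB
      rw [Filter.EventuallyEq.mlieBracket_vectorField_eq (Filter.EventuallyEq.refl _ A) (hexp hB),
        mlieBracket_add_right (mdiffAt_of_smooth (hs hBf hZ))
          (mdiffAt_of_smooth (hs hf (hb hB hZ))),
        mlieBracket_smul_right (hBf.mdifferentiableAt (by simp)) (mdiffAt_of_smooth hZ),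
        mlieBracket_smul_right hmf (mdiffAt_of_smooth (hb hB hZ))]
    have := isManifold_minSmoothness (E := E) (M := M) 3
    have j₁ := leibniz_identity_mlieBracket_apply (contMDiffAt_minSmoothness 2 hX)
      (contMDiffAt_minSmoothness 2 hY) (contMDiffAt_minSmoothness 2 (hs hf hZ))
    have j₂ := leibniz_identity_mlieBracket_apply (contMDiffAt_minSmoothness 2 hX)
      (contMDiffAt_minSmoothness 2 hY) (contMDiffAt_minSmoothness 2 hZ)
    rw [hsec hX hY, hsec hY hX, mlieBracket_smul_right hmf (mdiffAt_of_smooth hZ), j₂] at j₁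
    linear_combination (norm := module) -j₁
  by_cases hE : Nontrivial E
  · obtain ⟨u, hu⟩ : ∃ u : TangentSpace 𝓘(ℝ, E) x, u ≠ 0 := exists_ne (0 : E)
    obtain ⟨Z, hZ, hZu⟩ := exists_smooth_extend x u
    have := key Z hZ
    rw [hZu, smul_eq_zero] at this
    exact sub_eq_zero.1 (this.resolve_right hu)
  -- A zero-dimensional model space has no nonzero `Z` to divide by, but there all vectors vanish.
  · have h0 (u : TangentSpace 𝓘(ℝ, E) x) : u = 0 :=
      (not_nontrivial_iff_subsingleton.1 hE).elim (α := E) u 0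
    rw [h0 (mlieBracket 𝓘(ℝ, E) X Y x), h0 (X x), h0 (Y x)]
    simp

variable [RiemannianBundle (fun x : M => TangentSpace 𝓘(ℝ, E) x)]
  [IsContMDiffRiemannianBundle 𝓘(ℝ, E) ∞ E (fun x : M => TangentSpace 𝓘(ℝ, E) x)]

theorem contMDiffAt_inner {X Y : Π x : M, TangentSpace 𝓘(ℝ, E) x} {x : M}
    (hX : CMDiffAt ∞ (T% X) x) (hY : CMDiffAt ∞ (T% Y) x) :
    CMDiffAt ∞ (fun y => inner ℝ (X y) (Y y)) x :=
  ContMDiffAt.inner_bundle (E := fun x : M => TangentSpace 𝓘(ℝ, E) x) hX hY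

/-- A field in the span of a smooth frame is smooth if its inner products with the frame are. -/
theorem contMDiffAt_of_inner {k : ℕ} {X : Fin k → Π x : M, TangentSpace 𝓘(ℝ, E) x}
    {Y : Π x : M, TangentSpace 𝓘(ℝ, E) x} {x : M} (hX : ∀ i, CMDiffAt ∞ (T% (X i)) x)
    (hli : LinearIndependent ℝ fun i => X i x)
    (hY : ∀ᶠ y in 𝓝 x, Y y ∈ Submodule.span ℝ (range fun i => X i y))
    (hXY : ∀ i, CMDiffAt ∞ (fun y => inner ℝ (X i y) (Y y)) x) :
    CMDiffAt ∞ (T% Y) x := by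
  have hex (y : M) : ∃ c : Fin k → ℝ, Y y ∈ Submodule.span ℝ (range fun i => X i y) →
      ∑ i, c i • X i y = Y y := by
    by_cases h : Y y ∈ Submodule.span ℝ (range fun i => X i y)
    · obtain ⟨c, hc⟩ := (Submodule.mem_span_range_iff_exists_fun ℝ).1 h
      exact ⟨c, fun _ => hc⟩
    · exact ⟨0, fun h' => absurd h' h⟩
  choose c hc using hex
  have hcs (i : Fin k) : CMDiffAt ∞ (fun y => c y i) x := by
    -- The coefficients in the frame solve the linear system given by its Gram matrix, which is
    -- positive definite at `x`.
    refine contMDiffAt_of_mulVec_eq (G := fun y => Matrix.gram ℝ fun i => X i y)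
      (b := fun y i => inner ℝ (X i y) (Y y)) (fun i j => ?_) hXY ?_ ?_ i
    · exact contMDiffAt_inner (hX i) (hX j)
    · exact (Matrix.posDef_gram_of_linearIndependent (𝕜 := ℝ)
        (E := TangentSpace 𝓘(ℝ, E) x) hli).det_pos.ne'
    · filter_upwards [hY] with y hy
      ext i
      rw [← hc y hy, inner_sum]
      simp [Matrix.mulVec, dotProduct, Matrix.gram_apply, real_inner_smul_right, mul_comm]
  have : CMDiffAt ∞ (T% (fun y => ∑ i, c y i • X i y)) x :=
    ContMDiffAt.sum_section fun i _ => (hcs i).smul_section (hX i)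
  refine this.congr_of_eventuallyEq ?_
  filter_upwards [hY] with y hy
  rw [hc y hy]

/-- A field is smooth if its inner products with all smooth fields are. -/
theorem contMDiffAt_of_forall_inner {Y : Π x : M, TangentSpace 𝓘(ℝ, E) x} {x : M}
    (hY : ∀ X : Π x : M, TangentSpace 𝓘(ℝ, E) x, CMDiffAt ∞ (T% X) x →
      CMDiffAt ∞ (fun y => inner ℝ (X y) (Y y)) x) : CMDiffAt ∞ (T% Y) x := by
  obtain ⟨W, hW, hx, X, hX, hXW⟩ := exists_smooth_frame (E := E) x
  have hXx (i) : CMDiffAt ∞ (T% (X i)) x := (hX i).contMDiffAt (hW.mem_nhds hx)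
  refine contMDiffAt_of_inner hXx (hXW x hx).1 ?_ fun i => hY _ (hXx i)
  filter_upwards [hW.mem_nhds hx] with y hy
  rw [(hXW y hy).2]
  trivial

/-- The Levi-Civita derivative of a smooth field along a smooth field is smooth. -/
theorem contMDiffAt_leviCivita {X Y : Π x : M, TangentSpace 𝓘(ℝ, E) x} {x : M}
    (hX : CMDiffAt ∞ (T% X) x) (hY : CMDiffAt ∞ (T% Y) x) :
    CMDiffAt ∞ (T% (fun y => leviCivita E M Y y (X y))) x := by
  refine contMDiffAt_of_forall_inner fun Z hZ => ?_
  have h : CMDiffAt ∞ (fun y => koszul X Y Z y / 2) x := by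
    unfold koszul
    have hd {A B C : Π x : M, TangentSpace 𝓘(ℝ, E) x} (hA : CMDiffAt ∞ (T% A) x)
        (hB : CMDiffAt ∞ (T% B) x) (hC : CMDiffAt ∞ (T% C) x) :
        CMDiffAt ∞ (fun z => d% (fun y => inner ℝ (A y) (B y)) z (C z)) x :=
      contMDiffAt_mvfderiv_apply (contMDiffAt_inner hA hB) hC
    have hb {A B C : Π x : M, TangentSpace 𝓘(ℝ, E) x} (hA : CMDiffAt ∞ (T% A) x)
        (hB : CMDiffAt ∞ (T% B) x) (hC : CMDiffAt ∞ (T% C) x) :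
        CMDiffAt ∞ (fun z => inner ℝ (mlieBracket 𝓘(ℝ, E) A B z) (C z)) x :=
      contMDiffAt_inner (contMDiffAt_mlieBracket hA hB) hC
    exact ((((((hd hY hZ hX).add (hd hX hZ hY)).sub (hd hX hY hZ)).add (hb hX hY hZ)).sub
      (hb hX hZ hY)).sub (hb hY hZ hX)).div_const 2
  refine h.congr_of_eventuallyEq ?_
  filter_upwards [eventually_mdiffAt hX, eventually_mdiffAt hY, eventually_mdiffAt hZ]
    with y hX hY hZ
  rw [real_inner_comm]
  exact inner_leviCivitaFun hX hY hZ

end SmoothFields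

/-! ### Integrable distributions are involutive -/

section Involutive

set_option linter.unusedSectionVars false

variable {E : Type*} [NormedAddCommGroup E] [NormedSpace ℝ E]
  {M : Type*} [TopologicalSpace M] [ChartedSpace E M] [IsManifold 𝓘(ℝ, E) ∞ M]
  {F : Type*} [NormedAddCommGroup F] [NormedSpace ℝ F]
  {G : Type*} [NormedAddCommGroup G] [NormedSpace ℝ G]

theorem mvfderiv_comp_map {f : F → M} {g : M → G} (z : F) (hg : MDiffAt g (f z)) (hf : MDiffAt f z)
    (v : F) : d% (g ∘ f) z v = d% g (f z) (mfderiv 𝓘(ℝ, F) 𝓘(ℝ, E) f z v) :=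
  mfderiv_comp_apply z hg hf v

theorem mvfderiv_congr {f g : M → G} {x : M} (h : f =ᶠ[𝓝 x] g) (v : TangentSpace 𝓘(ℝ, E) x) :
    d% f x v = d% g x v := by
  have := h.mfderiv_eq (I := 𝓘(ℝ, E)) (I' := 𝓘(ℝ, G))
  exact DFunLike.congr_fun (F := E →L[ℝ] G) this v

theorem mvfderiv_clm_comp {g : M → G} {x : M} (hg : MDiffAt g x) (L : G →L[ℝ] F)
    (v : TangentSpace 𝓘(ℝ, E) x) : d% (fun y => L (g y)) x v = L (d% g x v) := by
  have h := mfderiv_comp_apply x (L.differentiableAt (x := g x)).mdifferentiableAt hg v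
  rw [mfderiv_eq_fderiv, ContinuousLinearMap.fderiv] at h
  exact h

theorem mvfderiv_injective_extChartAt {p y : M} (hy : y ∈ (extChartAt 𝓘(ℝ, E) p).source) :
    Function.Injective (d% (extChartAt 𝓘(ℝ, E) p) y) :=
  (isInvertible_mfderiv_extChartAt hy).injective

theorem contMDiffAt_extChartAt_of_mem {p y : M} (hy : y ∈ (extChartAt 𝓘(ℝ, E) p).source) :
    CMDiffAt ∞ (extChartAt 𝓘(ℝ, E) p) y :=
  contMDiffAt_extChartAt' (by simpa using hy)

variable [FiniteDimensional ℝ E]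

/-- `[X, Y] f = X (Y f) - Y (X f)` for vector valued functions. -/
theorem mvfderiv_mlieBracket_vector {X Y : Π x : M, TangentSpace 𝓘(ℝ, E) x} {f : M → G} {x : M}
    (hX : CMDiffAt ∞ (T% X) x) (hY : CMDiffAt ∞ (T% Y) x) (hf : CMDiffAt ∞ f x) :
    d% f x (mlieBracket 𝓘(ℝ, E) X Y x)
      = d% (fun y => d% f y (Y y)) x (X x) - d% (fun y => d% f y (X y)) x (Y x) := by
  refine (SeparatingDual.eq_iff_forall_dual_eq (R := ℝ)).2 fun L => ?_
  have hLf : CMDiffAt ∞ (fun y => L (f y)) x := (L.contDiff.contMDiff.contMDiffAt).comp x hf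
  have hev : ∀ᶠ y in 𝓝 x, MDiffAt f y := by
    have : IsManifold 𝓘(ℝ, E) 1 M := IsManifold.of_le (n := ∞) (by simp)
    filter_upwards [(contMDiffAt_iff_contMDiffAt_nhds (n := 1) (by simp)).1
      (hf.of_le (by simp))] with y hy
    exact hy.mdifferentiableAt one_ne_zero
  have h2 {A : Π x : M, TangentSpace 𝓘(ℝ, E) x} (hA : CMDiffAt ∞ (T% A) x)
      (v : TangentSpace 𝓘(ℝ, E) x) :
      d% (fun y => d% (fun y => L (f y)) y (A y)) x v = L (d% (fun y => d% f y (A y)) x v) := by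
    rw [← mvfderiv_clm_comp ((contMDiffAt_mvfderiv_apply hf hA).mdifferentiableAt (by simp))]
    have : (fun y => d% (fun y => L (f y)) y (A y)) =ᶠ[𝓝 x] fun y => L (d% f y (A y)) := by
      filter_upwards [hev] with y hy
      exact mvfderiv_clm_comp hy L _
    exact mvfderiv_congr this v
  rw [map_sub, ← h2 hX, ← h2 hY, ← mvfderiv_clm_comp hev.self_of_nhds,
    mvfderiv_mlieBracket hX hY hLf]

/-- A vector field tangent to an immersed submanifold lifts to the source of the immersion. -/
theorem exists_lift [FiniteDimensional ℝ F] {f : F → M} {z₀ : F}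
    {X : Π x : M, TangentSpace 𝓘(ℝ, E) x} (hf : ∀ᶠ z in 𝓝 z₀, CMDiffAt ∞ f z)
    (hinj : Function.Injective (mfderiv 𝓘(ℝ, F) 𝓘(ℝ, E) f z₀)) (hX : CMDiffAt ∞ (T% X) (f z₀))
    (hXf : ∀ᶠ z in 𝓝 z₀, X (f z) ∈ (mfderiv 𝓘(ℝ, F) 𝓘(ℝ, E) f z).range) :
    ∃ Z : Π z : F, TangentSpace 𝓘(ℝ, F) z, CMDiffAt ∞ (T% Z) z₀ ∧
      ∀ᶠ z in 𝓝 z₀, mfderiv 𝓘(ℝ, F) 𝓘(ℝ, E) f z (Z z) = X (f z) := by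
  have : CompleteSpace F := FiniteDimensional.complete ℝ F
  set φ := extChartAt 𝓘(ℝ, E) (f z₀) with hφ
  have hfz := hf.self_of_nhds
  have hsrc : ∀ᶠ z in 𝓝 z₀, f z ∈ φ.source :=
    hfz.continuousAt.eventually (extChartAt_source_mem_nhds (f z₀))
  have hφc {z : F} (hz : f z ∈ φ.source) : CMDiffAt ∞ φ (f z) := contMDiffAt_extChartAt_of_mem hz
  have hH : ContDiffAt ℝ ∞ (φ ∘ f) z₀ :=
    ((hφc hsrc.self_of_nhds).comp z₀ hfz).contDiffAt
  have hdH {z : F} (hz : f z ∈ φ.source) (hfz : CMDiffAt ∞ f z) (v : F) :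
      fderiv ℝ (φ ∘ f) z v = d% φ (f z) (mfderiv 𝓘(ℝ, F) 𝓘(ℝ, E) f z v) := by
    have h := mvfderiv_comp_map z ((hφc hz).mdifferentiableAt (by simp))
      (hfz.mdifferentiableAt (by simp)) v
    refine Eq.trans ?_ h
    exact (DFunLike.congr_fun (F := F →L[ℝ] E) (mfderiv_eq_fderiv (f := φ ∘ f) (x := z)) v).symm
  have hHinj : Function.Injective (fderiv ℝ (φ ∘ f) z₀) := by
    intro u v huv
    have huv' := ((hdH hsrc.self_of_nhds hfz u).symm.trans huv).trans
      (hdH hsrc.self_of_nhds hfz v)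
    exact hinj (mvfderiv_injective_extChartAt hsrc.self_of_nhds huv')
  obtain ⟨L', hL'⟩ := (fderiv ℝ (φ ∘ f) z₀).toLinearMap.exists_leftInverse_of_injective
    (LinearMap.ker_eq_bot.2 hHinj)
  set L : E →L[ℝ] F := LinearMap.toContinuousLinearMap L'
  -- `A` is the identity at `z₀`, hence invertible nearby, and `A⁻¹ L dφ(X)` recovers the preimage
  -- of `X` under the differential of `f`. Unlike a pointwise choice of preimage, this formula is
  -- visibly smooth.
  set A : F → F →L[ℝ] F := fun z => L.comp (fderiv ℝ (φ ∘ f) z) with hA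
  have hA0 : A z₀ = ((ContinuousLinearEquiv.refl ℝ F : F ≃L[ℝ] F) : F →L[ℝ] F) := by
    ext v
    exact LinearMap.congr_fun hL' v
  have hAc : ContDiffAt ℝ ∞ A z₀ :=
    contDiffAt_const.clm_comp (hH.fderiv_right (m := ∞) (by simp))
  have hb : CMDiffAt ∞ (fun z => d% φ (f z) (X (f z))) z₀ := by
    have h0 : CMDiffAt ∞ (fun y => d% φ y (X y)) (f z₀) :=
      contMDiffAt_mvfderiv_apply (hφc hsrc.self_of_nhds) hX
    exact ContMDiffAt.comp (g := fun y => d% φ y (X y)) z₀ h0 hfz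
  have hAinv : ContDiffAt ℝ ∞ (fun z => (A z).inverse) z₀ := by
    refine ContDiffAt.comp (g := ContinuousLinearMap.inverse) z₀ ?_ hAc
    rw [hA0]
    exact contDiffAt_map_inverse _
  refine ⟨fun z => (A z).inverse (L (d% φ (f z) (X (f z)))), ?_, ?_⟩
  · refine contMDiffAt_vectorSpace_iff_contDiffAt.2 ?_
    exact hAinv.clm_apply (contDiffAt_const.clm_apply hb.contDiffAt)
  · have hinvA : ∀ᶠ z in 𝓝 z₀, A z ∈ range ((↑) : (F ≃L[ℝ] F) → F →L[ℝ] F) := by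
      refine hAc.continuousAt.eventually ?_
      rw [hA0]
      exact ContinuousLinearEquiv.nhds _
    filter_upwards [hf, hsrc, hinvA, hXf] with z hfz hz ⟨e, he⟩ ⟨(u : F), hu⟩
    have hu' : mfderiv 𝓘(ℝ, F) 𝓘(ℝ, E) f z u = X (f z) := hu
    have h1 : L (d% φ (f z) (X (f z))) = e u := by
      rw [← hu']
      exact (congrArg L (hdH hz hfz u)).symm.trans (DFunLike.congr_fun he u).symm
    have h2 : (A z).inverse (L (d% φ (f z) (X (f z)))) = u := by
      rw [h1, ← he, ContinuousLinearMap.inverse_equiv]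
      exact e.symm_apply_apply u
    exact (congrArg (fun w : F => (mfderiv 𝓘(ℝ, F) 𝓘(ℝ, E) f z w : TangentSpace 𝓘(ℝ, E) (f z)))
      h2).trans hu'

/-- The bracket of two fields tangent to an immersed submanifold is tangent to it. -/
theorem mlieBracket_mem_range_mfderiv [FiniteDimensional ℝ F] {f : F → M} {z₀ : F}
    {X Y : Π x : M, TangentSpace 𝓘(ℝ, E) x} (hf : ∀ᶠ z in 𝓝 z₀, CMDiffAt ∞ f z)
    (hinj : Function.Injective (mfderiv 𝓘(ℝ, F) 𝓘(ℝ, E) f z₀)) (hX : CMDiffAt ∞ (T% X) (f z₀))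
    (hY : CMDiffAt ∞ (T% Y) (f z₀))
    (hXf : ∀ᶠ z in 𝓝 z₀, X (f z) ∈ (mfderiv 𝓘(ℝ, F) 𝓘(ℝ, E) f z).range)
    (hYf : ∀ᶠ z in 𝓝 z₀, Y (f z) ∈ (mfderiv 𝓘(ℝ, F) 𝓘(ℝ, E) f z).range) :
    mlieBracket 𝓘(ℝ, E) X Y (f z₀) ∈ (mfderiv 𝓘(ℝ, F) 𝓘(ℝ, E) f z₀).range := by
  obtain ⟨X', hX', hXX'⟩ := exists_lift hf hinj hX hXf
  obtain ⟨Y', hY', hYY'⟩ := exists_lift hf hinj hY hYf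
  set φ := extChartAt 𝓘(ℝ, E) (f z₀)
  have hfz := hf.self_of_nhds
  have hfd := hfz.mdifferentiableAt (n := ∞) (by simp)
  have hsrc : ∀ᶠ z in 𝓝 z₀, f z ∈ φ.source :=
    hfz.continuousAt.eventually (extChartAt_source_mem_nhds (f z₀))
  have hφc {z : F} (hz : f z ∈ φ.source) : CMDiffAt ∞ φ (f z) := contMDiffAt_extChartAt_of_mem hz
  have hφ0 := hφc hsrc.self_of_nhds
  -- The bracket of the lifts maps to the bracket of the fields. This is tested on the chart `φ`,
  -- whose differential is injective, by differentiating `φ ∘ f`.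
  refine ⟨mlieBracket 𝓘(ℝ, F) X' Y' z₀, ?_⟩
  apply mvfderiv_injective_extChartAt hsrc.self_of_nhds
  have hrel {A : Π x : M, TangentSpace 𝓘(ℝ, E) x} {A' : Π z : F, TangentSpace 𝓘(ℝ, F) z}
      (hA : CMDiffAt ∞ (T% A) (f z₀))
      (hAA' : ∀ᶠ z in 𝓝 z₀, mfderiv 𝓘(ℝ, F) 𝓘(ℝ, E) f z (A' z) = A (f z)) (v : F) :
      d% (fun z => d% (φ ∘ f) z (A' z)) z₀ v
        = d% (fun y => d% φ y (A y)) (f z₀) (mfderiv 𝓘(ℝ, F) 𝓘(ℝ, E) f z₀ v) := by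
    refine Eq.trans ?_ (mvfderiv_comp_map z₀
      ((contMDiffAt_mvfderiv_apply hφ0 hA).mdifferentiableAt (by simp)) hfd v)
    have : (fun z => d% (φ ∘ f) z (A' z)) =ᶠ[𝓝 z₀] (fun y => d% φ y (A y)) ∘ f := by
      filter_upwards [hAA', hf, hsrc] with z hz hfz hzs
      exact (mvfderiv_comp_map z ((hφc hzs).mdifferentiableAt (by simp))
        (hfz.mdifferentiableAt (by simp)) _).trans (congrArg (d% φ (f z)) hz)
    exact mvfderiv_congr this v
  have h := mvfderiv_mlieBracket_vector hX' hY' (hφ0.comp z₀ hfz)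
  have hX₁ := (hrel hX hXX' (Y' z₀)).trans (congrArg _ hYY'.self_of_nhds)
  have hY₁ := (hrel hY hYY' (X' z₀)).trans (congrArg _ hXX'.self_of_nhds)
  refine (mvfderiv_comp_map z₀ (hφ0.mdifferentiableAt (by simp)) hfd _).symm.trans (h.trans ?_)
  exact (congrArg₂ (· - ·) hY₁ hX₁).trans (mvfderiv_mlieBracket_vector hX hY hφ0).symm

/-- The tangent distribution of a foliation is involutive. -/
theorem IsIntegrableOn.mlieBracket_mem {U : Set M}
    {D : Π x : M, Submodule ℝ (TangentSpace 𝓘(ℝ, E) x)} (hD : IsIntegrableOn U D) {x : M}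
    (hx : x ∈ U) {X Y : Π x : M, TangentSpace 𝓘(ℝ, E) x} (hX : CMDiffAt ∞ (T% X) x)
    (hY : CMDiffAt ∞ (T% Y) x) (hXD : ∀ᶠ y in 𝓝 x, X y ∈ D y) (hYD : ∀ᶠ y in 𝓝 x, Y y ∈ D y) :
    mlieBracket 𝓘(ℝ, E) X Y x ∈ D x := by
  obtain ⟨k, N, f, hf, z₀, hz₀, rfl⟩ := hD x hx
  have hN := hf.isOpen.mem_nhds hz₀
  have hfs : ∀ᶠ z in 𝓝 z₀, CMDiffAt ∞ f z := by
    filter_upwards [hN] with z hz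
    exact (hf.contMDiffOn z hz).contMDiffAt (hf.isOpen.mem_nhds hz)
  have hr {A : Π x : M, TangentSpace 𝓘(ℝ, E) x} (hA : ∀ᶠ y in 𝓝 (f z₀), A y ∈ D y) :
      ∀ᶠ z in 𝓝 z₀, A (f z) ∈
        (mfderiv 𝓘(ℝ, EuclideanSpace ℝ (Fin k)) 𝓘(ℝ, E) f z).range := by
    filter_upwards [hN, hfs.self_of_nhds.continuousAt.eventually hA] with z hz hAz
    rw [hf.range_mfderiv z hz]
    exact hAz
  rw [← hf.range_mfderiv z₀ hz₀]
  exact mlieBracket_mem_range_mfderiv hfs (hf.injective_mfderiv z₀ hz₀) hX hY (hr hXD) (hr hYD)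

end Involutive

/-! ### Commuting frames for involutive distributions -/

section Frobenius

set_option linter.unusedSectionVars false

variable {E : Type*} [NormedAddCommGroup E] [NormedSpace ℝ E]
  {M : Type*} [TopologicalSpace M] [ChartedSpace E M] [IsManifold 𝓘(ℝ, E) ∞ M]
  [FiniteDimensional ℝ E]

theorem contMDiffAt_clm_comp {G G' : Type*} [NormedAddCommGroup G] [NormedSpace ℝ G]
    [NormedAddCommGroup G'] [NormedSpace ℝ G'] (L : G →L[ℝ] G') {f : M → G} {x : M}
    (hf : CMDiffAt ∞ f x) : CMDiffAt ∞ (fun y => L (f y)) x :=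
  (L.contDiff.contMDiff.contMDiffAt).comp x hf

/-- An involutive distribution has local frames of commuting fields. -/
theorem exists_commuting_frame {U : Set M} {D : Π x : M, Submodule ℝ (TangentSpace 𝓘(ℝ, E) x)}
    (hD : IsSmoothDistributionOn U D)
    (hinv : ∀ W ⊆ U, IsOpen W → ∀ X Y : Π x : M, TangentSpace 𝓘(ℝ, E) x, IsSectionOn D W X →
      IsSectionOn D W Y → ∀ x ∈ W, mlieBracket 𝓘(ℝ, E) X Y x ∈ D x) {p : M} (hp : p ∈ U) :
    ∃ W ⊆ U, IsOpen W ∧ p ∈ W ∧ ∃ (k : ℕ) (Y : Fin k → Π x : M, TangentSpace 𝓘(ℝ, E) x),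
      (∀ i, CMDiff[W] ∞ (T% (Y i))) ∧
      (∀ x ∈ W, LinearIndependent ℝ (fun i => Y i x) ∧
        Submodule.span ℝ (range fun i => Y i x) = D x) ∧
      ∀ x ∈ W, ∀ i j, mlieBracket 𝓘(ℝ, E) (Y i) (Y j) x = 0 := by
  obtain ⟨W, hWU, hW, hpW, k, X, hX, hXD⟩ := hD p hp
  set φ := extChartAt 𝓘(ℝ, E) p with hφ
  -- `L ∘ φ` plays the role of `k` coordinate functions whose differentials restrict to an
  -- isomorphism on `D p`.
  obtain ⟨L, hL⟩ : ∃ L : E →L[ℝ] (Fin k → ℝ), ∀ i, L (d% φ p (X i p)) = Pi.single i 1 := by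
    have hli : LinearIndependent ℝ fun i => d% φ p (X i p) :=
      (hXD p hpW).1.map' (d% φ p).toLinearMap
        (LinearMap.ker_eq_bot.2 (mvfderiv_injective_extChartAt (mem_extChartAt_source p)))
    obtain ⟨L, hL⟩ := (Fintype.linearCombination ℝ fun i => d% φ p (X i p)).exists_leftInverse_of_injective
      (LinearMap.ker_eq_bot.2 hli.fintypeLinearCombination_injective)
    refine ⟨LinearMap.toContinuousLinearMap L, fun i => ?_⟩
    simpa using LinearMap.congr_fun hL (Pi.single i 1)
  have hXs {y : M} (hy : y ∈ W) (i) : CMDiffAt ∞ (T% (X i)) y :=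
    (hX i).contMDiffAt (hW.mem_nhds hy)
  set G : M → Matrix (Fin k) (Fin k) ℝ := fun y => .of fun i j => L (d% φ y (X j y)) i with hG
  have hGs {y : M} (hy : y ∈ W ∩ φ.source) (i j) : CMDiffAt ∞ (fun y => G y i j) y :=
    contMDiffAt_clm_comp ((ContinuousLinearMap.proj i).comp L)
      (contMDiffAt_mvfderiv_apply (contMDiffAt_extChartAt_of_mem hy.2) (hXs hy.1 j))
  have hS : IsOpen (W ∩ φ.source) := hW.inter (isOpen_extChartAt_source p)
  have hdet : ContinuousOn (fun y => (G y).det) (W ∩ φ.source) := by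
    refine continuousOn_of_forall_continuousAt fun y hy => ?_
    refine (continuous_id.matrix_det).continuousAt.comp (f := G) (g := Matrix.det) ?_
    exact continuousAt_pi.2 fun i => continuousAt_pi.2 fun j => (hGs hy i j).continuousAt
  set W' : Set M := (W ∩ φ.source) ∩ (fun y => (G y).det) ⁻¹' {0}ᶜ with hW'
  have hW'o : IsOpen W' := hdet.isOpen_inter_preimage hS isOpen_compl_singleton
  have hinjD {y : M} (hy : y ∈ W') {w : TangentSpace 𝓘(ℝ, E) y} (hw : w ∈ D y)
      (h0 : L (d% φ y w) = 0) : w = 0 := by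
    rw [← (hXD y hy.1.1).2, Submodule.mem_span_range_iff_exists_fun] at hw
    obtain ⟨c, rfl⟩ := hw
    have : G y *ᵥ c = 0 := by
      rw [← h0]
      ext i
      simp [hG, Matrix.mulVec, dotProduct, mul_comm]
    have hc : c = 0 := Matrix.eq_zero_of_mulVec_eq_zero hy.2 this
    simp [hc]
  -- The frame is normalised by `G⁻¹` so that `L ∘ dφ` sends it to the constant standard basis.
  set Y : Fin k → Π x : M, TangentSpace 𝓘(ℝ, E) x := fun j y => ∑ i, (G y)⁻¹ i j • X i y with hY
  have hYs {y : M} (hy : y ∈ W') (j) : CMDiffAt ∞ (T% (Y j)) y := by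
    refine ContMDiffAt.sum_section fun i _ => ContMDiffAt.smul_section ?_ (hXs hy.1.1 i)
    refine contMDiffAt_of_mulVec_eq (c := fun y i => (G y)⁻¹ i j)
      (b := fun _ i => (1 : Matrix (Fin k) (Fin k) ℝ) i j) (hGs hy.1)
      (fun i => contMDiffAt_const) hy.2 ?_ i
    filter_upwards [hW'o.mem_nhds hy] with z hz
    ext i
    rw [← Matrix.mul_nonsing_inv (G z) (isUnit_iff_ne_zero.2 hz.2)]
    rfl
  have hYD {y : M} (hy : y ∈ W') (j) : Y j y ∈ D y := by
    rw [← (hXD y hy.1.1).2]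
    exact Submodule.sum_mem _ fun i _ => Submodule.smul_mem _ _ (Submodule.subset_span ⟨i, rfl⟩)
  have hLY {y : M} (hy : y ∈ W') (j) : L (d% φ y (Y j y)) = Pi.single j 1 := by
    ext i
    have := congrFun (congrFun (Matrix.mul_nonsing_inv (G y) (isUnit_iff_ne_zero.2 hy.2)) i) j
    rw [Matrix.mul_apply] at this
    simp only [hY, map_sum, map_smul, Finset.sum_apply, Pi.smul_apply, smul_eq_mul]
    rw [Pi.single_apply, ← Matrix.one_apply, ← this]
    exact Finset.sum_congr rfl fun l _ => mul_comm _ _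
  have hlc {y : M} (hy : y ∈ W') (c : Fin k → ℝ) : L (d% φ y (∑ j, c j • Y j y)) = c := by
    simp only [map_sum, map_smul, hLY hy]
    ext i
    simp [Pi.single_apply]
  refine ⟨W', fun y hy => hWU hy.1.1, hW'o, ⟨⟨hpW, mem_extChartAt_source p⟩, ?_⟩, k, Y,
    fun i y hy => (hYs hy i).contMDiffWithinAt, fun y hy => ⟨?_, le_antisymm ?_ ?_⟩,
    fun y hy i j => hinjD hy ?_ ?_⟩
  · have : G p = 1 := by
      ext i j
      rw [Matrix.one_apply, ← Pi.single_apply j (1 : ℝ) i, ← hL j]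
      rfl
    simp [this]
  · refine Fintype.linearIndependent_iff.2 fun c hc i => ?_
    rw [← hlc hy c, hc]
    simp
  · rw [Submodule.span_le]
    rintro _ ⟨j, rfl⟩
    exact hYD hy j
  · intro w hw
    have : w - ∑ j, L (d% φ y w) j • Y j y = 0 :=
      hinjD hy (Submodule.sub_mem _ hw (Submodule.sum_mem _ fun j _ =>
        Submodule.smul_mem _ _ (hYD hy j))) (by rw [map_sub, map_sub, hlc hy, sub_self])
    rw [sub_eq_zero.1 this]
    exact Submodule.sum_mem _ fun i _ => Submodule.smul_mem _ _ (Submodule.subset_span ⟨i, rfl⟩)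
  · exact hinv W' (fun y hy => hWU hy.1.1) hW'o _ _
      ⟨fun y hy => (hYs hy i).contMDiffWithinAt, fun y hy => hYD hy i⟩
      ⟨fun y hy => (hYs hy j).contMDiffWithinAt, fun y hy => hYD hy j⟩ y hy
  -- The derivatives of the functions `L ∘ φ` along the `Y m` are constant, so the bracket
  -- annihilates them. It lies in `D`, where `L ∘ dφ` is injective, so it is zero.
  · have hφy {z : M} (hz : z ∈ W') : CMDiffAt ∞ φ z := contMDiffAt_extChartAt_of_mem hz.1.2
    ext l
    set L' : E →L[ℝ] ℝ := (ContinuousLinearMap.proj l).comp L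
    have hd {z : M} (hz : z ∈ W') (v : TangentSpace 𝓘(ℝ, E) z) :
        d% (fun y => L' (φ y)) z v = L (d% φ z v) l :=
      mvfderiv_clm_comp ((hφy hz).mdifferentiableAt (by simp)) L' v
    have hconst (m) (v : TangentSpace 𝓘(ℝ, E) y) :
        d% (fun z => d% (fun y => L' (φ y)) z (Y m z)) y v = 0 := by
      have : (fun z => d% (fun y => L' (φ y)) z (Y m z))
          =ᶠ[𝓝 y] fun _ => (Pi.single m 1 : Fin k → ℝ) l := by
        filter_upwards [hW'o.mem_nhds hy] with z hz
        rw [hd hz, hLY hz]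
      rw [mvfderiv_congr this]
      exact (DFunLike.congr_fun (F := E →L[ℝ] ℝ) mfderiv_const v)
    rw [← hd hy, mvfderiv_mlieBracket (hYs hy i) (hYs hy j)
      (contMDiffAt_clm_comp L' (hφy hy)), hconst, hconst, sub_zero]
    rfl

end Frobenius

/-! ### Frobenius' theorem -/

section Integrable

set_option linter.unusedSectionVars false

variable {E : Type*} [NormedAddCommGroup E] [NormedSpace ℝ E]
  {M : Type*} [TopologicalSpace M] [ChartedSpace E M] [IsManifold 𝓘(ℝ, E) ∞ M]
  [FiniteDimensional ℝ E]

/-- In a chart, an integral manifold is a solution of `Df = B ∘ f`, where `B e v` is the combination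
of the frame fields at `e` with coefficients `v`. The integrability condition for `B` is exactly
that the fields commute. -/
theorem exists_isIntegralManifoldIn_of_commuting {U W : Set M}
    {D : Π x : M, Submodule ℝ (TangentSpace 𝓘(ℝ, E) x)} (hWU : W ⊆ U) (hW : IsOpen W) {p : M}
    (hp : p ∈ W) {k : ℕ} {Y : Fin k → Π x : M, TangentSpace 𝓘(ℝ, E) x}
    (hY : ∀ i, CMDiff[W] ∞ (T% (Y i))) (hYD : ∀ x ∈ W, LinearIndependent ℝ (fun i => Y i x) ∧
      Submodule.span ℝ (range fun i => Y i x) = D x)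
    (hYY : ∀ x ∈ W, ∀ i j, mlieBracket 𝓘(ℝ, E) (Y i) (Y j) x = 0) :
    ∃ (N : Set (EuclideanSpace ℝ (Fin k))) (f : EuclideanSpace ℝ (Fin k) → M),
      IsIntegralManifoldIn U D N f ∧ p ∈ f '' N := by
  have : CompleteSpace E := FiniteDimensional.complete ℝ E
  set φ := extChartAt 𝓘(ℝ, E) p with hφ
  have hYs {y : M} (hy : y ∈ W) (i) : CMDiffAt ∞ (T% (Y i)) y :=
    (hY i).contMDiffAt (hW.mem_nhds hy)
  set a : Fin k → M → E := fun j y => d% φ y (Y j y) with ha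
  have has {y : M} (hy : y ∈ W) (hyφ : y ∈ φ.source) (j) : CMDiffAt ∞ (a j) y :=
    contMDiffAt_mvfderiv_apply (contMDiffAt_extChartAt_of_mem hyφ) (hYs hy j)
  set Ω : Set E := φ.target ∩ φ.symm ⁻¹' W with hΩ
  have hΩo : IsOpen Ω :=
    (continuousOn_extChartAt_symm p).isOpen_inter_preimage (isOpen_extChartAt_target p) hW
  have hsymm {e : E} (he : e ∈ φ.target) : CMDiffAt ∞ φ.symm e :=
    (contMDiffOn_extChartAt_symm p).contMDiffAt ((isOpen_extChartAt_target p).mem_nhds he)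
  have hsrc {e : E} (he : e ∈ φ.target) : φ.symm e ∈ φ.source := φ.map_target he
  have hâ {e : E} (he : e ∈ Ω) (j) : ContDiffAt ℝ ∞ (fun e => a j (φ.symm e)) e :=
    (ContMDiffAt.comp e (has he.2 (hsrc he.1) j) (hsymm he.1)).contDiffAt
  set B : E → EuclideanSpace ℝ (Fin k) →L[ℝ] E := fun e =>
    ∑ j, (EuclideanSpace.proj j : EuclideanSpace ℝ (Fin k) →L[ℝ] ℝ).smulRight (a j (φ.symm e))
    with hB
  have hBv (e : E) (v : EuclideanSpace ℝ (Fin k)) : B e v = ∑ j, v j • a j (φ.symm e) := by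
    simp [hB]
  have hBs : ContDiffOn ℝ ∞ B Ω := by
    refine ContDiffOn.sum fun j _ => ?_
    intro e he
    exact (contDiffAt_const.smulRight (hâ he j)).contDiffWithinAt
  have hBd {e : E} (he : e ∈ Ω) (w : E) (v : EuclideanSpace ℝ (Fin k)) :
      fderiv ℝ B e w v = ∑ j, v j • fderiv ℝ (fun e => a j (φ.symm e)) e w := by
    have h1 : HasFDerivAt (fun e => B e v)
        (∑ j, v j • fderiv ℝ (fun e => a j (φ.symm e)) e) e := by
      simp only [hBv]
      refine HasFDerivAt.fun_sum fun j _ => HasFDerivAt.const_smul ?_ _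
      exact ((hâ he j).differentiableAt (by simp)).hasFDerivAt
    have h2 : HasFDerivAt (fun e => B e v) ((fderiv ℝ B e).flip v) e :=
      (((hBs e he).contDiffAt (hΩo.mem_nhds he)).differentiableAt (by simp)).hasFDerivAt.clm_apply
        (hasFDerivAt_const v e) |>.congr_fderiv (by ext; simp)
    have := congrArg (fun A : E →L[ℝ] E => A w) (h2.unique h1)
    simpa using this
  have hâd {e : E} (he : e ∈ Ω) (i j) : fderiv ℝ (fun e => a j (φ.symm e)) e (a i (φ.symm e))
      = d% (a j) (φ.symm e) (Y i (φ.symm e)) := by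
    have h1 : a j =ᶠ[𝓝 (φ.symm e)] (fun e => a j (φ.symm e)) ∘ φ := by
      filter_upwards [(isOpen_extChartAt_source p).mem_nhds (hsrc he.1)] with y hy
      simp only [Function.comp, hφ]
      rw [(extChartAt 𝓘(ℝ, E) p).left_inv hy]
    rw [mvfderiv_congr h1]
    have he' : φ (φ.symm e) = e := φ.right_inv he.1
    have h2 := mfderiv_comp_apply (I := 𝓘(ℝ, E)) (I' := 𝓘(ℝ, E)) (I'' := 𝓘(ℝ, E)) (φ.symm e)
      (g := fun e => a j (φ.symm e)) (f := φ)
      (by rw [he']; exact ((hâ he j).differentiableAt (by simp)).mdifferentiableAt)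
      ((contMDiffAt_extChartAt_of_mem (hsrc he.1)).mdifferentiableAt (by simp)) (Y i (φ.symm e))
    refine Eq.trans ?_ h2.symm
    rw [he', mfderiv_eq_fderiv]
    rfl
  have hsym : ∀ e ∈ Ω, ∀ u v, fderiv ℝ B e (B e u) v = fderiv ℝ B e (B e v) u := by
    intro e he u v
    have hij (i j) : fderiv ℝ (fun e => a j (φ.symm e)) e (a i (φ.symm e))
        = fderiv ℝ (fun e => a i (φ.symm e)) e (a j (φ.symm e)) := by
      have := mvfderiv_mlieBracket_vector (hYs he.2 i) (hYs he.2 j)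
        (contMDiffAt_extChartAt_of_mem (hsrc he.1))
      rw [hYY _ he.2, map_zero] at this
      rw [hâd he, hâd he]
      exact sub_eq_zero.1 this.symm
    rw [hBd he, hBd he]
    simp only [hBv, map_sum, map_smul, Finset.smul_sum]
    rw [Finset.sum_comm]
    refine Finset.sum_congr rfl fun i _ => Finset.sum_congr rfl fun j _ => ?_
    rw [hij, smul_comm]
  have hBφ {y : M} (hy : y ∈ φ.source) (v : EuclideanSpace ℝ (Fin k)) :
      B (φ y) v = d% φ y (∑ j, v j • Y j y) := by
    rw [hBv, φ.left_inv hy]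
    simp [ha]
  have hinjY {y : M} (hy : y ∈ W) {u v : EuclideanSpace ℝ (Fin k)}
      (h : ∑ j, u j • Y j y = ∑ j, v j • Y j y) : u = v := by
    ext i
    exact congrFun ((hYD y hy).1.fintypeLinearCombination_injective (a₁ := u) (a₂ := v) h) i
  have hpΩ : φ p ∈ Ω := ⟨mem_extChartAt_target p, by
    rw [mem_preimage, hφ, extChartAt_to_inv]; exact hp⟩
  obtain ⟨N, f, hN, h0, hf0, hfinj, hfs, hf⟩ := exists_injOn_hasFDerivAt_eq_comp hΩo hpΩ hBs
    (fun u v huv => hinjY hp (mvfderiv_injective_extChartAt (mem_extChartAt_source p)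
      (((hBφ (mem_extChartAt_source p) u).symm.trans huv).trans
        (hBφ (mem_extChartAt_source p) v)))) hsym
  have hFs {z} (hz : z ∈ N) : CMDiffAt ∞ (fun z => φ.symm (f z)) z :=
    ContMDiffAt.comp z (hsymm (hf z hz).1.1)
      ((hfs z hz).contDiffAt (hN.mem_nhds hz)).contMDiffAt
  have hFd {z} (hz : z ∈ N) (v : EuclideanSpace ℝ (Fin k)) :
      mfderiv 𝓘(ℝ, EuclideanSpace ℝ (Fin k)) 𝓘(ℝ, E) (fun z => φ.symm (f z)) z v
        = ∑ j, v j • Y j (φ.symm (f z)) := by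
    apply mvfderiv_injective_extChartAt (hsrc (hf z hz).1.1)
    rw [← hBφ (hsrc (hf z hz).1.1), φ.right_inv (hf z hz).1.1]
    have h1 := mvfderiv_comp_map z
      ((contMDiffAt_extChartAt_of_mem (hsrc (hf z hz).1.1)).mdifferentiableAt (by simp))
      ((hFs hz).mdifferentiableAt (by simp)) v
    refine h1.symm.trans ?_
    have h2 : φ ∘ (fun z => φ.symm (f z)) =ᶠ[𝓝 z] f := by
      filter_upwards [hN.mem_nhds hz] with w hw
      exact φ.right_inv (hf w hw).1.1
    have h3 := mvfderiv_congr h2 v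
    refine h3.trans ?_
    rw [← (hf z hz).2.fderiv]
    exact DFunLike.congr_fun (F := EuclideanSpace ℝ (Fin k) →L[ℝ] E) mfderiv_eq_fderiv v
  refine ⟨N, fun z => φ.symm (f z), ⟨hN, fun z hz => hWU (hf z hz).1.2, ?_, ?_, ?_, ?_⟩,
    0, h0, ?_⟩
  · exact fun z hz w hw hzw => hfinj hz hw (φ.symm.injOn (hf z hz).1.1 (hf w hw).1.1 hzw)
  · exact fun z hz => (hFs hz).contMDiffWithinAt
  · intro z hz u v huv
    exact hinjY (hf z hz).1.2 (((hFd hz u).symm.trans huv).trans (hFd hz v))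
  · intro z hz
    rw [← (hYD _ (hf z hz).1.2).2]
    ext w
    rw [Submodule.mem_span_range_iff_exists_fun]
    constructor
    · rintro ⟨(v : EuclideanSpace ℝ (Fin k)), rfl⟩
      exact ⟨fun j => v j, (hFd hz v).symm⟩
    · rintro ⟨c, rfl⟩
      exact ⟨WithLp.toLp 2 c, hFd hz (WithLp.toLp 2 c)⟩
  · simp only [hf0]
    exact extChartAt_to_inv p

/-- The theorem of Frobenius: an involutive distribution is integrable. -/
theorem isIntegrableOn_of_mlieBracket_mem {U : Set M}
    {D : Π x : M, Submodule ℝ (TangentSpace 𝓘(ℝ, E) x)} (hD : IsSmoothDistributionOn U D)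
    (hinv : ∀ W ⊆ U, IsOpen W → ∀ X Y : Π x : M, TangentSpace 𝓘(ℝ, E) x, IsSectionOn D W X →
      IsSectionOn D W Y → ∀ x ∈ W, mlieBracket 𝓘(ℝ, E) X Y x ∈ D x) : IsIntegrableOn U D := by
  intro p hp
  obtain ⟨W, hWU, hW, hpW, k, Y, hY, hYD, hYY⟩ := exists_commuting_frame hD hinv hp
  exact ⟨k, exists_isIntegralManifoldIn_of_commuting hWU hW hpW hY hYD hYY⟩

end Integrable

/-! ### Vector fields over an open set as a module -/

section FieldsOn

set_option linter.unusedSectionVars false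

variable {E : Type*} [NormedAddCommGroup E] [NormedSpace ℝ E]
  {M : Type*} [TopologicalSpace M] [ChartedSpace E M] [IsManifold 𝓘(ℝ, E) ∞ M]

/-- The vector fields that are smooth on `W` and vanish off `W`. -/
def fieldsOn (W : Set M) : Submodule ℝ (Π x : M, TangentSpace 𝓘(ℝ, E) x) where
  carrier := {X | (∀ x ∈ W, CMDiffAt ∞ (T% X) x) ∧ ∀ x ∉ W, X x = 0}
  add_mem' := fun hX hY => ⟨fun x hx => (hX.1 x hx).add_section (hY.1 x hx),
    fun x hx => by rw [Pi.add_apply, hX.2 x hx, hY.2 x hx, add_zero]⟩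
  zero_mem' := ⟨fun x _ => (contMDiff_zeroSection ℝ (TangentSpace 𝓘(ℝ, E) : M → Type _)).contMDiffAt,
    fun _ _ => rfl⟩
  smul_mem' := fun c X hX => ⟨fun x hx => (hX.1 x hx).const_smul_section,
    fun x hx => by rw [Pi.smul_apply, hX.2 x hx, smul_zero]⟩

open Classical in
/-- The field that equals `X` on `W` and `0` off `W`. -/
noncomputable def cutoff (W : Set M) (X : Π x : M, TangentSpace 𝓘(ℝ, E) x) (x : M) :
    TangentSpace 𝓘(ℝ, E) x :=
  if x ∈ W then X x else 0

theorem cutoff_of_mem {W : Set M} (X : Π x : M, TangentSpace 𝓘(ℝ, E) x) {x : M} (hx : x ∈ W) :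
    cutoff W X x = X x := if_pos hx

theorem cutoff_of_notMem {W : Set M} (X : Π x : M, TangentSpace 𝓘(ℝ, E) x) {x : M} (hx : x ∉ W) :
    cutoff W X x = 0 := if_neg hx

theorem contMDiffAt_congr {X Y : Π x : M, TangentSpace 𝓘(ℝ, E) x} {x : M}
    (hX : CMDiffAt ∞ (T% X) x) (h : ∀ᶠ y in 𝓝 x, Y y = X y) : CMDiffAt ∞ (T% Y) x := by
  refine hX.congr_of_eventuallyEq ?_
  filter_upwards [h] with y hy
  rw [hy]

theorem cutoff_eventuallyEq {W : Set M} (hW : IsOpen W) (X : Π x : M, TangentSpace 𝓘(ℝ, E) x)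
    {x : M} (hx : x ∈ W) : ∀ᶠ y in 𝓝 x, cutoff W X y = X y := by
  filter_upwards [hW.mem_nhds hx] with y hy
  exact cutoff_of_mem X hy

theorem cutoff_mem_fieldsOn {W : Set M} (hW : IsOpen W) {X : Π x : M, TangentSpace 𝓘(ℝ, E) x}
    (hX : ∀ x ∈ W, CMDiffAt ∞ (T% X) x) : cutoff W X ∈ fieldsOn W :=
  ⟨fun x hx => contMDiffAt_congr (hX x hx) (cutoff_eventuallyEq hW X hx),
    fun _ hx => cutoff_of_notMem X hx⟩

/-- The purpose of demanding that fields vanish off `W`: pointwise identities on `W` become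
equalities in the module. -/
theorem fieldsOn_ext {W : Set M} {X Y : fieldsOn (E := E) W} (h : ∀ x ∈ W, X.1 x = Y.1 x) :
    X = Y := by
  ext x
  by_cases hx : x ∈ W
  · exact h x hx
  · rw [X.2.2 x hx, Y.2.2 x hx]

variable [FiniteDimensional ℝ E]
  [RiemannianBundle (fun x : M => TangentSpace 𝓘(ℝ, E) x)]
  [IsContMDiffRiemannianBundle 𝓘(ℝ, E) ∞ E (fun x : M => TangentSpace 𝓘(ℝ, E) x)]

theorem contMDiffAt_vert {U : Set M} {D : Π x : M, Submodule ℝ (TangentSpace 𝓘(ℝ, E) x)}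
    (hD : IsSmoothDistributionOn U D) {x : M} (hx : x ∈ U)
    {X : Π x : M, TangentSpace 𝓘(ℝ, E) x} (hX : CMDiffAt ∞ (T% X) x) :
    CMDiffAt ∞ (T% (vert D X)) x := by
  obtain ⟨W, -, hW, hxW, k, Y, hY, hYD⟩ := hD x hx
  have hYx (i) : CMDiffAt ∞ (T% (Y i)) x := (hY i).contMDiffAt (hW.mem_nhds hxW)
  refine contMDiffAt_of_inner hYx (hYD x hxW).1 ?_ fun i => ?_
  · filter_upwards [hW.mem_nhds hxW] with y hy
    rw [(hYD y hy).2]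
    exact Submodule.starProjection_apply_mem _ _
  · refine (contMDiffAt_inner (hYx i) hX).congr_of_eventuallyEq ?_
    filter_upwards [hW.mem_nhds hxW] with y hy
    have : Y i y ∈ D y := by
      rw [← (hYD y hy).2]
      exact Submodule.subset_span ⟨i, rfl⟩
    rw [vert, ← Submodule.inner_starProjection_left_eq_right,
      Submodule.starProjection_eq_self_iff.2 this]

theorem hor_apply (D : Π x : M, Submodule ℝ (TangentSpace 𝓘(ℝ, E) x))
    (X : Π x : M, TangentSpace 𝓘(ℝ, E) x) (x : M) : hor D X x = X x - vert D X x :=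
  Submodule.starProjection_orthogonal_val _

theorem contMDiffAt_hor {U : Set M} {D : Π x : M, Submodule ℝ (TangentSpace 𝓘(ℝ, E) x)}
    (hD : IsSmoothDistributionOn U D) {x : M} (hx : x ∈ U)
    {X : Π x : M, TangentSpace 𝓘(ℝ, E) x} (hX : CMDiffAt ∞ (T% X) x) :
    CMDiffAt ∞ (T% (hor D X)) x :=
  contMDiffAt_congr (hX.sub_section (contMDiffAt_vert hD hx hX))
    (Filter.Eventually.of_forall fun y => hor_apply D X y)

theorem leviCivita_congr {Y Y' : Π x : M, TangentSpace 𝓘(ℝ, E) x} {x : M}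
    (hY : CMDiffAt ∞ (T% Y) x) (h : ∀ᶠ y in 𝓝 x, Y' y = Y y) :
    leviCivita E M Y' x = leviCivita E M Y x :=
  (leviCivita E M).isCovariantDerivativeOnUniv.congr_of_eventuallyEq
    (mdiffAt_of_smooth (contMDiffAt_congr hY h)) (mdiffAt_of_smooth hY) Filter.univ_mem h

/-- The Levi-Civita connection on `fieldsOn W`. -/
noncomputable def covariant {W : Set M} (hW : IsOpen W) :
    fieldsOn (E := E) W →+ fieldsOn (E := E) W →+ fieldsOn (E := E) W :=
  AddMonoidHom.mk' (fun X => AddMonoidHom.mk' (fun Y =>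
      ⟨cutoff W fun x => leviCivita E M Y.1 x (X.1 x),
        cutoff_mem_fieldsOn hW fun x hx => contMDiffAt_leviCivita (X.2.1 x hx) (Y.2.1 x hx)⟩)
      fun Y Y' => fieldsOn_ext fun x hx => by
        have := (leviCivita E M).isCovariantDerivativeOnUniv.add
          (mdiffAt_of_smooth (Y.2.1 x hx)) (mdiffAt_of_smooth (Y'.2.1 x hx)) (mem_univ x)
        simp only [Submodule.coe_add, Pi.add_apply, cutoff_of_mem _ hx]
        exact DFunLike.congr_fun this (X.1 x))
    fun X X' => by
      ext1 Y
      refine fieldsOn_ext fun x hx => ?_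
      simp [cutoff_of_mem _ hx]

theorem covariant_apply {W : Set M} (hW : IsOpen W) (X Y : fieldsOn (E := E) W) {x : M}
    (hx : x ∈ W) : (covariant hW X Y).1 x = leviCivita E M Y.1 x (X.1 x) :=
  cutoff_of_mem (fun x => leviCivita E M Y.1 x (X.1 x)) hx

theorem covariant_sub_covariant {W : Set M} (hW : IsOpen W) (X Y : fieldsOn (E := E) W) {x : M}
    (hx : x ∈ W) : (covariant hW X Y - covariant hW Y X).1 x = mlieBracket 𝓘(ℝ, E) X.1 Y.1 x := by
  rw [← leviCivita_torsionFree (mdiffAt_of_smooth (X.2.1 x hx)) (mdiffAt_of_smooth (Y.2.1 x hx)),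
    ← covariant_apply hW X Y hx, ← covariant_apply hW Y X hx]
  rfl

/-- The inner product of two fields, as a function. -/
noncomputable def innerFields (W : Set M) :
    fieldsOn (E := E) W →+ fieldsOn (E := E) W →+ (M → ℝ) :=
  AddMonoidHom.mk' (fun X => AddMonoidHom.mk' (fun Y x => inner ℝ (X.1 x) (Y.1 x))
      fun Y Y' => by ext x; simp [inner_add_right])
    fun X X' => by ext Y x; simp [inner_add_left]

theorem innerFields_apply {W : Set M} (X Y : fieldsOn (E := E) W) (x : M) :
    innerFields W X Y x = inner ℝ (X.1 x) (Y.1 x) := rfl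

theorem mvfderiv_innerFields {W : Set M} (hW : IsOpen W) (X Y Z : fieldsOn (E := E) W) {x : M}
    (hx : x ∈ W) : d% (innerFields W Y Z) x (X.1 x)
      = innerFields W (covariant hW X Y) Z x + innerFields W Y (covariant hW X Z) x := by
  rw [innerFields_apply, innerFields_apply, covariant_apply hW X Y hx, covariant_apply hW X Z hx]
  exact leviCivita_metric (mdiffAt_of_smooth (X.2.1 x hx)) (mdiffAt_of_smooth (Y.2.1 x hx))
    (mdiffAt_of_smooth (Z.2.1 x hx))

theorem contMDiffAt_innerFields {W : Set M} (X Y : fieldsOn (E := E) W) {x : M} (hx : x ∈ W) :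
    CMDiffAt ∞ (innerFields W X Y) x :=
  contMDiffAt_inner (X.2.1 x hx) (Y.2.1 x hx)

theorem innerFields_of_notMem {W : Set M} (X Y : fieldsOn (E := E) W) {x : M} (hx : x ∉ W) :
    innerFields W X Y x = 0 := by
  rw [innerFields_apply, X.2.2 x hx, inner_zero_left]

theorem innerFields_metric {W : Set M} (hW : IsOpen W) (X : fieldsOn (E := E) W)
    {A B A' B' : fieldsOn (E := E) W} (h : innerFields W A B = innerFields W A' B') :
    innerFields W (covariant hW X A) B + innerFields W A (covariant hW X B)
      = innerFields W (covariant hW X A') B' + innerFields W A' (covariant hW X B') := by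
  ext x
  simp only [Pi.add_apply]
  by_cases hx : x ∈ W
  · rw [← mvfderiv_innerFields hW X A B hx, h, mvfderiv_innerFields hW X A' B' hx]
  · simp only [innerFields_of_notMem _ _ hx]

/-- Torsion-freeness converts the regrouped sum into iterated brackets, so the first Bianchi
identity is the Jacobi identity for vector fields. -/
theorem covariant_jacobi {W : Set M} (hW : IsOpen W) (X Y Z : fieldsOn (E := E) W) :
    (covariant hW X (covariant hW Y Z) - covariant hW Y (covariant hW X Z)
        - covariant hW (covariant hW X Y - covariant hW Y X) Z)
      + (covariant hW Y (covariant hW Z X) - covariant hW Z (covariant hW Y X)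
        - covariant hW (covariant hW Y Z - covariant hW Z Y) X)
      + (covariant hW Z (covariant hW X Y) - covariant hW X (covariant hW Z Y)
        - covariant hW (covariant hW Z X - covariant hW X Z) Y) = 0 := by
  have : CompleteSpace E := FiniteDimensional.complete ℝ E
  have := isManifold_minSmoothness (E := E) (M := M) 3
  have key (X Y Z : fieldsOn (E := E) W) {x : M} (hx : x ∈ W) :
      (covariant hW X (covariant hW Y Z - covariant hW Z Y)
        - covariant hW (covariant hW Y Z - covariant hW Z Y) X).1 x
        = mlieBracket 𝓘(ℝ, E) X.1 (mlieBracket 𝓘(ℝ, E) Y.1 Z.1) x := by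
    rw [covariant_sub_covariant hW _ _ hx]
    refine Filter.EventuallyEq.mlieBracket_vectorField_eq (Filter.EventuallyEq.refl _ _) ?_
    filter_upwards [hW.mem_nhds hx] with y hy
    exact covariant_sub_covariant hW Y Z hy
  have hsum : (covariant hW X (covariant hW Y Z - covariant hW Z Y)
        - covariant hW (covariant hW Y Z - covariant hW Z Y) X)
      + (covariant hW Y (covariant hW Z X - covariant hW X Z)
        - covariant hW (covariant hW Z X - covariant hW X Z) Y)
      + (covariant hW Z (covariant hW X Y - covariant hW Y X)
        - covariant hW (covariant hW X Y - covariant hW Y X) Z) = 0 := by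
    refine fieldsOn_ext fun x hx => ?_
    have h1 := key X Y Z hx
    have h2 := key Y Z X hx
    have h3 := key Z X Y hx
    have hb {A B : fieldsOn (E := E) W} := contMDiffAt_mlieBracket (A.2.1 x hx) (B.2.1 x hx)
    have hj := leibniz_identity_mlieBracket_apply (contMDiffAt_minSmoothness 2 (X.2.1 x hx))
      (contMDiffAt_minSmoothness 2 (Y.2.1 x hx)) (contMDiffAt_minSmoothness 2 (Z.2.1 x hx))
    rw [Submodule.coe_add, Submodule.coe_add, Pi.add_apply, Pi.add_apply, h1, h2, h3, hj,
      mlieBracket_swap_apply (V := Z.1) (W := mlieBracket 𝓘(ℝ, E) X.1 Y.1)]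
    have hzx : mlieBracket 𝓘(ℝ, E) Y.1 (mlieBracket 𝓘(ℝ, E) Z.1 X.1) x
        = - mlieBracket 𝓘(ℝ, E) Y.1 (mlieBracket 𝓘(ℝ, E) X.1 Z.1) x := by
      rw [mlieBracket_swap (V := Z.1), ← neg_one_smul ℝ,
        mlieBracket_const_smul_right (mdiffAt_of_smooth (contMDiffAt_mlieBracket (X.2.1 x hx)
          (Z.2.1 x hx))), neg_one_smul]
    rw [hzx]
    simp
  rw [← hsum]
  simp only [map_sub, AddMonoidHom.sub_apply]
  abel

/-- The function `⟨Z, A⟩` is differentiated by `[X, Y] = XY - YX`. The products of two first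
derivatives are symmetric in `X` and `Y` and cancel. -/
theorem innerFields_curvature {W : Set M} (hW : IsOpen W) (X Y Z A : fieldsOn (E := E) W) :
    innerFields W (covariant hW X (covariant hW Y Z) - covariant hW Y (covariant hW X Z)
        - covariant hW (covariant hW X Y - covariant hW Y X) Z) A
      = - innerFields W Z (covariant hW X (covariant hW Y A) - covariant hW Y (covariant hW X A)
        - covariant hW (covariant hW X Y - covariant hW Y X) A) := by
  ext x
  by_cases hx : x ∈ W
  · have h := mvfderiv_mlieBracket (X.2.1 x hx) (Y.2.1 x hx) (contMDiffAt_innerFields Z A hx)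
    have h2 (X Y : fieldsOn (E := E) W) :
        d% (fun y => d% (innerFields W Z A) y (Y.1 y)) x (X.1 x)
          = innerFields W (covariant hW X (covariant hW Y Z)) A x
            + innerFields W (covariant hW Y Z) (covariant hW X A) x
            + (innerFields W (covariant hW X Z) (covariant hW Y A) x
            + innerFields W Z (covariant hW X (covariant hW Y A)) x) := by
      have : (fun y => d% (innerFields W Z A) y (Y.1 y)) =ᶠ[𝓝 x]
          fun y => innerFields W (covariant hW Y Z) A y + innerFields W Z (covariant hW Y A) y := by
        filter_upwards [hW.mem_nhds hx] with y hy
        exact mvfderiv_innerFields hW Y Z A hy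
      rw [mvfderiv_congr this, mvfderiv_fun_add
        ((contMDiffAt_innerFields _ _ hx).mdifferentiableAt (by simp))
        ((contMDiffAt_innerFields _ _ hx).mdifferentiableAt (by simp)), add_apply,
        mvfderiv_innerFields hW _ _ _ hx, mvfderiv_innerFields hW _ _ _ hx]
    rw [h2, h2, ← covariant_sub_covariant hW X Y hx, mvfderiv_innerFields hW _ _ _ hx] at h
    simp only [map_sub, AddMonoidHom.sub_apply, Pi.sub_apply, Pi.neg_apply] at h ⊢
    linear_combination -h
  · rw [Pi.neg_apply, innerFields_of_notMem _ _ hx, innerFields_of_notMem _ _ hx, neg_zero]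

end FieldsOn

/-! ### The manifold as an instance of the algebraic structure -/

section Instance

set_option linter.unusedSectionVars false

variable {E : Type*} [NormedAddCommGroup E] [NormedSpace ℝ E]
  {M : Type*} [TopologicalSpace M] [ChartedSpace E M] [IsManifold 𝓘(ℝ, E) ∞ M]
  [FiniteDimensional ℝ E]
  [RiemannianBundle (fun x : M => TangentSpace 𝓘(ℝ, E) x)]
  [IsContMDiffRiemannianBundle 𝓘(ℝ, E) ∞ E (fun x : M => TangentSpace 𝓘(ℝ, E) x)]
  {J : Π x : M, TangentSpace 𝓘(ℝ, E) x →L[ℝ] TangentSpace 𝓘(ℝ, E) x}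
  {V : Π x : M, Submodule ℝ (TangentSpace 𝓘(ℝ, E) x)}

theorem IsKahler.inner_left (hJ : IsKahler J) (x : M) (v w : TangentSpace 𝓘(ℝ, E) x) :
    inner ℝ (J x v) w = - inner ℝ v (J x w) := by
  rw [← hJ.isometry x v (J x w), hJ.sq, inner_neg_right, neg_neg]

theorem IsKahler.contMDiffAt (hJ : IsKahler J) {X : Π x : M, TangentSpace 𝓘(ℝ, E) x} {x : M}
    (hX : CMDiffAt ∞ (T% X) x) : CMDiffAt ∞ (T% (fun y => J y (X y))) x :=
  ContMDiffAt.clm_bundle_apply (E₁ := fun x : M => TangentSpace 𝓘(ℝ, E) x)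
    (E₂ := fun x : M => TangentSpace 𝓘(ℝ, E) x) (hJ.smooth.contMDiffAt (x := x)) hX

theorem IsKahler.mem_orthogonal (hJ : IsKahler J) {x : M}
    {K : Submodule ℝ (TangentSpace 𝓘(ℝ, E) x)} (hK : ∀ v ∈ K, J x v ∈ K)
    {v : TangentSpace 𝓘(ℝ, E) x} (hv : v ∈ Kᗮ) : J x v ∈ Kᗮ := by
  rw [Submodule.mem_orthogonal'] at hv ⊢
  intro u hu
  rw [hJ.inner_left, hv _ (hK u hu), neg_zero]

theorem IsKahler.starProjection (hJ : IsKahler J) {x : M}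
    {K : Submodule ℝ (TangentSpace 𝓘(ℝ, E) x)} (hK : ∀ v ∈ K, J x v ∈ K)
    (v : TangentSpace 𝓘(ℝ, E) x) : K.starProjection (J x v) = J x (K.starProjection v) := by
  refine Submodule.eq_starProjection_of_mem_orthogonal
    (hK _ (Submodule.starProjection_apply_mem _ _)) ?_
  rw [← map_sub]
  exact hJ.mem_orthogonal hK (Submodule.sub_starProjection_mem_orthogonal _)

theorem vert_eq_self_iff {X : Π x : M, TangentSpace 𝓘(ℝ, E) x} {x : M} :
    vert V X x = X x ↔ X x ∈ V x := Submodule.starProjection_eq_self_iff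

theorem vert_eq_zero_iff {X : Π x : M, TangentSpace 𝓘(ℝ, E) x} {x : M} :
    vert V X x = 0 ↔ X x ∈ (V x)ᗮ := Submodule.starProjection_apply_eq_zero_iff _

/-- The vertical projection on `fieldsOn W`. -/
noncomputable def vertFields (hV : IsComplexRiemannianFoliationOn J univ V) (W : Set M) :
    fieldsOn (E := E) W →+ fieldsOn (E := E) W :=
  AddMonoidHom.mk' (fun X => ⟨vert V X.1,
      fun x hx => contMDiffAt_vert hV.foliation.smooth (mem_univ x) (X.2.1 x hx),
      fun x hx => by rw [vert, X.2.2 x hx, map_zero]⟩)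
    fun X X' => fieldsOn_ext fun x _ => map_add (V x).starProjection (X.1 x) (X'.1 x)

theorem vertFields_eq_self_iff (hV : IsComplexRiemannianFoliationOn J univ V) {W : Set M}
    {X : fieldsOn (E := E) W} : vertFields hV W X = X ↔ ∀ x ∈ W, X.1 x ∈ V x :=
  ⟨fun h x _ => vert_eq_self_iff.1 (congrFun (congrArg Subtype.val h) x),
    fun h => fieldsOn_ext fun x hx => vert_eq_self_iff.2 (h x hx)⟩

theorem vertFields_eq_zero_iff (hV : IsComplexRiemannianFoliationOn J univ V) {W : Set M}
    {X : fieldsOn (E := E) W} : vertFields hV W X = 0 ↔ ∀ x ∈ W, X.1 x ∈ (V x)ᗮ :=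
  ⟨fun h x _ => vert_eq_zero_iff.1 (congrFun (congrArg Subtype.val h) x),
    fun h => fieldsOn_ext fun x hx => vert_eq_zero_iff.2 (h x hx)⟩

theorem vertFields_apply (hV : IsComplexRiemannianFoliationOn J univ V) {W : Set M}
    (X : fieldsOn (E := E) W) (x : M) :
    (vertFields hV W X).1 x = (V x).starProjection (X.1 x) := rfl

theorem isSectionOn_of_fieldsOn {D : Π x : M, Submodule ℝ (TangentSpace 𝓘(ℝ, E) x)} {W : Set M}
    {X : fieldsOn (E := E) W} (h : ∀ x ∈ W, X.1 x ∈ D x) : IsSectionOn D W X.1 :=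
  ⟨fun x hx => (X.2.1 x hx).contMDiffWithinAt, h⟩

/-- The fields on an open subset of a Kähler manifold with a complex Riemannian foliation. -/
noncomputable def foliatedKahlerModule (hJ : IsKahler J)
    (hV : IsComplexRiemannianFoliationOn J univ V) {W : Set M} (hW : IsOpen W) :
    FoliatedKahlerModule (fieldsOn (E := E) W) (M → ℝ) where
  g := innerFields W
  D := covariant hW
  J := AddMonoidHom.mk' (fun X => ⟨fun x => J x (X.1 x), fun x hx => hJ.contMDiffAt (X.2.1 x hx),
      fun x hx => (congrArg (J x) (X.2.2 x hx)).trans (map_zero _)⟩)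
    fun X X' => fieldsOn_ext fun x _ => map_add (J x) (X.1 x) (X'.1 x)
  v := vertFields hV W
  symm X Y := funext fun x => real_inner_comm (Y.1 x) (X.1 x)
  definite X h := fieldsOn_ext fun x _ => inner_self_eq_zero.1 (congrFun h x)
  metric X _ _ _ _ h := innerFields_metric hW X h
  jacobi := covariant_jacobi hW
  curvature_skew := innerFields_curvature hW
  J_sq X := fieldsOn_ext fun x _ => hJ.sq x _
  J_isometry X Y := funext fun x => hJ.isometry x _ _
  J_parallel X Y := fieldsOn_ext fun x hx => by
    rw [covariant_apply hW _ _ hx]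
    refine (hJ.parallel Y.1 x (mdiffAt_of_smooth (Y.2.1 x hx)) (X.1 x)).trans ?_
    rw [← covariant_apply hW _ _ hx]
    rfl
  v_idem X := (vertFields_eq_self_iff hV).2 fun x _ => Submodule.starProjection_apply_mem _ _
  v_symm X Y := funext fun x =>
    Submodule.inner_starProjection_left_eq_right (V x) (X.1 x) (Y.1 x)
  v_J X := fieldsOn_ext fun x _ => hJ.starProjection (hV.complex x (mem_univ x)) _
  involutive {U A} hU hA := by
    rw [vertFields_eq_self_iff] at hU hA ⊢
    intro x hx
    rw [covariant_sub_covariant hW U A hx]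
    refine hV.foliation.integrable.mlieBracket_mem (mem_univ x) (U.2.1 x hx) (A.2.1 x hx) ?_ ?_
    · filter_upwards [hW.mem_nhds hx] with y hy using hU y hy
    · filter_upwards [hW.mem_nhds hx] with y hy using hA y hy
  riemannian {U X Y} hU hX hY := by
    rw [vertFields_eq_self_iff] at hU
    rw [vertFields_eq_zero_iff] at hX hY
    ext x
    by_cases hx : x ∈ W
    · have h := hV.riemannian W (subset_univ _) hW U.1 X.1 Y.1 (isSectionOn_of_fieldsOn hU)
        (isSectionOn_of_fieldsOn hX) (isSectionOn_of_fieldsOn hY) x hx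
      have h2 := mvfderiv_innerFields hW U X Y hx
      rw [← covariant_sub_covariant hW U X hx, ← covariant_sub_covariant hW U Y hx] at h
      have h3 := h2.symm.trans h
      simp only [innerFields_apply, Submodule.coe_sub, Pi.sub_apply, inner_sub_left,
        inner_sub_right] at h3
      simp only [Pi.add_apply, Pi.zero_apply, innerFields_apply]
      linear_combination h3
    · simp [Pi.add_apply, innerFields_of_notMem _ _ hx]

end Instance

/-! ### Transfer of the algebraic results to local sections -/

section Sections

set_option linter.unusedSectionVars false

variable {E : Type*} [NormedAddCommGroup E] [NormedSpace ℝ E]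
  {M : Type*} [TopologicalSpace M] [ChartedSpace E M] [IsManifold 𝓘(ℝ, E) ∞ M]

theorem IsSectionOn.contMDiffAt {D : Π x : M, Submodule ℝ (TangentSpace 𝓘(ℝ, E) x)} {W : Set M}
    {X : Π x : M, TangentSpace 𝓘(ℝ, E) x} (hX : IsSectionOn D W X) (hW : IsOpen W) {x : M}
    (hx : x ∈ W) : CMDiffAt ∞ (T% X) x :=
  (hX.1 x hx).contMDiffAt (hW.mem_nhds hx)

theorem IsSectionOn.mono {D : Π x : M, Submodule ℝ (TangentSpace 𝓘(ℝ, E) x)} {W W' : Set M}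
    {X : Π x : M, TangentSpace 𝓘(ℝ, E) x} (hX : IsSectionOn D W X) (h : W' ⊆ W) :
    IsSectionOn D W' X :=
  ⟨hX.1.mono h, fun x hx => hX.2 x (h hx)⟩

/-- A field that is smooth on `W`, cut off outside of `W`. -/
noncomputable def toFields {W : Set M} (hW : IsOpen W) (X : Π x : M, TangentSpace 𝓘(ℝ, E) x)
    (hX : ∀ x ∈ W, CMDiffAt ∞ (T% X) x) : fieldsOn (E := E) W :=
  ⟨cutoff W X, cutoff_mem_fieldsOn hW hX⟩

theorem toFields_apply {W : Set M} (hW : IsOpen W) {X : Π x : M, TangentSpace 𝓘(ℝ, E) x}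
    (hX : ∀ x ∈ W, CMDiffAt ∞ (T% X) x) {x : M} (hx : x ∈ W) : (toFields hW X hX).1 x = X x :=
  cutoff_of_mem X hx

variable [FiniteDimensional ℝ E]
  [RiemannianBundle (fun x : M => TangentSpace 𝓘(ℝ, E) x)]
  [IsContMDiffRiemannianBundle 𝓘(ℝ, E) ∞ E (fun x : M => TangentSpace 𝓘(ℝ, E) x)]
  {J : Π x : M, TangentSpace 𝓘(ℝ, E) x →L[ℝ] TangentSpace 𝓘(ℝ, E) x}
  {V : Π x : M, Submodule ℝ (TangentSpace 𝓘(ℝ, E) x)}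

/-- The component of `∇_X Y` tangent to `V`. -/
noncomputable def vertDeriv (V : Π x : M, Submodule ℝ (TangentSpace 𝓘(ℝ, E) x))
    (X Y : Π x : M, TangentSpace 𝓘(ℝ, E) x) : Π x : M, TangentSpace 𝓘(ℝ, E) x :=
  vert V fun x => leviCivita E M Y x (X x)

theorem contMDiffAt_vertDeriv (hV : IsSmoothDistributionOn univ V)
    {X Y : Π x : M, TangentSpace 𝓘(ℝ, E) x} {x : M} (hX : CMDiffAt ∞ (T% X) x)
    (hY : CMDiffAt ∞ (T% Y) x) : CMDiffAt ∞ (T% (vertDeriv V X Y)) x :=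
  contMDiffAt_vert hV (mem_univ x) (contMDiffAt_leviCivita hX hY)

theorem isSectionOn_vert {U W : Set M} (hV : IsSmoothDistributionOn U V) (hWU : W ⊆ U)
    {X : Π x : M, TangentSpace 𝓘(ℝ, E) x} (hX : ∀ x ∈ W, CMDiffAt ∞ (T% X) x) :
    IsSectionOn V W (vert V X) :=
  ⟨fun x hx => (contMDiffAt_vert hV (hWU hx) (hX x hx)).contMDiffWithinAt,
    fun _ _ => Submodule.starProjection_apply_mem _ _⟩

theorem isSectionOn_hor {U W : Set M} (hV : IsSmoothDistributionOn U V) (hWU : W ⊆ U)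
    {X : Π x : M, TangentSpace 𝓘(ℝ, E) x} (hX : ∀ x ∈ W, CMDiffAt ∞ (T% X) x) :
    IsSectionOn (fun x => (V x)ᗮ) W (hor V X) :=
  ⟨fun x hx => (contMDiffAt_hor hV (hWU hx) (hX x hx)).contMDiffWithinAt,
    fun _ _ => Submodule.starProjection_apply_mem _ _⟩

theorem covariant_toFields {W : Set M} (hW : IsOpen W) {X Y : Π x : M, TangentSpace 𝓘(ℝ, E) x}
    (hX : ∀ x ∈ W, CMDiffAt ∞ (T% X) x) (hY : ∀ x ∈ W, CMDiffAt ∞ (T% Y) x) :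
    covariant hW (toFields hW X hX) (toFields hW Y hY)
      = toFields hW (fun x => leviCivita E M Y x (X x))
        fun x hx => contMDiffAt_leviCivita (hX x hx) (hY x hx) :=
  fieldsOn_ext fun x hx => by
    rw [covariant_apply hW _ _ hx, toFields_apply hW _ hx, toFields_apply hW _ hx,
      ← leviCivita_congr (hY x hx) (cutoff_eventuallyEq hW Y hx)]
    rfl

theorem vertFields_toFields (hV : IsComplexRiemannianFoliationOn J univ V) {W : Set M}
    (hW : IsOpen W) {X : Π x : M, TangentSpace 𝓘(ℝ, E) x}
    (hX : ∀ x ∈ W, CMDiffAt ∞ (T% X) x) :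
    vertFields hV W (toFields hW X hX) = toFields hW (vert V X)
      fun x hx => contMDiffAt_vert hV.foliation.smooth (mem_univ x) (hX x hx) :=
  fieldsOn_ext fun x hx => by
    rw [vertFields_apply, toFields_apply hW _ hx, toFields_apply hW _ hx]
    rfl

theorem vertFields_covariant_toFields (hV : IsComplexRiemannianFoliationOn J univ V) {W : Set M}
    (hW : IsOpen W) {X Y : Π x : M, TangentSpace 𝓘(ℝ, E) x}
    (hX : ∀ x ∈ W, CMDiffAt ∞ (T% X) x) (hY : ∀ x ∈ W, CMDiffAt ∞ (T% Y) x) :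
    vertFields hV W (covariant hW (toFields hW X hX) (toFields hW Y hY))
      = toFields hW (vertDeriv V X Y) fun x hx =>
        contMDiffAt_vertDeriv hV.foliation.smooth (hX x hx) (hY x hx) := by
  rw [covariant_toFields, vertFields_toFields]
  rfl

theorem innerFields_toFields {W : Set M} (hW : IsOpen W) {X Y : Π x : M, TangentSpace 𝓘(ℝ, E) x}
    (hX : ∀ x ∈ W, CMDiffAt ∞ (T% X) x) (hY : ∀ x ∈ W, CMDiffAt ∞ (T% Y) x) {x : M} (hx : x ∈ W) :
    innerFields W (toFields hW X hX) (toFields hW Y hY) x = inner ℝ (X x) (Y x) := by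
  rw [innerFields_apply, toFields_apply hW _ hx, toFields_apply hW _ hx]

theorem vertFields_toFields_eq_self (hV : IsComplexRiemannianFoliationOn J univ V) {W : Set M}
    (hW : IsOpen W) {X : Π x : M, TangentSpace 𝓘(ℝ, E) x} (hX : IsSectionOn V W X) :
    vertFields hV W (toFields hW X fun _ => hX.contMDiffAt hW)
      = toFields hW X fun _ => hX.contMDiffAt hW := by
  rw [vertFields_eq_self_iff]
  intro x hx
  rw [toFields_apply hW _ hx]
  exact hX.2 x hx

theorem vertFields_toFields_eq_zero (hV : IsComplexRiemannianFoliationOn J univ V) {W : Set M}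
    (hW : IsOpen W) {X : Π x : M, TangentSpace 𝓘(ℝ, E) x}
    (hX : IsSectionOn (fun x => (V x)ᗮ) W X) :
    vertFields hV W (toFields hW X fun _ => hX.contMDiffAt hW) = 0 := by
  rw [vertFields_eq_zero_iff]
  intro x hx
  rw [toFields_apply hW _ hx]
  exact hX.2 x hx

theorem oneillA_of_isSectionOn {W : Set M} (hW : IsOpen W) {X Y : Π x : M, TangentSpace 𝓘(ℝ, E) x}
    (hX : IsSectionOn (fun x => (V x)ᗮ) W X) (hY : IsSectionOn (fun x => (V x)ᗮ) W Y) {x : M}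
    (hx : x ∈ W) : oneillA V X Y x = vertDeriv V X Y x := by
  have h1 : ∀ᶠ y in 𝓝 x, hor V Y y = Y y := by
    filter_upwards [hW.mem_nhds hx] with y hy
    exact Submodule.starProjection_eq_self_iff.2 (hY.2 y hy)
  have h2 : ∀ᶠ y in 𝓝 x, vert V Y y = (0 : Π x : M, TangentSpace 𝓘(ℝ, E) x) y := by
    filter_upwards [hW.mem_nhds hx] with y hy
    exact vert_eq_zero_iff.2 (hY.2 y hy)
  have h3 : hor V X x = X x := Submodule.starProjection_eq_self_iff.2 (hX.2 x hx)
  have h4 : leviCivita E M (vert V Y) x = 0 := by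
    rw [leviCivita_congr (Y := 0) ((contMDiff_zeroSection ℝ
      (TangentSpace 𝓘(ℝ, E) : M → Type _)).contMDiffAt) h2, (leviCivita E M).zero]
    rfl
  rw [oneillA, leviCivita_congr (hY.contMDiffAt hW hx) h1, h3, h4]
  simp [vertDeriv, vert]

theorem vertDeriv_mem_aHH {W : Set M} (hW : IsOpen W) {X Y : Π x : M, TangentSpace 𝓘(ℝ, E) x}
    (hX : IsSectionOn (fun x => (V x)ᗮ) W X) (hY : IsSectionOn (fun x => (V x)ᗮ) W Y) {x : M}
    (hx : x ∈ W) : vertDeriv V X Y x ∈ aHH V x :=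
  Submodule.subset_span ⟨W, X, Y, hW, hx, hX, hY, (oneillA_of_isSectionOn hW hX hY hx).symm⟩

theorem aHH_eq_span (x : M) : aHH V x = Submodule.span ℝ {v | ∃ (W : Set M)
    (X Y : Π x : M, TangentSpace 𝓘(ℝ, E) x), IsOpen W ∧ x ∈ W ∧
    IsSectionOn (fun y => (V y)ᗮ) W X ∧ IsSectionOn (fun y => (V y)ᗮ) W Y ∧
    v = vertDeriv V X Y x} := by
  refine le_antisymm (Submodule.span_le.2 ?_) (Submodule.span_le.2 ?_)
  · rintro v ⟨W, X, Y, hW, hx, hX, hY, rfl⟩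
    exact Submodule.subset_span ⟨W, X, Y, hW, hx, hX, hY, oneillA_of_isSectionOn hW hX hY hx⟩
  · rintro v ⟨W, X, Y, hW, hx, hX, hY, rfl⟩
    exact vertDeriv_mem_aHH hW hX hY hx

theorem aHH_le (x : M) : aHH V x ≤ V x := by
  rw [aHH_eq_span, Submodule.span_le]
  rintro v ⟨W, X, Y, hW, hx, hX, hY, rfl⟩
  exact Submodule.starProjection_apply_mem _ _

theorem mem_aHH_orthogonal {x : M} {u : TangentSpace 𝓘(ℝ, E) x}
    (h : ∀ (W : Set M) (X Y : Π x : M, TangentSpace 𝓘(ℝ, E) x), IsOpen W → x ∈ W →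
      IsSectionOn (fun y => (V y)ᗮ) W X → IsSectionOn (fun y => (V y)ᗮ) W Y →
      inner ℝ (vertDeriv V X Y x) u = 0) : u ∈ (aHH V x)ᗮ := by
  rw [Submodule.mem_orthogonal]
  intro v hv
  rw [aHH_eq_span] at hv
  induction hv using Submodule.span_induction with
  | mem v hv =>
    obtain ⟨W, X, Y, hW, hx, hX, hY, rfl⟩ := hv
    exact h W X Y hW hx hX hY
  | zero => exact inner_zero_left _
  | add v w _ _ hv hw => rw [inner_add_left, hv, hw, add_zero]
  | smul c v _ hv => rw [real_inner_smul_left, hv, mul_zero]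

/-- The bridge from `vZero`, defined pointwise, to the algebraic notion of a flat field. -/
theorem isFlat_toFields (hJ : IsKahler J) (hV : IsComplexRiemannianFoliationOn J univ V)
    {W : Set M} (hW : IsOpen W) {N : Π x : M, TangentSpace 𝓘(ℝ, E) x}
    (hN : IsSectionOn (vZero V) W N) :
    (foliatedKahlerModule hJ hV hW).IsFlat (toFields hW N fun _ => hN.contMDiffAt hW) where
  vertical := vertFields_toFields_eq_self hV hW ⟨hN.1, fun x hx => (hN.2 x hx).1⟩
  orthogonal {X Y} hX hY := by
    have hX' := (vertFields_eq_zero_iff hV).1 hX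
    have hY' := (vertFields_eq_zero_iff hV).1 hY
    ext x
    by_cases hx : x ∈ W
    · refine (congrArg₂ (inner ℝ) ?_ (toFields_apply hW _ hx)).trans
        ((hN.2 x hx).2 (vertDeriv V X.1 Y.1 x) (vertDeriv_mem_aHH hW (isSectionOn_of_fieldsOn hX')
          (isSectionOn_of_fieldsOn hY') hx))
      exact (congrArg (V x).starProjection (covariant_apply hW X Y hx))
    · exact innerFields_of_notMem _ _ hx

/-- `T` takes values in `V₀`. -/
theorem vertDeriv_mem_vZero (hJ : IsKahler J) (hV : IsComplexRiemannianFoliationOn J univ V)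
    {W : Set M} (hW : IsOpen W) {U Z : Π x : M, TangentSpace 𝓘(ℝ, E) x}
    (hU : IsSectionOn V W U) (hZ : IsSectionOn (fun x => (V x)ᗮ) W Z) {x : M} (hx : x ∈ W) :
    vertDeriv V U Z x ∈ vZero V x := by
  refine ⟨Submodule.starProjection_apply_mem _ _, mem_aHH_orthogonal ?_⟩
  intro W' X Y hW' hx' hX hY
  -- The fields producing an element of `A_H H` have their own domain; restriction to the
  -- intersection places everything in one module.
  have ho := hW.inter hW'
  have hxo : x ∈ W ∩ W' := ⟨hx, hx'⟩
  replace hU := hU.mono (inter_subset_left (t := W'))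
  replace hZ := hZ.mono (inter_subset_left (t := W'))
  replace hX := hX.mono (inter_subset_right (s := W))
  replace hY := hY.mono (inter_subset_right (s := W))
  have h := ((foliatedKahlerModule hJ hV ho).isFlat_t (vertFields_toFields_eq_self hV ho hU)
    (vertFields_toFields_eq_zero hV ho hZ)).orthogonal (vertFields_toFields_eq_zero hV ho hX)
    (vertFields_toFields_eq_zero hV ho hY)
  have h2 := congrFun h x
  simp only [foliatedKahlerModule, vertFields_covariant_toFields] at h2
  rwa [innerFields_toFields ho _ _ hxo] at h2

/-- `B` is a horizontal section, or a section `A_X Y` of `A_H H`. -/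
def IsConullOn (V : Π x : M, Submodule ℝ (TangentSpace 𝓘(ℝ, E) x)) (W : Set M)
    (B : Π x : M, TangentSpace 𝓘(ℝ, E) x) : Prop :=
  IsSectionOn (fun x => (V x)ᗮ) W B ∨ ∃ X Y, IsSectionOn (fun x => (V x)ᗮ) W X ∧
    IsSectionOn (fun x => (V x)ᗮ) W Y ∧ B = vertDeriv V X Y

theorem IsConullOn.mono {W W' : Set M} {B : Π x : M, TangentSpace 𝓘(ℝ, E) x}
    (hB : IsConullOn V W B) (h : W' ⊆ W) : IsConullOn V W' B :=
  hB.imp (fun hB => hB.mono h) fun ⟨X, Y, hX, hY, hB⟩ => ⟨X, Y, hX.mono h, hY.mono h, hB⟩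

theorem IsConullOn.contMDiffAt (hV : IsSmoothDistributionOn univ V) {W : Set M} (hW : IsOpen W)
    {B : Π x : M, TangentSpace 𝓘(ℝ, E) x} (hB : IsConullOn V W B) {x : M} (hx : x ∈ W) :
    CMDiffAt ∞ (T% B) x := by
  rcases hB with hB | ⟨X, Y, hX, hY, rfl⟩
  · exact hB.contMDiffAt hW hx
  · exact contMDiffAt_vertDeriv hV (hX.contMDiffAt hW hx) (hY.contMDiffAt hW hx)

theorem IsConullOn.inner_eq_zero {W : Set M} (hW : IsOpen W)
    {B N : Π x : M, TangentSpace 𝓘(ℝ, E) x} (hB : IsConullOn V W B)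
    (hN : IsSectionOn (vZero V) W N) {x : M} (hx : x ∈ W) : inner ℝ (B x) (N x) = 0 := by
  rcases hB with hB | ⟨X, Y, hX, hY, rfl⟩
  · rw [real_inner_comm]
    exact hB.2 x hx _ (hN.2 x hx).1
  · exact (hN.2 x hx).2 _ (vertDeriv_mem_aHH hW hX hY hx)

/-- The four combinations of a horizontal field and a field `A_X Y` are the definition of flatness
and the three `inner_D` lemmas of the algebraic part. -/
theorem inner_leviCivita_conull (hJ : IsKahler J) (hV : IsComplexRiemannianFoliationOn J univ V)
    {W : Set M} (hW : IsOpen W) {A B N : Π x : M, TangentSpace 𝓘(ℝ, E) x} (hA : IsConullOn V W A)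
    (hB : IsConullOn V W B) (hN : IsSectionOn (vZero V) W N) {x : M} (hx : x ∈ W) :
    inner ℝ (leviCivita E M B x (A x)) (N x) = 0 := by
  have hN' := isFlat_toFields hJ hV hW hN
  have hc {A B : Π x : M, TangentSpace 𝓘(ℝ, E) x} (hA : ∀ x ∈ W, CMDiffAt ∞ (T% A) x)
      (hB : ∀ x ∈ W, CMDiffAt ∞ (T% B) x)
      (h : (foliatedKahlerModule hJ hV hW).g ((foliatedKahlerModule hJ hV hW).D
        (toFields hW A hA) (toFields hW B hB)) (toFields hW N fun _ => hN.contMDiffAt hW) = 0) :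
      inner ℝ (leviCivita E M B x (A x)) (N x) = 0 := by
    have h2 := congrFun h x
    simp only [foliatedKahlerModule, covariant_toFields] at h2
    rwa [innerFields_toFields hW _ _ hx] at h2
  have hz {X : Π x : M, TangentSpace 𝓘(ℝ, E) x} (hX : IsSectionOn (fun x => (V x)ᗮ) W X) :
      (foliatedKahlerModule hJ hV hW).v (toFields hW X fun _ => hX.contMDiffAt hW) = 0 :=
    vertFields_toFields_eq_zero hV hW hX
  have ha {X Y : Π x : M, TangentSpace 𝓘(ℝ, E) x} (hX : IsSectionOn (fun x => (V x)ᗮ) W X)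
      (hY : IsSectionOn (fun x => (V x)ᗮ) W Y) :
      toFields hW (vertDeriv V X Y) (fun x hx => contMDiffAt_vertDeriv hV.foliation.smooth
        (hX.contMDiffAt hW hx) (hY.contMDiffAt hW hx)) = (foliatedKahlerModule hJ hV hW).v
        ((foliatedKahlerModule hJ hV hW).D (toFields hW X fun _ => hX.contMDiffAt hW)
          (toFields hW Y fun _ => hY.contMDiffAt hW)) :=
    (vertFields_covariant_toFields hV hW _ _).symm
  rcases hA with hA | ⟨X, Y, hX, hY, rfl⟩ <;> rcases hB with hB | ⟨Z, Z', hZ, hZ', rfl⟩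
  · refine hc (fun _ => hA.contMDiffAt hW) (fun _ => hB.contMDiffAt hW) ?_
    rw [← FoliatedKahlerModule.g_v_right _ hN'.vertical]
    exact hN'.orthogonal (hz hA) (hz hB)
  · refine hc (fun _ => hA.contMDiffAt hW) (fun x hx => contMDiffAt_vertDeriv hV.foliation.smooth
        (hZ.contMDiffAt hW hx) (hZ'.contMDiffAt hW hx)) ?_
    rw [ha hZ hZ']
    exact FoliatedKahlerModule.inner_D_horizontal_a _ (hz hA) (hz hZ) (hz hZ') hN'
  · refine hc (fun x hx => contMDiffAt_vertDeriv hV.foliation.smooth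
        (hX.contMDiffAt hW hx) (hY.contMDiffAt hW hx)) (fun _ => hB.contMDiffAt hW) ?_
    rw [ha hX hY]
    exact FoliatedKahlerModule.inner_D_a_horizontal _ (hz hX) (hz hY) (hz hB) hN'.vertical
  · refine hc (fun x hx => contMDiffAt_vertDeriv hV.foliation.smooth
        (hX.contMDiffAt hW hx) (hY.contMDiffAt hW hx)) (fun x hx => contMDiffAt_vertDeriv
        hV.foliation.smooth (hZ.contMDiffAt hW hx) (hZ'.contMDiffAt hW hx)) ?_
    rw [ha hX hY, ha hZ hZ']
    exact FoliatedKahlerModule.inner_D_a_a _ (hz hZ) (hz hZ') (hz hX) (hz hY) hN'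

/-- `V₀` is involutive. -/
theorem mlieBracket_mem_vZero (hJ : IsKahler J) (hV : IsComplexRiemannianFoliationOn J univ V)
    {W : Set M} (hW : IsOpen W) {N N' : Π x : M, TangentSpace 𝓘(ℝ, E) x}
    (hN : IsSectionOn (vZero V) W N) (hN' : IsSectionOn (vZero V) W N') {x : M} (hx : x ∈ W) :
    mlieBracket 𝓘(ℝ, E) N N' x ∈ vZero V x := by
  refine ⟨hV.foliation.integrable.mlieBracket_mem (mem_univ x) (hN.contMDiffAt hW hx)
    (hN'.contMDiffAt hW hx) ?_ ?_, mem_aHH_orthogonal ?_⟩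
  · filter_upwards [hW.mem_nhds hx] with y hy using (hN.2 y hy).1
  · filter_upwards [hW.mem_nhds hx] with y hy using (hN'.2 y hy).1
  intro W' X Y hW' hx' hX hY
  have ho := hW.inter hW'
  have hxo : x ∈ W ∩ W' := ⟨hx, hx'⟩
  replace hN := hN.mono (inter_subset_left (t := W'))
  replace hN' := hN'.mono (inter_subset_left (t := W'))
  replace hX := hX.mono (inter_subset_right (s := W))
  replace hY := hY.mono (inter_subset_right (s := W))
  have h := (foliatedKahlerModule hJ hV ho).inner_bracket_a (vertFields_toFields_eq_zero hV ho hX)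
    (vertFields_toFields_eq_zero hV ho hY) (isFlat_toFields hJ hV ho hN)
    (isFlat_toFields hJ hV ho hN')
  have h2 := congrFun h x
  simp only [foliatedKahlerModule, vertFields_covariant_toFields] at h2
  rw [innerFields_apply, covariant_sub_covariant ho _ _ hxo, toFields_apply ho _ hxo] at h2
  rw [real_inner_comm]
  refine Eq.trans ?_ h2
  congr 1
  refine (Filter.EventuallyEq.mlieBracket_vectorField_eq ?_ ?_).symm
  · exact cutoff_eventuallyEq ho N hxo
  · exact cutoff_eventuallyEq ho N' hxo

/-- `J (A_X Y) = A_X (J Y)` shows that `A_H H` is `J`-stable; an isometry with `J² = -1` then also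
preserves its orthogonal complement. -/
theorem IsKahler.mem_vZero (hJ : IsKahler J) (hV : IsComplexRiemannianFoliationOn J univ V) {x : M}
    {v : TangentSpace 𝓘(ℝ, E) x} (hv : v ∈ vZero V x) : J x v ∈ vZero V x := by
  refine ⟨hV.complex x (mem_univ x) v hv.1, hJ.mem_orthogonal (fun w hw => ?_) hv.2⟩
  rw [aHH_eq_span] at hw
  induction hw using Submodule.span_induction with
  | mem w hw =>
    obtain ⟨W, X, Y, hW, hx, hX, hY, rfl⟩ := hw
    have hJY : IsSectionOn (fun y => (V y)ᗮ) W fun y => J y (Y y) :=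
      ⟨fun y hy => (hJ.contMDiffAt (hY.contMDiffAt hW hy)).contMDiffWithinAt,
        fun y hy => hJ.mem_orthogonal (hV.complex y (mem_univ y)) (hY.2 y hy)⟩
    have h := vertDeriv_mem_aHH hW hX hJY hx
    rw [vertDeriv, vert, hJ.parallel Y x (mdiffAt_of_smooth (hY.contMDiffAt hW hx)),
      hJ.starProjection (hV.complex x (mem_univ x))] at h
    exact h
  | zero => rw [map_zero]; exact Submodule.zero_mem _
  | add v w _ _ hv hw => rw [map_add]; exact Submodule.add_mem _ hv hw
  | smul c v _ hv => rw [map_smul]; exact Submodule.smul_mem _ _ hv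

end Sections

/-! ### Smoothness, polarity and non-triviality of V₀ -/

section Polar

set_option linter.unusedSectionVars false

variable {E : Type*} [NormedAddCommGroup E] [NormedSpace ℝ E]
  {M : Type*} [TopologicalSpace M] [ChartedSpace E M] [IsManifold 𝓘(ℝ, E) ∞ M]
  [FiniteDimensional ℝ E]

/-- Every tangent vector extends to a smooth vector field on a neighbourhood. -/
theorem exists_smooth_extend_nhds (x : M) (u : TangentSpace 𝓘(ℝ, E) x) :
    ∃ (W : Set M) (X : Π x : M, TangentSpace 𝓘(ℝ, E) x), IsOpen W ∧ x ∈ W ∧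
      (∀ y ∈ W, CMDiffAt ∞ (T% X) y) ∧ X x = u := by
  obtain ⟨W, hW, hx, X, hX, hXW⟩ := exists_smooth_frame (E := E) x
  have hu : u ∈ Submodule.span ℝ (range fun i => X i x) := by rw [(hXW x hx).2]; trivial
  obtain ⟨c, hc⟩ := (Submodule.mem_span_range_iff_exists_fun ℝ).1 hu
  refine ⟨W, fun y => ∑ i, c i • X i y, hW, hx, fun y hy => ?_, hc⟩
  exact ContMDiffAt.sum_section fun i _ =>
    ((hX i).contMDiffAt (hW.mem_nhds hy)).const_smul_section

theorem IsSmoothDistributionOn.mono {U U' : Set M}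
    {D : Π x : M, Submodule ℝ (TangentSpace 𝓘(ℝ, E) x)} (hD : IsSmoothDistributionOn U D)
    (hU' : IsOpen U') (h : U' ⊆ U) : IsSmoothDistributionOn U' D := by
  intro p hp
  obtain ⟨W, -, hW, hpW, k, X, hX, hXD⟩ := hD p (h hp)
  exact ⟨W ∩ U', inter_subset_right, hW.inter hU', ⟨hpW, hp⟩, k, X,
    fun i => (hX i).mono inter_subset_left, fun x hx => hXD x hx.1⟩

variable [RiemannianBundle (fun x : M => TangentSpace 𝓘(ℝ, E) x)]
  [IsContMDiffRiemannianBundle 𝓘(ℝ, E) ∞ E (fun x : M => TangentSpace 𝓘(ℝ, E) x)]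

/-- Around a point where its rank is maximal, a distribution spanned there by smooth sections has
a smooth frame. -/
theorem exists_smooth_frame_of_span {D : Π x : M, Submodule ℝ (TangentSpace 𝓘(ℝ, E) x)}
    {Ω : Set M} (hΩ : IsOpen Ω) {q : M} (hq : q ∈ Ω)
    (hspan : D q ≤ Submodule.span ℝ {u | ∃ (W : Set M) (X : Π x : M, TangentSpace 𝓘(ℝ, E) x),
      IsOpen W ∧ q ∈ W ∧ IsSectionOn D W X ∧ u = X q})
    (hrank : ∀ y ∈ Ω, Module.finrank ℝ (D y) ≤ Module.finrank ℝ (D q)) :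
    ∃ W ⊆ Ω, IsOpen W ∧ q ∈ W ∧ ∃ (k : ℕ) (X : Fin k → Π x : M, TangentSpace 𝓘(ℝ, E) x),
      (∀ i, CMDiff[W] ∞ (T% (X i))) ∧
      ∀ x ∈ W, LinearIndependent ℝ (fun i => X i x) ∧
        Submodule.span ℝ (range fun i => X i x) = D x := by
  set s := {u | ∃ (W : Set M) (X : Π x : M, TangentSpace 𝓘(ℝ, E) x),
      IsOpen W ∧ q ∈ W ∧ IsSectionOn D W X ∧ u = X q} with hs
  have hsD : Submodule.span ℝ s = D q := by
    refine le_antisymm (Submodule.span_le.2 ?_) hspan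
    rintro _ ⟨W, X, -, hqW, hX, rfl⟩
    exact hX.2 q hqW
  obtain ⟨f, hfs, hfspan, hfli⟩ := Submodule.exists_fun_fin_finrank_span_eq ℝ s
  choose W X hW hqW hX hfX using hfs
  have hfX' : f = fun i => X i q := funext hfX
  set Ω' := Ω ∩ ⋂ i, W i with hΩ'
  have hΩ'o : IsOpen Ω' := hΩ.inter (isOpen_iInter_of_finite hW)
  have hΩ'W {y : M} (hy : y ∈ Ω') (i) : y ∈ W i := mem_iInter.1 hy.2 i
  -- Non-vanishing of the Gram determinant keeps the chosen sections independent near `q`;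
  -- maximality of the rank at `q` then forces them to span.
  have hdet : ContinuousOn (fun y => (Matrix.gram ℝ fun i => X i y).det) Ω' := by
    refine continuousOn_of_forall_continuousAt fun y hy => ?_
    refine (continuous_id.matrix_det).continuousAt.comp (f := fun y => Matrix.gram ℝ fun i => X i y)
      (g := Matrix.det) ?_
    exact continuousAt_pi.2 fun i => continuousAt_pi.2 fun j =>
      (contMDiffAt_inner ((hX i).contMDiffAt (hW i) (hΩ'W hy i))
        ((hX j).contMDiffAt (hW j) (hΩ'W hy j))).continuousAt
  refine ⟨Ω' ∩ (fun y => (Matrix.gram ℝ fun i => X i y).det) ⁻¹' {0}ᶜ,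
    fun y hy => hy.1.1, hdet.isOpen_inter_preimage hΩ'o isOpen_compl_singleton,
    ⟨⟨hq, mem_iInter.2 hqW⟩, ?_⟩, _, X,
    fun i => (hX i).1.mono fun y hy => hΩ'W hy.1 i, fun y hy => ?_⟩
  · rw [hfX'] at hfli
    exact (Matrix.posDef_gram_of_linearIndependent (𝕜 := ℝ)
      (E := TangentSpace 𝓘(ℝ, E) q) hfli).det_pos.ne'
  · have hli : LinearIndependent ℝ fun i => X i y := by
      refine Fintype.linearIndependent_iff.2 fun c hc i => ?_
      refine congrFun (Matrix.eq_zero_of_mulVec_eq_zero hy.2 ?_) i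
      ext j
      have : ∑ i, inner ℝ (X j y) (c i • X i y) = 0 := by rw [← inner_sum, hc, inner_zero_right]
      simpa [Matrix.mulVec, dotProduct, Matrix.gram_apply, real_inner_smul_right, mul_comm]
        using this
    refine ⟨hli, Submodule.eq_of_le_of_finrank_le (Submodule.span_le.2 ?_) ?_⟩
    · rintro _ ⟨i, rfl⟩
      exact (hX i).2 y (hΩ'W hy.1 i)
    · rw [finrank_span_eq_card hli, Fintype.card_fin, hsD]
      exact hrank y hy.1.1

theorem finrank_eq_of_frame {k : ℕ} {x : M} {X : Fin k → TangentSpace 𝓘(ℝ, E) x}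
    {K : Submodule ℝ (TangentSpace 𝓘(ℝ, E) x)}
    (h : LinearIndependent ℝ X ∧ Submodule.span ℝ (range X) = K) : Module.finrank ℝ K = k := by
  rw [← h.2, finrank_span_eq_card h.1, Fintype.card_fin]

/-- The orthogonal complement of a smooth distribution in another one is smooth. -/
theorem IsSmoothDistributionOn.inf_orthogonal {U : Set M}
    {D₁ D₂ : Π x : M, Submodule ℝ (TangentSpace 𝓘(ℝ, E) x)} (h₁ : IsSmoothDistributionOn U D₁)
    (h₂ : IsSmoothDistributionOn U D₂) (h : ∀ x ∈ U, D₁ x ≤ D₂ x) :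
    IsSmoothDistributionOn U fun x => D₂ x ⊓ (D₁ x)ᗮ := by
  intro q hq
  obtain ⟨W₁, hW₁U, hW₁, hqW₁, k₁, X₁, -, hX₁⟩ := h₁ q hq
  obtain ⟨W₂, -, hW₂, hqW₂, k₂, X₂, -, hX₂⟩ := h₂ q hq
  -- The rank of the complement is locally constant, equal to `k₂ - k₁`, so the maximality
  -- hypothesis of the frame lemma holds.
  have hr {y : M} (hy : y ∈ W₁ ∩ W₂) :
      k₁ + Module.finrank ℝ (D₂ y ⊓ (D₁ y)ᗮ : Submodule ℝ (TangentSpace 𝓘(ℝ, E) y)) = k₂ := by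
    rw [inf_comm, ← finrank_eq_of_frame (hX₁ y hy.1), ← finrank_eq_of_frame (hX₂ y hy.2)]
    exact Submodule.finrank_add_inf_finrank_orthogonal (h y (hW₁U hy.1))
  suffices h : ∃ W ⊆ W₁ ∩ W₂, _ from
    let ⟨W, hW, hX⟩ := h
    ⟨W, fun y hy => hW₁U (hW hy).1, hX⟩
  refine exists_smooth_frame_of_span (D := fun x => D₂ x ⊓ (D₁ x)ᗮ)
    (hW₁.inter hW₂) ⟨hqW₁, hqW₂⟩ (fun v hv => ?_) (fun y hy => ?_)
  · obtain ⟨W, X, hWo, hqW, hX, rfl⟩ := exists_smooth_extend_nhds q v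
    -- A section through `v`: extend `v` smoothly, project to `D₂`, then remove the component in
    -- `D₁`. Neither projection changes `v`.
    have hV : IsSectionOn D₂ (W ∩ W₁) (vert D₂ X) :=
      isSectionOn_vert h₂ (fun y hy => hW₁U hy.2) fun y hy => hX y hy.1
    have hH : IsSectionOn (fun x => (D₁ x)ᗮ) (W ∩ W₁) (hor D₁ (vert D₂ X)) :=
      isSectionOn_hor h₁ (fun y hy => hW₁U hy.2) fun y hy =>
        hV.contMDiffAt (hWo.inter hW₁) hy
    refine Submodule.subset_span ⟨W ∩ W₁, hor D₁ (vert D₂ X), hWo.inter hW₁, ⟨hqW, hqW₁⟩,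
      ⟨hH.1, fun y hy => ⟨?_, hH.2 y hy⟩⟩, ?_⟩
    · rw [hor_apply]
      exact Submodule.sub_mem _ (hV.2 y hy)
        (h y (hW₁U hy.2) (Submodule.starProjection_apply_mem _ _))
    · rw [hor, Submodule.starProjection_eq_self_iff.2]
      · exact (vert_eq_self_iff.2 hv.1).symm
      · rw [vert_eq_self_iff.2 hv.1]
        exact hv.2
  · have e₁ := hr hy
    have e₂ := hr ⟨hqW₁, hqW₂⟩
    change Module.finrank ℝ (D₂ y ⊓ (D₁ y)ᗮ : Submodule ℝ (TangentSpace 𝓘(ℝ, E) y))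
      ≤ Module.finrank ℝ (D₂ q ⊓ (D₁ q)ᗮ : Submodule ℝ (TangentSpace 𝓘(ℝ, E) q))
    omega

variable {J : Π x : M, TangentSpace 𝓘(ℝ, E) x →L[ℝ] TangentSpace 𝓘(ℝ, E) x}
  {V : Π x : M, Submodule ℝ (TangentSpace 𝓘(ℝ, E) x)}

/-- `(V ⊓ (A_H H)ᗮ)ᗮ = Vᗮ ⊔ A_H H`, and both summands are spanned by values of smooth sections. No
constancy of the rank of `A_H H` is needed. -/
theorem vZero_orthogonal_le (hV : IsSmoothDistributionOn univ V) (x : M) :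
    (vZero V x)ᗮ ≤ Submodule.span ℝ {u | ∃ (W : Set M) (B : Π x : M, TangentSpace 𝓘(ℝ, E) x),
      IsOpen W ∧ x ∈ W ∧ IsConullOn V W B ∧ u = B x} := by
  have h : (vZero V x)ᗮ = (V x)ᗮ ⊔ aHH V x := by
    rw [vZero, ← Submodule.orthogonal_orthogonal ((V x)ᗮ ⊔ aHH V x), ← Submodule.inf_orthogonal,
      Submodule.orthogonal_orthogonal]
  rw [h, aHH_eq_span]
  refine sup_le (fun u hu => ?_) (Submodule.span_le.2 ?_)
  · obtain ⟨W, X, hW, hx, hX, rfl⟩ := exists_smooth_extend_nhds x u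
    exact Submodule.subset_span ⟨W, hor V X, hW, hx, Or.inl (isSectionOn_hor hV (subset_univ _) hX),
      (Submodule.starProjection_eq_self_iff.2 hu).symm⟩
  · rintro _ ⟨W, X, Y, hW, hx, hX, hY, rfl⟩
    exact Submodule.subset_span ⟨W, vertDeriv V X Y, hW, hx, Or.inr ⟨X, Y, hX, hY, rfl⟩, rfl⟩

/-- The derivatives of a section of `V₀` in the directions orthogonal to `V₀` are tangent to
`V₀`. -/
theorem inner_leviCivita_vZero (hJ : IsKahler J) (hV : IsComplexRiemannianFoliationOn J univ V)
    {W : Set M} (hW : IsOpen W) {N : Π x : M, TangentSpace 𝓘(ℝ, E) x}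
    (hN : IsSectionOn (vZero V) W N) {x : M} (hx : x ∈ W) {ξ η : TangentSpace 𝓘(ℝ, E) x}
    (hξ : ξ ∈ (vZero V x)ᗮ) (hη : η ∈ (vZero V x)ᗮ) :
    inner ℝ η (leviCivita E M N x ξ) = 0 := by
  replace hξ := vZero_orthogonal_le hV.foliation.smooth x hξ
  replace hη := vZero_orthogonal_le hV.foliation.smooth x hη
  -- The expression is linear in the vectors `ξ` and `η`, so they may be taken to be values of
  -- sections `A` and `B` of the spanning family. Differentiating `⟨B, N⟩ = 0` then reduces the
  -- claim to `inner_leviCivita_conull`.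
  induction hξ using Submodule.span_induction with
  | mem ξ hξ =>
    obtain ⟨W₁, A, hW₁, hx₁, hA, rfl⟩ := hξ
    induction hη using Submodule.span_induction with
    | mem η hη =>
      obtain ⟨W₂, B, hW₂, hx₂, hB, rfl⟩ := hη
      have ho := (hW.inter hW₁).inter hW₂
      have hxo : x ∈ W ∩ W₁ ∩ W₂ := ⟨⟨hx, hx₁⟩, hx₂⟩
      replace hN := hN.mono (W' := W ∩ W₁ ∩ W₂) fun y hy => hy.1.1
      replace hA := hA.mono (W' := W ∩ W₁ ∩ W₂) fun y hy => hy.1.2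
      replace hB := hB.mono (W' := W ∩ W₁ ∩ W₂) fun y hy => hy.2
      have h0 : (fun y => (inner ℝ (B y) (N y) : ℝ)) =ᶠ[𝓝 x] fun _ => 0 := by
        filter_upwards [ho.mem_nhds hxo] with y hy
        exact hB.inner_eq_zero ho hN hy
      have h := leviCivita_metric
        (mdiffAt_of_smooth (hA.contMDiffAt hV.foliation.smooth ho hxo))
        (mdiffAt_of_smooth (hB.contMDiffAt hV.foliation.smooth ho hxo))
        (mdiffAt_of_smooth (hN.contMDiffAt ho hxo))
      rw [mvfderiv_congr h0, mvfderiv_const, inner_leviCivita_conull hJ hV ho hA hB hN hxo,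
        zero_add] at h
      exact h.symm
    | zero => exact inner_zero_left _
    | add v w _ _ hv hw => rw [inner_add_left, hv, hw, add_zero]
    | smul c v _ hv => rw [real_inner_smul_left, hv, mul_zero]
  | zero => rw [map_zero, inner_zero_right]
  | add v w _ _ hv hw => rw [map_add, inner_add_right, hv, hw, add_zero]
  | smul c v _ hv => rw [map_smul, real_inner_smul_right, hv, mul_zero]

theorem isPolarOn_vZero (hJ : IsKahler J) (hV : IsComplexRiemannianFoliationOn J univ V)
    {U : Set M} (hD : IsSmoothDistributionOn U (vZero V)) : IsPolarOn U (vZero V) := by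
  intro W hWU hW X Y hX hY x hx
  have hYs {y : M} (hy : y ∈ W) : CMDiffAt ∞ (T% Y) y := (hY y hy).contMDiffAt (hW.mem_nhds hy)
  have hξ : hor (vZero V) X x ∈ (vZero V x)ᗮ := Submodule.starProjection_apply_mem _ _
  have hv := isSectionOn_vert hD hWU fun y hy => hYs hy
  have hh := isSectionOn_hor hD hWU fun y hy => hYs hy
  -- The metric property moves the derivative from a field orthogonal to `V₀` onto a section of
  -- `V₀`.
  have h1 : (vZero V x).starProjection
      (leviCivita E M (hor (vZero V) Y) x (hor (vZero V) X x)) = 0 := by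
    rw [Submodule.starProjection_apply_eq_zero_iff, Submodule.mem_orthogonal']
    intro u hu
    obtain ⟨W', N, hW', hxW', hN, rfl⟩ := exists_smooth_extend_nhds x u
    have ho := hW.inter hW'
    have hxo : x ∈ W ∩ W' := ⟨hx, hxW'⟩
    have hN' : IsSectionOn (vZero V) (W ∩ W') (vert (vZero V) N) :=
      isSectionOn_vert hD (fun y hy => hWU hy.1) fun y hy => hN y hy.2
    have h0 : (fun y => (inner ℝ (hor (vZero V) Y y) (vert (vZero V) N y) : ℝ))
        =ᶠ[𝓝 x] fun _ => 0 := by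
      filter_upwards [ho.mem_nhds hxo] with y hy
      rw [real_inner_comm]
      exact hh.2 y hy.1 _ (hN'.2 y hy)
    obtain ⟨W₁, A, hW₁, hxW₁, hA, hAx⟩ := exists_smooth_extend_nhds x (hor (vZero V) X x)
    have h := leviCivita_metric (mdiffAt_of_smooth (hA x hxW₁))
      (mdiffAt_of_smooth (hh.contMDiffAt hW hx)) (mdiffAt_of_smooth (hN'.contMDiffAt ho hxo))
    rw [mvfderiv_congr h0, mvfderiv_const, hAx,
      inner_leviCivita_vZero hJ hV ho hN' hxo hξ (hh.2 x hx), add_zero,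
      vert_eq_self_iff.2 hu] at h
    exact h.symm
  have h2 : (vZero V x)ᗮ.starProjection
      (leviCivita E M (vert (vZero V) Y) x (hor (vZero V) X x)) = 0 := by
    rw [Submodule.starProjection_apply_eq_zero_iff, Submodule.mem_orthogonal]
    exact fun u hu => inner_leviCivita_vZero hJ hV hW hv hx hξ hu
  rw [oneillA, h1, h2, add_zero]

/-- `(L_N g)(X, Y) = ⟨∇_X N, Y⟩ + ⟨X, ∇_Y N⟩`, and here each summand vanishes separately. -/
theorem isRiemannianOn_vZero (hJ : IsKahler J) (hV : IsComplexRiemannianFoliationOn J univ V)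
    (U : Set M) : IsRiemannianOn U (vZero V) := by
  intro W _ hW N X Y hN hX hY x hx
  have hNs := mdiffAt_of_smooth (hN.contMDiffAt hW hx)
  have hXs := mdiffAt_of_smooth (hX.contMDiffAt hW hx)
  have hYs := mdiffAt_of_smooth (hY.contMDiffAt hW hx)
  rw [leviCivita_metric hNs hXs hYs, ← leviCivita_torsionFree hNs hXs,
    ← leviCivita_torsionFree hNs hYs, inner_sub_left, inner_sub_right,
    inner_leviCivita_vZero hJ hV hW hN hx (hY.2 x hx) (hX.2 x hx), real_inner_comm (Y x),
    real_inner_comm (Y x) (leviCivita E M N x (X x)),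
    inner_leviCivita_vZero hJ hV hW hN hx (hX.2 x hx) (hY.2 x hx), sub_zero, sub_zero]

theorem isComplexRiemannianFoliationOn_vZero (hJ : IsKahler J)
    (hV : IsComplexRiemannianFoliationOn J univ V) {U : Set M}
    (hD : IsSmoothDistributionOn U (vZero V)) :
    IsComplexRiemannianFoliationOn J U (vZero V) where
  foliation := ⟨hD, isIntegrableOn_of_mlieBracket_mem hD fun _ _ hW _ _ hX hY _ hx =>
    mlieBracket_mem_vZero hJ hV hW hX hY hx⟩
  complex _ _ _ hv := hJ.mem_vZero hV hv
  riemannian := isRiemannianOn_vZero hJ hV U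

/-- A non-empty open set contains an open set on which `V₀` is a smooth distribution. -/
theorem exists_isSmoothDistributionOn_vZero (hV : IsSmoothDistributionOn univ V) {O : Set M}
    (hO : IsOpen O) (hne : O.Nonempty) :
    ∃ U ⊆ O, IsOpen U ∧ U.Nonempty ∧ IsSmoothDistributionOn U (vZero V) := by
  -- The rank of `A_H H` is bounded by the dimension, so it attains a maximum on `O`; near such a
  -- point `A_H H` has a smooth frame.
  obtain ⟨p, hp, hmax⟩ : ∃ p ∈ O, ∀ y ∈ O,
      Module.finrank ℝ (aHH V y) ≤ Module.finrank ℝ (aHH V p) := by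
    have hfin : ((fun y => Module.finrank ℝ (aHH V y)) '' O).Finite := by
      refine (finite_Iic (Module.finrank ℝ E)).subset ?_
      rintro _ ⟨y, -, rfl⟩
      exact Submodule.finrank_le (aHH V y)
    obtain ⟨_, ⟨⟨p, hp, rfl⟩, h⟩⟩ := hfin.exists_maximal (hne.image _)
    refine ⟨p, hp, fun y hy => ?_⟩
    by_contra! hlt
    exact hlt.not_ge (h ⟨y, hy, rfl⟩ hlt.le)
  obtain ⟨U, hUO, hU, hpU, k, X, hX, hXU⟩ := exists_smooth_frame_of_span hO hp (by
    nth_rw 1 [aHH_eq_span]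
    refine Submodule.span_mono ?_
    rintro _ ⟨W, X, Y, hW, hpW, hX, hY, rfl⟩
    exact ⟨W, vertDeriv V X Y, hW, hpW, ⟨fun y hy => (contMDiffAt_vertDeriv hV
      (hX.contMDiffAt hW hy) (hY.contMDiffAt hW hy)).contMDiffWithinAt,
      fun y hy => vertDeriv_mem_aHH hW hX hY hy⟩, rfl⟩) hmax
  refine ⟨U, hUO, hU, ⟨p, hpU⟩, ?_⟩
  refine IsSmoothDistributionOn.inf_orthogonal (D₁ := aHH V) (D₂ := V)
    (fun q hq => ⟨U, subset_rfl, hU, hq, k, X, hX, hXU⟩) (hV.mono hU (subset_univ _))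
    fun x _ => aHH_le x

/-- If the foliation is not totally geodesic then `V₀` is non-zero on a non-empty open set. -/
theorem exists_vZero_ne_bot (hJ : IsKahler J) (hV : IsComplexRiemannianFoliationOn J univ V)
    (hT : ¬ IsTotallyGeodesicOn univ V) :
    ∃ O : Set M, IsOpen O ∧ O.Nonempty ∧ ∀ x ∈ O, vZero V x ≠ ⊥ := by
  -- Non-vanishing of `T_U Z` is an open condition, and its values lie in `V₀`.
  have key {W : Set M} (hW : IsOpen W) {U Z : Π x : M, TangentSpace 𝓘(ℝ, E) x}
      (hU : IsSectionOn V W U) (hZ : IsSectionOn (fun x => (V x)ᗮ) W Z) {x : M} (hx : x ∈ W)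
      (h0 : vertDeriv V U Z x ≠ 0) :
      ∃ O : Set M, IsOpen O ∧ O.Nonempty ∧ ∀ x ∈ O, vZero V x ≠ ⊥ := by
    have hs {y : M} (hy : y ∈ W) : CMDiffAt ∞ (T% (vertDeriv V U Z)) y :=
      contMDiffAt_vertDeriv hV.foliation.smooth (hU.contMDiffAt hW hy) (hZ.contMDiffAt hW hy)
    have hc : ContinuousOn (fun y => inner ℝ (vertDeriv V U Z y) (vertDeriv V U Z y)) W :=
      continuousOn_of_forall_continuousAt fun y hy =>
        (contMDiffAt_inner (hs hy) (hs hy)).continuousAt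
    refine ⟨_, hc.isOpen_inter_preimage hW isOpen_compl_singleton (t := {0}ᶜ),
      ⟨x, hx, fun h => h0 (inner_self_eq_zero.1 h)⟩, fun y hy hbot => hy.2 ?_⟩
    have := vertDeriv_mem_vZero hJ hV hW hU hZ hy.1
    rw [hbot, Submodule.mem_bot] at this
    simp [this]
  simp only [IsTotallyGeodesicOn, not_forall] at hT
  obtain ⟨W, -, hW, X, Y, hX, hY, x, hx, hT⟩ := hT
  have hXs {y : M} (hy : y ∈ W) : CMDiffAt ∞ (T% X) y := (hX y hy).contMDiffAt (hW.mem_nhds hy)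
  have hYs {y : M} (hy : y ∈ W) : CMDiffAt ∞ (T% Y) y := (hY y hy).contMDiffAt (hW.mem_nhds hy)
  have hVs := hV.foliation.smooth
  have hU := isSectionOn_vert hVs (subset_univ W) fun y hy => hXs hy
  have hU' := isSectionOn_vert hVs (subset_univ W) fun y hy => hYs hy
  have hZ := isSectionOn_hor hVs (subset_univ W) fun y hy => hYs hy
  by_cases h0 : vertDeriv V (vert V X) (hor V Y) x = 0
  · have h1 : oneillT V X Y x
        = hor V (fun y => leviCivita E M (vert V Y) y (vert V X y)) x := by
      change _ + vertDeriv V (vert V X) (hor V Y) x = _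
      rw [h0, add_zero]
      rfl
    rw [h1] at hT
    -- Only the horizontal half of `T` is non-zero at `x`. With `Z = hor V A`, differentiating `⟨Z,
    -- vert V Y⟩ = 0` gives `⟨T_U Z, vert V Y⟩ = -‖Z‖²`, so the vertical half is non-zero for this
    -- other `Z`.
    set A : Π x : M, TangentSpace 𝓘(ℝ, E) x :=
      fun y => leviCivita E M (vert V Y) y (vert V X y) with hA
    have hZ' : IsSectionOn (fun x => (V x)ᗮ) W (hor V A) :=
      isSectionOn_hor hVs (subset_univ W) fun y hy => contMDiffAt_leviCivita
        (hU.contMDiffAt hW hy) (hU'.contMDiffAt hW hy)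
    refine key hW hU hZ' hx fun h => hT ?_
    have hz : (fun y => (inner ℝ (hor V A y) (vert V Y y) : ℝ)) =ᶠ[𝓝 x] fun _ => 0 := by
      filter_upwards [hW.mem_nhds hx] with y hy
      rw [real_inner_comm]
      exact hZ'.2 y hy _ (hU'.2 y hy)
    have hm := leviCivita_metric (mdiffAt_of_smooth (hU.contMDiffAt hW hx))
      (mdiffAt_of_smooth (hZ'.contMDiffAt hW hx)) (mdiffAt_of_smooth (hU'.contMDiffAt hW hx))
    have hi : inner ℝ (leviCivita E M (hor V A) x (vert V X x)) (vert V Y x) = 0 := by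
      have := congrArg (fun v => (inner ℝ v (vert V Y x) : ℝ)) h
      simp only [vertDeriv, inner_zero_left] at this
      rw [vert, Submodule.inner_starProjection_left_eq_right,
        Submodule.starProjection_eq_self_iff.2 (hU'.2 x hx)] at this
      exact this
    rw [mvfderiv_congr hz, mvfderiv_const, hi, zero_add] at hm
    rw [← inner_self_eq_zero (𝕜 := ℝ)]
    refine Eq.trans ?_ hm.symm
    nth_rw 2 [hor_apply]
    rw [inner_sub_right, real_inner_comm (vert V A x),
      hZ'.2 x hx (vert V A x) (Submodule.starProjection_apply_mem _ _), sub_zero]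
  · exact key hW hU hZ hx h0

end Polar

end KahlerFoliation

theorem theorem1p2
    {E : Type*} [NormedAddCommGroup E] [NormedSpace ℝ E] [FiniteDimensional ℝ E]
    {M : Type*} [TopologicalSpace M] [ChartedSpace E M] [IsManifold 𝓘(ℝ, E) ∞ M]
    [RiemannianBundle (fun x : M => TangentSpace 𝓘(ℝ, E) x)]
    [IsContMDiffRiemannianBundle 𝓘(ℝ, E) ∞ E (fun x : M => TangentSpace 𝓘(ℝ, E) x)]
    (J : Π x : M, TangentSpace 𝓘(ℝ, E) x →L[ℝ] TangentSpace 𝓘(ℝ, E) x)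
    (hJ : KahlerFoliation.IsKahler J)
    (V : Π x : M, Submodule ℝ (TangentSpace 𝓘(ℝ, E) x))
    (hV : KahlerFoliation.IsComplexRiemannianFoliationOn J univ V) :
    KahlerFoliation.IsTotallyGeodesicOn univ V ∨
      ∃ U : Set M, IsOpen U ∧ IsConnected U ∧
        (∀ x ∈ U, KahlerFoliation.vZero V x ≠ ⊥) ∧
        KahlerFoliation.IsComplexRiemannianFoliationOn J U (KahlerFoliation.vZero V) ∧
        KahlerFoliation.IsPolarOn U (KahlerFoliation.vZero V) := by
  refine or_iff_not_imp_left.2 fun hT => ?_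
  obtain ⟨O, hO, hne, hbot⟩ := KahlerFoliation.exists_vZero_ne_bot hJ hV hT
  obtain ⟨U, hUO, hU, ⟨p, hp⟩, hD⟩ :=
    KahlerFoliation.exists_isSmoothDistributionOn_vZero hV.foliation.smooth hO hne
  -- Local connectedness makes the component of `p` in `U` open, and all the properties of `U`
  -- restrict to it.
  have : LocallyConnectedSpace M := ChartedSpace.locallyConnectedSpace E M
  have hsub := connectedComponentIn_subset U p
  have ho := hU.connectedComponentIn (x := p)
  have hD' := hD.mono ho hsub
  exact ⟨connectedComponentIn U p, ho, isConnected_connectedComponentIn_iff.2 hp,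
    fun x hx => hbot x (hUO (hsub hx)),
    KahlerFoliation.isComplexRiemannianFoliationOn_vZero hJ hV hD',
    KahlerFoliation.isPolarOn_vZero hJ hV hD'⟩
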